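/- Let $N\ge 1$, $1<p<\infty$, $0<s<1$ and $A>0$. Let $\Omega,\Omega'\subset\mathbb{R}^N$ be bounded open sets with $\Omega\Subset\Omega'$ (that is, $\overline\Omega\subset\Omega'$). Let $f\in L^q(\Omega)$, where $1\le q\le\infty$ satisfies $$q\ge \frac{Np}{Np-N+p}\ \text{ if } p<N,\qquad q>1\ \text{ if } p=N,\qquad q\ge 1\ \text{ if } p>N$$ (that is, $q\ge (p^*)'$ if $p\ne N$, with $p^*$ the Sobolev exponent). Let $g\in W^{1,p}(\Omega')\cap L^{p-1}_{sp}(\mathbb{R}^N)$, where $$L^{p-1}_{sp}(\mathbb{R}^N)=\Big\{u\in L^{p-1}_{\rm loc}(\mathbb{R}^N)\,:\,\int_{\mathbb{R}^N}\frac{|u(x)|^{p-1}}{1+|x|^{N+sp}}\,dx<\infty\Big\}.$$ Let $W^{1,p}_0(\Omega)$ be the closure of $C_c^\infty(\Omega)$ in $W^{1,p}(\Omega)$, its elements being extended by $0$ outside $\Omega$, and let $$W^{1,p}_g(\Omega)=\{v\in W^{1,p}(\Omega)\cap L^{p-1}_{sp}(\mathbb{R}^N)\,:\, v-g\in W^{1,p}_0(\Omega)\},$$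 where its elements are extended by $g$ outside $\Omega$. Then there is a unique (up to equality almost everywhere) weak solution $u\in W^{1,p}_g(\Omega)$ of the Dirichlet problem $$-\Delta_p u+A(-\Delta_p)^s u=f\ \text{ in }\Omega,\qquad u=g\ \text{ in }\mathbb{R}^N\setminus\Omega,$$ that is, a unique $u\in W^{1,p}_g(\Omega)$ such that for every $\varphi\in W^{1,p}_0(\Omega)$ the following integrals converge absolutely and $$\int_\Omega|\nabla u|^{p-2}\nabla u\cdot\nabla\varphi\,dx+A\int_{\mathbb{R}^N}\int_{\mathbb{R}^N}\frac{|u(x)-u(y)|^{p-2}(u(x)-u(y))(\varphi(x)-\varphi(y))}{|x-y|^{N+sp}}\,dx\,dy=\int_\Omega f\varphi\,dx.$$ -/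

import Mathlib

open MeasureTheory Filter Topology
open scoped ENNReal ContDiff

/-- `ψ ∈ C_c^∞(Ω)`: smooth, with compact support contained in `Ω`. -/
structure IsTestFunction {N : ℕ} (Ω : Set (EuclideanSpace ℝ (Fin N)))
    (ψ : EuclideanSpace ℝ (Fin N) → ℝ) : Prop where
  smooth : ContDiff ℝ ∞ ψ
  compact : HasCompactSupport ψ
  support_subset : tsupport ψ ⊆ Ω

/-- `G` is the weak (distributional) gradient of `u` in the open set `Ω`. -/
structure IsWeakGradient {N : ℕ} (Ω : Set (EuclideanSpace ℝ (Fin N)))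
    (u : EuclideanSpace ℝ (Fin N) → ℝ)
    (G : EuclideanSpace ℝ (Fin N) → EuclideanSpace ℝ (Fin N)) : Prop where
  locallyIntegrable : LocallyIntegrableOn u Ω
  locallyIntegrable_grad : LocallyIntegrableOn G Ω
  integral_eq : ∀ ψ : EuclideanSpace ℝ (Fin N) → ℝ, IsTestFunction Ω ψ →
    ∫ x in Ω, u x • gradient ψ x = - ∫ x in Ω, ψ x • G x

/-- `u ∈ W^{1,p}(Ω)`; the values of `u` outside `Ω` are irrelevant. -/
def MemW1p {N : ℕ} (Ω : Set (EuclideanSpace ℝ (Fin N))) (p : ℝ)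
    (u : EuclideanSpace ℝ (Fin N) → ℝ) : Prop :=
  MemLp u (ENNReal.ofReal p) (volume.restrict Ω) ∧
    ∃ G : EuclideanSpace ℝ (Fin N) → EuclideanSpace ℝ (Fin N),
      IsWeakGradient Ω u G ∧ MemLp G (ENNReal.ofReal p) (volume.restrict Ω)

/-- `u ∈ W_0^{1,p}(Ω)`: the closure of `C_c^∞(Ω)` in `W^{1,p}(Ω)`; the values of `u` outside `Ω`
are irrelevant. -/
def MemW1pZero {N : ℕ} (Ω : Set (EuclideanSpace ℝ (Fin N))) (p : ℝ)
    (u : EuclideanSpace ℝ (Fin N) → ℝ) : Prop :=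
  MemLp u (ENNReal.ofReal p) (volume.restrict Ω) ∧
    ∃ G : EuclideanSpace ℝ (Fin N) → EuclideanSpace ℝ (Fin N),
      IsWeakGradient Ω u G ∧ MemLp G (ENNReal.ofReal p) (volume.restrict Ω) ∧
      ∃ ψ : ℕ → EuclideanSpace ℝ (Fin N) → ℝ, (∀ n, IsTestFunction Ω (ψ n)) ∧
        Tendsto (fun n => eLpNorm (fun x => ψ n x - u x) (ENNReal.ofReal p) (volume.restrict Ω))
          atTop (𝓝 0) ∧
        Tendsto (fun n => eLpNorm (fun x => gradient (ψ n) x - G x) (ENNReal.ofReal p)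
          (volume.restrict Ω)) atTop (𝓝 0)

/-- The tail space `L^q_α(ℝ^N)`, for `q, α > 0`. -/
def MemTailSpace {N : ℕ} (q α : ℝ) (u : EuclideanSpace ℝ (Fin N) → ℝ) : Prop :=
  (∀ K : Set (EuclideanSpace ℝ (Fin N)), IsCompact K →
    MemLp u (ENNReal.ofReal q) (volume.restrict K)) ∧
  Integrable (fun x => |u x| ^ q / (1 + ‖x‖ ^ ((N : ℝ) + α)))

/-- `u ∈ W_g^{1,p}(Ω)`, where `u` is regarded as a function on `ℝ^N`, extended by `g` outside
`Ω`. -/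
structure MemW1pBdry {N : ℕ} (Ω : Set (EuclideanSpace ℝ (Fin N))) (p s : ℝ)
    (g u : EuclideanSpace ℝ (Fin N) → ℝ) : Prop where
  memW1p : MemW1p Ω p u
  memTail : MemTailSpace (p - 1) (s * p) u
  sub_mem : MemW1pZero Ω p (fun x => u x - g x)
  eq_outside : u =ᵐ[volume.restrict Ωᶜ] g

/-- The exponent `(p^*)'` conjugate to the Sobolev exponent `p^*`, for `p ≠ N`: it equals
`Np / (Np - N + p)` if `p < N`, and `1` if `p > N`. -/
noncomputable def sobolevDualExponent (N : ℕ) (p : ℝ) : ℝ≥0∞ :=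
  if p < N then ENNReal.ofReal (N * p / (N * p - N + p)) else 1

/-- `J_p(a) = |a|^{p-2} a`. -/
noncomputable def pPower (p a : ℝ) : ℝ := |a| ^ (p - 2) * a

/-- The integrand `|∇u|^{p-2} ∇u · ∇φ` of the local term. -/
noncomputable def localIntegrand {N : ℕ} (p : ℝ)
    (Du Dφ : EuclideanSpace ℝ (Fin N) → EuclideanSpace ℝ (Fin N))
    (x : EuclideanSpace ℝ (Fin N)) : ℝ :=
  ‖Du x‖ ^ (p - 2) * inner ℝ (Du x) (Dφ x)

/-- The integrand `J_p(u(x) - u(y)) (φ(x) - φ(y)) |x - y|^{-N-sp}` of the nonlocal term. -/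
noncomputable def nonlocalIntegrand {N : ℕ} (p s : ℝ) (u φ : EuclideanSpace ℝ (Fin N) → ℝ)
    (z : EuclideanSpace ℝ (Fin N) × EuclideanSpace ℝ (Fin N)) : ℝ :=
  pPower p (u z.1 - u z.2) * (φ z.1 - φ z.2) / ‖z.1 - z.2‖ ^ ((N : ℝ) + s * p)

/-- `u ∈ W_g^{1,p}(Ω)` is a weak solution of `-Δ_p u + A (-Δ_p)^s u = f` in `Ω`, `u = g` in
`ℝ^N \ Ω`: all the integrals converge absolutely and the weak formulation holds for every
`φ ∈ W_0^{1,p}(Ω)`, extended by zero outside `Ω`. -/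
def IsWeakSolution {N : ℕ} (Ω : Set (EuclideanSpace ℝ (Fin N))) (p s A : ℝ)
    (f g u : EuclideanSpace ℝ (Fin N) → ℝ) : Prop :=
  MemW1pBdry Ω p s g u ∧
  ∃ Du : EuclideanSpace ℝ (Fin N) → EuclideanSpace ℝ (Fin N), IsWeakGradient Ω u Du ∧
    ∀ (φ : EuclideanSpace ℝ (Fin N) → ℝ)
      (Dφ : EuclideanSpace ℝ (Fin N) → EuclideanSpace ℝ (Fin N)),
      MemW1pZero Ω p φ → IsWeakGradient Ω φ Dφ →
      IntegrableOn (localIntegrand p Du Dφ) Ω ∧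
      Integrable (nonlocalIntegrand p s u (Ω.indicator φ)) ∧
      IntegrableOn (fun x => f x * φ x) Ω ∧
      (∫ x in Ω, localIntegrand p Du Dφ x) +
          A * (∫ z, nonlocalIntegrand p s u (Ω.indicator φ) z) =
        ∫ x in Ω, f x * φ x

/-! Write `u = g + w` with `w` in `W_0^{1,p}(Ω)`, `δv(x, y) = v(x) - v(y)` and `dμ = |x - y|^{-N-sp}
dx dy`. The problem is the Euler–Lagrange equation of the convex functional `F(w) = ∫ (|∇g + ∇w|^p -
|∇g|^p) / p + A ∫∫ (|δg + δw|^p - |δg|^p) / p dμ - ∫ f w`, the first and last integrals being over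
`Ω`. Away from `Ω` the function `g` only has a finite tail, so `∫∫ |δg|^p dμ` may be infinite. The
power of `|δg|` is therefore subtracted under the integral sign. By the subgradient inequality for
`|·|^p / p` this difference lies between two pairings, which are integrable once `∫∫ |δg|^{p-1} |δξ|
dμ ≤ C ‖ξ‖` (`exists_lintegral_sub_rpow_mul_le`).

That bound splits at a small distance `r`. Near the diagonal, `‖g(· + h) - g‖_p ≤ |h| ‖∇g‖_p` on a
neighbourhood of `Ω` (`lintegral_enorm_sub_rpow_le`), and `|h|^{p-N-sp}` is integrable at the origin
because `s < 1`. Far from it, one of the two points may be taken in the bounded set `Ω`, so the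
kernel is controlled by the tail weight (`exists_setLIntegral_far_le`).

A minimizer is found without weak compactness. A pointwise uniform convexity inequality for `|·|^p`,
integrated over the local term, makes minimizing sequences Cauchy in the gradient, hence in
`W_0^{1,p}(Ω)` by Poincaré. The nonlocal term only has to be convex (`exists_functional_add_eq`).
Coercivity comes from the growth `p > 1` of the local term, since the nonlocal energy is bounded
below by a continuous linear functional. The load `f` is continuous by Sobolev embedding, with a sup
bound when `p > N` (`exists_setLIntegral_mul_le`).

For uniqueness, two solutions are tested with their difference. Monotonicity of both terms, strict
for the local one, forces equal gradients, and Poincaré concludes (`IsWeakSolution.ae_eq`). -/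

theorem norm_add_rpow_le {V : Type*} [NormedAddCommGroup V] {q : ℝ} (hq : 0 ≤ q) (a b : V) :
    ‖a + b‖ ^ q ≤ 2 ^ q * (‖a‖ ^ q + ‖b‖ ^ q) := by
  have h : ‖a + b‖ ≤ 2 * max ‖a‖ ‖b‖ := by
    linarith [norm_add_le a b, le_max_left ‖a‖ ‖b‖, le_max_right ‖a‖ ‖b‖]
  calc ‖a + b‖ ^ q ≤ (2 * max ‖a‖ ‖b‖) ^ q := Real.rpow_le_rpow (norm_nonneg _) h hq
    _ = 2 ^ q * (max ‖a‖ ‖b‖) ^ q := Real.mul_rpow (by norm_num) (by positivity)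
    _ ≤ _ := by
      gcongr
      have h1 : 0 ≤ ‖a‖ ^ q := by positivity
      have h2 : 0 ≤ ‖b‖ ^ q := by positivity
      rcases max_choice ‖a‖ ‖b‖ with h | h <;> rw [h] <;> linarith

/-! ### Convexity of the `p`-th power of the norm and monotonicity of its gradient. -/

section PMap

variable {V : Type*} [NormedAddCommGroup V] [InnerProductSpace ℝ V]

/-- The duality map `v ↦ ‖v‖^{p-2} v`. -/
noncomputable def pMap (p : ℝ) (v : V) : V := ‖v‖ ^ (p - 2) • v

theorem pPower_eq_pMap (p a : ℝ) : pPower p a = pMap p a := by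
  simp [pPower, pMap]

theorem inner_pMap_left (p : ℝ) (v w : V) :
    inner ℝ (pMap p v) w = ‖v‖ ^ (p - 2) * inner ℝ v w := by
  simp [pMap, real_inner_smul_left]

theorem norm_pMap {p : ℝ} (hp : 1 < p) (v : V) : ‖pMap p v‖ = ‖v‖ ^ (p - 1) := by
  rcases eq_or_ne v 0 with rfl | hv
  · simp [pMap, Real.zero_rpow (by linarith : p - 1 ≠ 0)]
  · have : 0 < ‖v‖ := norm_pos_iff.2 hv
    rw [pMap, norm_smul, Real.norm_of_nonneg (by positivity),
      show p - 1 = (p - 2) + 1 by ring, Real.rpow_add_one this.ne']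

theorem inner_pMap_self {p : ℝ} (hp : 1 < p) (v : V) : inner ℝ (pMap p v) v = ‖v‖ ^ p := by
  rcases eq_or_ne v 0 with rfl | hv
  · simp [Real.zero_rpow (by linarith : p ≠ 0)]
  · have : 0 < ‖v‖ := norm_pos_iff.2 hv
    rw [inner_pMap_left, real_inner_self_eq_norm_sq, ← Real.rpow_natCast,
      ← Real.rpow_add this]
    congr 1; push_cast; ring

theorem continuous_pMap {p : ℝ} (hp : 1 < p) : Continuous (pMap p : V → V) := by
  rw [continuous_iff_continuousAt]
  intro v
  rcases eq_or_ne v 0 with rfl | hv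
  · have h0 : pMap p (0 : V) = 0 := by simp [pMap]
    rw [ContinuousAt, h0, tendsto_zero_iff_norm_tendsto_zero]
    simp_rw [norm_pMap hp]
    have : Continuous fun v : V => ‖v‖ ^ (p - 1) :=
      continuous_norm.rpow_const fun _ => Or.inr (by linarith)
    simpa [Real.zero_rpow (by linarith : p - 1 ≠ 0)] using this.tendsto 0
  · exact (continuousAt_id.norm.rpow_const (Or.inl (norm_ne_zero_iff.2 hv))).smul continuousAt_id

/-- Cauchy–Schwarz followed by Young with exponents `p` and `p'`. This is the subgradient inequality
for `‖·‖^p / p`, from which the convexity and monotonicity facts below are derived. -/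
theorem norm_rpow_sub_le_inner_pMap {p : ℝ} (hp : 1 < p) (v w : V) :
    ‖v‖ ^ p / p - ‖w‖ ^ p / p ≤ inner ℝ (pMap p v) (v - w) := by
  have hq := Real.HolderConjugate.conjExponent hp
  have h1 : inner ℝ (pMap p v) w ≤ ‖v‖ ^ (p - 1) * ‖w‖ := by
    rw [← norm_pMap hp]; exact real_inner_le_norm _ _
  have h2 := Real.young_inequality_of_nonneg (norm_nonneg w)
    (Real.rpow_nonneg (norm_nonneg v) (p - 1)) hq
  have h3 : (‖v‖ ^ (p - 1)) ^ p.conjExponent = ‖v‖ ^ p := by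
    rw [← Real.rpow_mul (norm_nonneg v)]
    congr 1
    exact hq.sub_one_mul_conj
  rw [h3] at h2
  have h4 : ‖v‖ ^ p / p.conjExponent = ‖v‖ ^ p - ‖v‖ ^ p / p := by
    rw [div_eq_mul_inv, ← hq.one_sub_inv]; ring
  rw [inner_sub_right, inner_pMap_self hp]
  nlinarith

/-- The subgradient inequalities at the midpoint towards `u` and `v` are added; their linear terms
cancel. -/
theorem two_mul_norm_midpoint_rpow_le {p : ℝ} (hp : 1 < p) (u v : V) :
    2 * ‖(1 / 2 : ℝ) • (u + v)‖ ^ p ≤ ‖u‖ ^ p + ‖v‖ ^ p := by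
  set m := (1 / 2 : ℝ) • (u + v) with hm
  have h1 := norm_rpow_sub_le_inner_pMap hp m u
  have h2 := norm_rpow_sub_le_inner_pMap hp m v
  have h3 : inner ℝ (pMap p m) (m - u) + inner ℝ (pMap p m) (m - v) = 0 := by
    rw [← inner_add_right]
    have : m - u + (m - v) = 0 := by rw [hm]; module
    rw [this, inner_zero_right]
  have h4 : 2 * ‖m‖ ^ p / p ≤ (‖u‖ ^ p + ‖v‖ ^ p) / p := by
    have : (‖u‖ ^ p + ‖v‖ ^ p) / p - 2 * ‖m‖ ^ p / p =
      - (‖m‖ ^ p / p - ‖u‖ ^ p / p + (‖m‖ ^ p / p - ‖v‖ ^ p / p)) := by ring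
    linarith
  exact (div_le_div_iff_of_pos_right (by linarith)).1 h4

/-- Strict convexity of `t ↦ t ^ p` forces `‖u‖ = ‖v‖`. Then `‖u + v‖ = 2 ‖u‖`, and the
parallelogram law gives `u - v = 0`. -/
theorem eq_of_norm_rpow_add_le_midpoint {p : ℝ} (hp : 1 < p) {u v : V}
    (h : ‖u‖ ^ p + ‖v‖ ^ p ≤ 2 * ‖(1 / 2 : ℝ) • (u + v)‖ ^ p) : u = v := by
  have hm : ‖(1 / 2 : ℝ) • (u + v)‖ ≤ (1 / 2) * ‖u‖ + (1 / 2) * ‖v‖ := by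
    rw [norm_smul, Real.norm_of_nonneg (by norm_num)]
    linarith [norm_add_le u v]
  have hmp := Real.rpow_le_rpow (norm_nonneg _) hm (by linarith : 0 ≤ p)
  have hn : ‖u‖ = ‖v‖ := by
    by_contra hne
    have := (strictConvexOn_rpow hp).2 (Set.mem_Ici.2 (norm_nonneg u))
      (Set.mem_Ici.2 (norm_nonneg v)) hne (by norm_num : (0 : ℝ) < 1 / 2)
      (by norm_num : (0 : ℝ) < 1 / 2) (by norm_num)
    simp only [smul_eq_mul] at this
    linarith
  have h2 : ‖u‖ ≤ ‖(1 / 2 : ℝ) • (u + v)‖ := by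
    rw [← hn] at h
    exact (Real.rpow_le_rpow_iff (norm_nonneg _) (norm_nonneg _) (by linarith : 0 < p)).1
      (by linarith)
  rw [norm_smul, Real.norm_of_nonneg (by norm_num)] at h2
  have hpar := parallelogram_law_with_norm ℝ u v
  rw [← hn] at hpar
  have : ‖u - v‖ = 0 := by nlinarith [norm_nonneg (u - v), norm_nonneg u, norm_nonneg (u + v)]
  exact sub_eq_zero.1 (norm_eq_zero.1 this)

/-- The subgradient inequalities at `u` and at `v`, both towards the midpoint, are added. Strict
convexity thereby passes to strict monotonicity of `pMap`. -/
theorem midpoint_defect_le_inner_pMap {p : ℝ} (hp : 1 < p) (u v : V) :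
    (‖u‖ ^ p + ‖v‖ ^ p - 2 * ‖(1 / 2 : ℝ) • (u + v)‖ ^ p) / p ≤
      (1 / 2) * inner ℝ (pMap p u - pMap p v) (u - v) := by
  set m := (1 / 2 : ℝ) • (u + v) with hm
  have h1 := norm_rpow_sub_le_inner_pMap hp u m
  have h2 := norm_rpow_sub_le_inner_pMap hp v m
  have e1 : u - m = (1 / 2 : ℝ) • (u - v) := by rw [hm]; module
  have e2 : v - m = (-1 / 2 : ℝ) • (u - v) := by rw [hm]; module
  rw [e1, real_inner_smul_right] at h1
  rw [e2, real_inner_smul_right] at h2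
  rw [inner_sub_left]
  have : (‖u‖ ^ p + ‖v‖ ^ p - 2 * ‖m‖ ^ p) / p =
    (‖u‖ ^ p / p - ‖m‖ ^ p / p) + (‖v‖ ^ p / p - ‖m‖ ^ p / p) := by ring
  linarith

theorem inner_pMap_sub_nonneg {p : ℝ} (hp : 1 < p) (u v : V) :
    0 ≤ inner ℝ (pMap p u - pMap p v) (u - v) := by
  have h1 := midpoint_defect_le_inner_pMap hp u v
  have h2 := two_mul_norm_midpoint_rpow_le hp u v
  have : 0 ≤ (‖u‖ ^ p + ‖v‖ ^ p - 2 * ‖(1 / 2 : ℝ) • (u + v)‖ ^ p) / p :=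
    div_nonneg (by linarith) (by linarith)
  linarith

theorem eq_of_inner_pMap_sub_eq_zero {p : ℝ} (hp : 1 < p) {u v : V}
    (h : inner ℝ (pMap p u - pMap p v) (u - v) = 0) : u = v := by
  have h1 := midpoint_defect_le_inner_pMap hp u v
  rw [h, mul_zero, div_le_iff₀ (by linarith), zero_mul] at h1
  exact eq_of_norm_rpow_add_le_midpoint hp (by linarith)

/-- Uniform convexity of `‖·‖^p`, in a form that can be integrated. -/
theorem exists_norm_sub_rpow_le_midpoint_defect [FiniteDimensional ℝ V] {p : ℝ} (hp : 1 < p)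
    {ε : ℝ} (hε : 0 < ε) : ∃ C : ℝ, 0 ≤ C ∧ ∀ u v : V,
      ‖u - v‖ ^ p ≤ ε * (‖u‖ ^ p + ‖v‖ ^ p) +
        C * (‖u‖ ^ p + ‖v‖ ^ p - 2 * ‖(1 / 2 : ℝ) • (u + v)‖ ^ p) := by
  have hp0 : 0 ≤ p := by linarith
  have hpow : Continuous fun r : ℝ => r ^ p := continuous_id.rpow_const fun _ => Or.inr hp0
  let D : V × V → ℝ := fun z =>
    ‖z.1‖ ^ p + ‖z.2‖ ^ p - 2 * ‖(1 / 2 : ℝ) • (z.1 + z.2)‖ ^ p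
  have hD : Continuous D := by
    have h1 : Continuous fun z : V × V => ‖z.1‖ ^ p := hpow.comp (by fun_prop)
    have h2 : Continuous fun z : V × V => ‖z.2‖ ^ p := hpow.comp (by fun_prop)
    have h3 : Continuous fun z : V × V => ‖(1 / 2 : ℝ) • (z.1 + z.2)‖ ^ p :=
      hpow.comp (by fun_prop)
    exact (h1.add h2).sub (continuous_const.mul h3)
  have hD0 : ∀ z, 0 ≤ D z := fun z => by
    have := two_mul_norm_midpoint_rpow_le hp z.1 z.2
    simp only [D]; linarith
  -- Both sides are homogeneous of degree `p`, so the unit sphere suffices. On `S` the `ε` term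
  -- alone does not exceed the left side, and there the defect `D` must be bounded below by
  -- compactness.
  let S : Set (V × V) := Metric.sphere 0 1 ∩
    {z | ε * (‖z.1‖ ^ p + ‖z.2‖ ^ p) ≤ ‖z.1 - z.2‖ ^ p}
  have : ProperSpace V := FiniteDimensional.proper ℝ V
  have hS : IsCompact S := by
    refine (isCompact_sphere 0 1).inter_right (isClosed_le ?_ ?_)
    · exact continuous_const.mul ((hpow.comp (by fun_prop)).add (hpow.comp (by fun_prop)))
    · exact hpow.comp (by fun_prop)
  have hpos : ∀ z ∈ S, 0 < D z := by
    intro z hz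
    refine lt_of_le_of_ne (hD0 z) fun h0 => ?_
    have heq : z.1 = z.2 := eq_of_norm_rpow_add_le_midpoint hp (by simp only [D] at h0; linarith)
    have h2 := hz.2
    simp only [Set.mem_ofPred_eq, heq, sub_self, norm_zero] at h2
    rw [Real.zero_rpow (by linarith)] at h2
    have h3 : ‖z.2‖ ^ p = 0 := by
      have : 0 ≤ ‖z.2‖ ^ p := by positivity
      nlinarith
    have h4 : z.2 = 0 := by
      rw [Real.rpow_eq_zero (norm_nonneg _) (by linarith)] at h3
      exact norm_eq_zero.1 h3
    have : z = 0 := Prod.ext (by rw [heq, h4]; rfl) h4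
    have h1 := hz.1
    rw [this] at h1
    simp at h1
  obtain ⟨d, hd, hdS⟩ : ∃ d > 0, ∀ z ∈ S, d ≤ D z := by
    rcases S.eq_empty_or_nonempty with he | hne
    · exact ⟨1, one_pos, by simp [he]⟩
    · obtain ⟨z, hz, hmin⟩ := hS.exists_isMinOn hne hD.continuousOn
      exact ⟨D z, hpos z hz, fun w hw => hmin hw⟩
  -- On the unit sphere of the sup norm `‖z.1 - z.2‖ ≤ 2`, while `d ≤ D z` on `S`.
  refine ⟨2 ^ p / d, by positivity, fun u v => ?_⟩
  have key : ∀ z ∈ Metric.sphere (0 : V × V) 1,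
      ‖z.1 - z.2‖ ^ p ≤ ε * (‖z.1‖ ^ p + ‖z.2‖ ^ p) + 2 ^ p / d * D z := by
    intro z hz
    by_cases hzS : ε * (‖z.1‖ ^ p + ‖z.2‖ ^ p) ≤ ‖z.1 - z.2‖ ^ p
    · have hle : ‖z.1 - z.2‖ ≤ 2 := by
        have hz' : ‖z‖ = 1 := by simpa using hz
        have := norm_fst_le z
        have := norm_snd_le z
        linarith [norm_sub_le z.1 z.2]
      have h1 : ‖z.1 - z.2‖ ^ p ≤ 2 ^ p := Real.rpow_le_rpow (norm_nonneg _) hle hp0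
      have h2 : 2 ^ p ≤ 2 ^ p / d * D z := by
        rw [div_mul_eq_mul_div, le_div_iff₀ hd]
        exact mul_le_mul_of_nonneg_left (hdS z ⟨hz, hzS⟩) (by positivity)
      have h3 : 0 ≤ ε * (‖z.1‖ ^ p + ‖z.2‖ ^ p) := by positivity
      linarith
    · have : 0 ≤ 2 ^ p / d * D z := mul_nonneg (by positivity) (hD0 z)
      push Not at hzS
      linarith
  rcases eq_or_ne ((u, v) : V × V) 0 with h0 | h0
  · rw [Prod.mk_eq_zero] at h0
    simp [h0.1, h0.2, Real.zero_rpow (by linarith : p ≠ 0)]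
  · set r := ‖((u, v) : V × V)‖ with hr
    have hr0 : 0 < r := norm_pos_iff.2 h0
    have hk := key (r⁻¹ • (u, v)) (by
      rw [mem_sphere_zero_iff_norm, norm_smul, norm_inv, norm_norm]
      exact inv_mul_cancel₀ hr0.ne')
    have hs : ∀ w : V, ‖r⁻¹ • w‖ ^ p = (r⁻¹) ^ p * ‖w‖ ^ p := fun w => by
      rw [norm_smul, Real.norm_of_nonneg (by positivity), Real.mul_rpow (by positivity)
        (norm_nonneg _)]
    simp only [D, Prod.smul_fst, Prod.smul_snd, ← smul_sub, ← smul_add] at hk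
    rw [smul_comm, hs, hs, hs, hs] at hk
    have hrp : 0 < (r⁻¹) ^ p := by positivity
    refine le_of_mul_le_mul_left ?_ hrp
    linarith

end PMap

/-! ### Power and Hölder inequalities for extended norms. -/

theorem enorm_add_rpow_le {V : Type*} [NormedAddCommGroup V] {q : ℝ} (hq : 0 ≤ q) (a b : V) :
    ‖a + b‖ₑ ^ q ≤ 2 ^ q * (‖a‖ₑ ^ q + ‖b‖ₑ ^ q) := by
  have h : ‖a + b‖ₑ ≤ 2 * max ‖a‖ₑ ‖b‖ₑ := by
    rw [two_mul]
    exact (enorm_add_le a b).trans (add_le_add (le_max_left _ _) (le_max_right _ _))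
  calc ‖a + b‖ₑ ^ q ≤ (2 * max ‖a‖ₑ ‖b‖ₑ) ^ q := ENNReal.rpow_le_rpow h hq
    _ = 2 ^ q * (max ‖a‖ₑ ‖b‖ₑ) ^ q := ENNReal.mul_rpow_of_nonneg _ _ hq
    _ ≤ _ := by
      gcongr
      rcases max_choice ‖a‖ₑ ‖b‖ₑ with h | h <;> rw [h]
      · exact le_self_add
      · exact le_add_self

theorem eLpNorm_ofReal_eq_lintegral {Y V : Type*} [MeasurableSpace Y] [NormedAddCommGroup V]
    {p : ℝ} (hp : 0 < p) (f : Y → V) (μ : Measure Y) :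
    eLpNorm f (ENNReal.ofReal p) μ = (∫⁻ y, ‖f y‖ₑ ^ p ∂μ) ^ (1 / p) := by
  rw [eLpNorm_eq_lintegral_rpow_enorm_toReal (by simpa using hp) ENNReal.ofReal_ne_top,
    ENNReal.toReal_ofReal hp.le]

theorem lintegral_enorm_rpow_eq_eLpNorm {Y V : Type*} [MeasurableSpace Y] [NormedAddCommGroup V]
    {p : ℝ} (hp : 0 < p) (f : Y → V) (μ : Measure Y) :
    ∫⁻ y, ‖f y‖ₑ ^ p ∂μ = eLpNorm f (ENNReal.ofReal p) μ ^ p := by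
  rw [eLpNorm_ofReal_eq_lintegral hp, ← ENNReal.rpow_mul, one_div_mul_cancel hp.ne',
    ENNReal.rpow_one]

/-- Hölder with exponents `p'` and `p`, since `(p - 1) p' = p`. -/
theorem lintegral_rpow_sub_one_mul_le {Y V W : Type*} [MeasurableSpace Y] [NormedAddCommGroup V]
    [NormedAddCommGroup W] {p : ℝ} (hp : 1 < p) {μ : Measure Y} {b : Y → V} {c : Y → W}
    (hb : AEStronglyMeasurable b μ) (hc : AEStronglyMeasurable c μ) :
    ∫⁻ y, ‖b y‖ₑ ^ (p - 1) * ‖c y‖ₑ ∂μ ≤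
      eLpNorm b (ENNReal.ofReal p) μ ^ (p - 1) * eLpNorm c (ENNReal.ofReal p) μ := by
  have hq := Real.HolderConjugate.conjExponent hp
  have h := ENNReal.lintegral_mul_le_Lp_mul_Lq μ hq.symm
    (hb.enorm.pow_const (p - 1)) hc.enorm
  refine h.trans ?_
  rw [eLpNorm_ofReal_eq_lintegral hq.pos, eLpNorm_ofReal_eq_lintegral hq.pos, ← ENNReal.rpow_mul]
  simp_rw [← ENNReal.rpow_mul, hq.sub_one_mul_conj]
  have he : 1 / p * (p - 1) = 1 / p.conjExponent := by
    rw [← hq.div_conj_eq_sub_one]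
    field_simp [hq.ne_zero, hq.symm.ne_zero]
  rw [he]

/-! ### Convex energies and pairings defined by a linear map into `L^p`. -/

section Abstract

variable {Y : Type*} [MeasurableSpace Y] {μ : Measure Y} {V : Type*} [NormedAddCommGroup V]
  [InnerProductSpace ℝ V] {X : Type*} [NormedAddCommGroup X] [NormedSpace ℝ X] {p : ℝ}
  [Fact (1 ≤ ENNReal.ofReal p)]

/-- The function `a` acts on the range of `T` through the pairing `ξ ↦ ∫ ‖a‖^{p-2} a · T ξ`. -/
structure IsPairable (p : ℝ) [Fact (1 ≤ ENNReal.ofReal p)] (T : X →L[ℝ] Lp V (ENNReal.ofReal p) μ)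
    (a : Y → V) : Prop where
  aestronglyMeasurable : AEStronglyMeasurable a μ
  bound : ∃ C : NNReal, ∀ ξ, ∫⁻ y, ‖a y‖ₑ ^ (p - 1) * ‖T ξ y‖ₑ ∂μ ≤ C * ‖ξ‖ₑ

variable {T : X →L[ℝ] Lp V (ENNReal.ofReal p) μ} {a : Y → V}

theorem isPairable_coeFn (hp : 1 < p) (T : X →L[ℝ] Lp V (ENNReal.ofReal p) μ)
    (b : Lp V (ENNReal.ofReal p) μ) : IsPairable p T b := by
  refine ⟨Lp.aestronglyMeasurable b, ‖b‖₊ ^ (p - 1) * ‖T‖₊, fun ξ => ?_⟩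
  refine (lintegral_rpow_sub_one_mul_le hp (Lp.aestronglyMeasurable b)
    (Lp.aestronglyMeasurable (T ξ))).trans ?_
  rw [← Lp.enorm_def, ← Lp.enorm_def, ENNReal.coe_mul,
    ENNReal.coe_rpow_of_nonneg _ (by linarith), mul_assoc]
  gcongr
  · rfl
  · exact T.le_opENorm ξ

/-- Together with `isPairable_coeFn`, this makes pairability stable under adding an element of
`L^p`, so it holds at every point `a + T x` at which the energy is differentiated. -/
theorem IsPairable.add (hp : 1 < p) (ha : IsPairable p T a) {b : Y → V} (hb : IsPairable p T b) :
    IsPairable p T (fun y => a y + b y) := by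
  obtain ⟨C, hC⟩ := ha.bound
  obtain ⟨D, hD⟩ := hb.bound
  have hp1 : 0 ≤ p - 1 := by linarith
  refine ⟨ha.aestronglyMeasurable.add hb.aestronglyMeasurable, 2 ^ (p - 1) * (C + D),
    fun ξ => ?_⟩
  have hT := (Lp.aestronglyMeasurable (T ξ)).enorm
  calc ∫⁻ y, ‖a y + b y‖ₑ ^ (p - 1) * ‖T ξ y‖ₑ ∂μ
      ≤ ∫⁻ y, 2 ^ (p - 1) * (‖a y‖ₑ ^ (p - 1) * ‖T ξ y‖ₑ + ‖b y‖ₑ ^ (p - 1) * ‖T ξ y‖ₑ) ∂μ := by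
        refine lintegral_mono fun y => ?_
        rw [← add_mul, ← mul_assoc]
        gcongr
        exact enorm_add_rpow_le hp1 _ _
    _ = 2 ^ (p - 1) * (∫⁻ y, ‖a y‖ₑ ^ (p - 1) * ‖T ξ y‖ₑ ∂μ +
          ∫⁻ y, ‖b y‖ₑ ^ (p - 1) * ‖T ξ y‖ₑ ∂μ) := by
        rw [lintegral_const_mul' _ _ (ENNReal.rpow_ne_top_of_nonneg hp1 (by simp)),
          lintegral_add_left' (by
            exact (ha.aestronglyMeasurable.enorm.pow_const (p - 1)).mul hT)]
    _ ≤ 2 ^ (p - 1) * (C * ‖ξ‖ₑ + D * ‖ξ‖ₑ) := by gcongr <;> apply_assumption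
    _ = _ := by
        rw [ENNReal.coe_mul, ENNReal.coe_add, ENNReal.coe_rpow_of_nonneg _ hp1]
        push_cast
        ring

theorem IsPairable.add_coeFn (hp : 1 < p) (ha : IsPairable p T a) (x : X) :
    IsPairable p T (fun y => a y + T x y) :=
  ha.add hp (isPairable_coeFn hp T (T x))

theorem IsPairable.integrable_mul (hp : 1 < p) (ha : IsPairable p T a) (ξ : X) :
    Integrable (fun y => ‖a y‖ ^ (p - 1) * ‖T ξ y‖) μ := by
  obtain ⟨C, hC⟩ := ha.bound
  refine ⟨((ha.aestronglyMeasurable.norm.aemeasurable.pow_const _).mul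
    (Lp.aestronglyMeasurable (T ξ)).norm.aemeasurable).aestronglyMeasurable, ?_⟩
  refine lt_of_le_of_lt ?_ ((hC ξ).trans_lt
    (ENNReal.mul_lt_top ENNReal.coe_lt_top enorm_lt_top))
  refine lintegral_mono fun y => le_of_eq ?_
  rw [enorm_mul, enorm_norm, Real.enorm_rpow_of_nonneg (norm_nonneg _) (by linarith), enorm_norm]

theorem IsPairable.integrable_inner (hp : 1 < p) (ha : IsPairable p T a) (ξ : X) :
    Integrable (fun y => inner ℝ (pMap p (a y)) (T ξ y)) μ := by
  refine (ha.integrable_mul hp ξ).mono'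
    (((continuous_pMap hp).comp_aestronglyMeasurable ha.aestronglyMeasurable).inner
      (Lp.aestronglyMeasurable (T ξ))) (Eventually.of_forall fun y => ?_)
  rw [← norm_pMap hp]
  exact norm_inner_le_norm _ _

/-- The functional `ξ ↦ ∫ ‖a‖^{p-2} a · T ξ`. -/
noncomputable def IsPairable.functional (hp : 1 < p) (ha : IsPairable p T a) : X →L[ℝ] ℝ :=
  LinearMap.mkContinuousOfExistsBound
    { toFun := fun ξ => ∫ y, inner ℝ (pMap p (a y)) (T ξ y) ∂μ
      map_add' := fun ξ η => by
        rw [← integral_add (ha.integrable_inner hp ξ) (ha.integrable_inner hp η)]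
        refine integral_congr_ae ?_
        rw [map_add]
        filter_upwards [Lp.coeFn_add (T ξ) (T η)] with y hy
        rw [hy, Pi.add_apply, inner_add_right]
      map_smul' := fun c ξ => by
        rw [RingHom.id_apply, smul_eq_mul, ← integral_const_mul]
        refine integral_congr_ae ?_
        rw [map_smul]
        filter_upwards [Lp.coeFn_smul c (T ξ)] with y hy
        rw [hy, Pi.smul_apply, real_inner_smul_right] } <| by
    obtain ⟨C, hC⟩ := ha.bound
    refine ⟨C, fun ξ => ?_⟩
    have h1 : ‖∫ y, inner ℝ (pMap p (a y)) (T ξ y) ∂μ‖ₑ ≤ C * ‖ξ‖ₑ := by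
      refine (enorm_integral_le_lintegral_enorm _).trans (le_trans ?_ (hC ξ))
      refine lintegral_mono fun y => ?_
      have : ‖inner ℝ (pMap p (a y)) (T ξ y)‖₊ ≤ ‖a y‖₊ ^ (p - 1) * ‖T ξ y‖₊ := by
        rw [← NNReal.coe_le_coe]
        push_cast
        rw [← norm_pMap hp]
        exact norm_inner_le_norm _ _
      rw [enorm_eq_nnnorm, enorm_eq_nnnorm, enorm_eq_nnnorm,
        ← ENNReal.coe_rpow_of_nonneg _ (by linarith), ← ENNReal.coe_mul]
      exact ENNReal.coe_le_coe.2 this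
    have h2 : ‖∫ y, inner ℝ (pMap p (a y)) (T ξ y) ∂μ‖₊ ≤ C * ‖ξ‖₊ := by
      rw [enorm_eq_nnnorm, enorm_eq_nnnorm] at h1
      exact_mod_cast h1
    exact_mod_cast h2

theorem IsPairable.functional_apply (hp : 1 < p) (ha : IsPairable p T a) (ξ : X) :
    ha.functional hp ξ = ∫ y, inner ℝ (pMap p (a y)) (T ξ y) ∂μ := rfl

/-- The energy `x ↦ ∫ (‖a + T x‖^p - ‖a‖^p) / p`. -/
noncomputable def pEnergy (p : ℝ) [Fact (1 ≤ ENNReal.ofReal p)]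
    (T : X →L[ℝ] Lp V (ENNReal.ofReal p) μ) (a : Y → V) (x : X) : ℝ :=
  ∫ y, (‖a y + T x y‖ ^ p / p - ‖a y‖ ^ p / p) ∂μ

/-- Convexity squeezes the integrand between the pairings of `T x` with `a` and with `a + T x`.
Neither `p`-th power need be integrable on its own. -/
theorem IsPairable.integrable_energy (hp : 1 < p) (ha : IsPairable p T a) (x : X) :
    Integrable (fun y => ‖a y + T x y‖ ^ p / p - ‖a y‖ ^ p / p) μ := by
  have hm := ha.aestronglyMeasurable
  refine integrable_of_le_of_le ?_ (Eventually.of_forall fun y => ?_)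
    (Eventually.of_forall fun y => ?_) (ha.integrable_inner hp x)
    ((ha.add_coeFn hp x).integrable_inner hp x)
  · exact ((((hm.add (Lp.aestronglyMeasurable (T x))).norm.aemeasurable.pow_const p).div_const
      p).sub ((hm.norm.aemeasurable.pow_const p).div_const p)).aestronglyMeasurable
  · have := norm_rpow_sub_le_inner_pMap hp (a y) (a y + T x y)
    rw [sub_add_cancel_left, inner_neg_right] at this
    linarith
  · have := norm_rpow_sub_le_inner_pMap hp (a y + T x y) (a y)
    rwa [add_sub_cancel_left] at this

theorem IsPairable.energy_add_le (hp : 1 < p) (ha : IsPairable p T a) (x z : X) :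
    pEnergy p T a x + (ha.add_coeFn hp x).functional hp (z - x) ≤ pEnergy p T a z := by
  rw [functional_apply, pEnergy, pEnergy, ← integral_add (ha.integrable_energy hp x)
    ((ha.add_coeFn hp x).integrable_inner hp _)]
  refine integral_mono_ae ((ha.integrable_energy hp x).add
    ((ha.add_coeFn hp x).integrable_inner hp _)) (ha.integrable_energy hp z) ?_
  rw [map_sub]
  filter_upwards [Lp.coeFn_sub (T z) (T x)] with y hy
  have := norm_rpow_sub_le_inner_pMap hp (a y + T x y) (a y + T z y)
  rw [show a y + T x y - (a y + T z y) = -(T z y - T x y) by abel, inner_neg_right] at this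
  rw [hy, Pi.sub_apply]
  linarith

theorem pEnergy_zero (T : X →L[ℝ] Lp V (ENNReal.ofReal p) μ) (a : Y → V) :
    pEnergy p T a 0 = 0 := by
  rw [pEnergy, map_zero]
  rw [← integral_zero Y ℝ (μ := μ)]
  refine integral_congr_ae ?_
  filter_upwards [Lp.coeFn_zero V (ENNReal.ofReal p) μ] with y hy
  rw [hy]; simp

/-- The subgradient inequality at the origin. It bounds the energy below by a linear functional,
which the coercive local term will absorb. -/
theorem IsPairable.functional_le_energy (hp : 1 < p) (ha : IsPairable p T a) (x : X) :
    ha.functional hp x ≤ pEnergy p T a x := by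
  have h := ha.energy_add_le hp 0 x
  rw [pEnergy_zero, zero_add, sub_zero] at h
  refine le_trans (le_of_eq ?_) h
  rw [functional_apply, functional_apply]
  refine integral_congr_ae ?_
  rw [map_zero]
  filter_upwards [Lp.coeFn_zero V (ENNReal.ofReal p) μ] with y hy
  rw [hy]; simp

/-- Dominated convergence: for `0 < t ≤ 1` the integrand is at most a constant times `(‖a + T x‖ ^
(p - 1) + ‖T ξ‖ ^ (p - 1)) ‖T ξ‖`, and both products are integrable. -/
theorem IsPairable.tendsto_functional (hp : 1 < p) (ha : IsPairable p T a) (x ξ : X) :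
    Tendsto (fun t : ℝ => (ha.add_coeFn hp (x + t • ξ)).functional hp ξ) (𝓝[>] 0)
      (𝓝 ((ha.add_coeFn hp x).functional hp ξ)) := by
  have hp1 : 0 ≤ p - 1 := by linarith
  have hx := ha.add_coeFn hp x
  have e : ∀ t : ℝ, (ha.add_coeFn hp (x + t • ξ)).functional hp ξ =
      ∫ y, inner ℝ (pMap p (a y + T x y + t • T ξ y)) (T ξ y) ∂μ := fun t => by
    rw [functional_apply]
    refine integral_congr_ae ?_
    rw [map_add, map_smul]
    filter_upwards [Lp.coeFn_add (T x) (t • T ξ), Lp.coeFn_smul t (T ξ)] with y h1 h2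
    rw [h1, Pi.add_apply, h2, Pi.smul_apply, add_assoc]
  simp_rw [e]
  rw [functional_apply]
  have hξ := Lp.aestronglyMeasurable (T ξ)
  refine tendsto_integral_filter_of_dominated_convergence
    (fun y => 2 ^ (p - 1) * (‖a y + T x y‖ ^ (p - 1) * ‖T ξ y‖ + ‖T ξ y‖ ^ (p - 1) * ‖T ξ y‖))
    (Eventually.of_forall fun t => ?_) ?_ ?_ (Eventually.of_forall fun y => ?_)
  · exact ((continuous_pMap hp).comp_aestronglyMeasurable
      (hx.aestronglyMeasurable.add (hξ.const_smul t))).inner hξ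
  · have h1 : ∀ᶠ t : ℝ in 𝓝[>] 0, t ≤ 1 :=
      nhdsWithin_le_nhds (eventually_le_nhds one_pos)
    filter_upwards [self_mem_nhdsWithin, h1] with t ht0 ht1
    have ht0' : 0 ≤ t := le_of_lt ht0
    refine Eventually.of_forall fun y => ?_
    refine (norm_inner_le_norm _ _).trans ?_
    rw [norm_pMap hp, ← add_mul, ← mul_assoc]
    refine mul_le_mul_of_nonneg_right ((norm_add_rpow_le hp1 _ _).trans ?_) (norm_nonneg _)
    gcongr
    rw [norm_smul, Real.norm_of_nonneg ht0']
    exact mul_le_of_le_one_left (norm_nonneg _) ht1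
  · exact ((hx.integrable_mul hp ξ).add
      ((isPairable_coeFn hp T (T ξ)).integrable_mul hp ξ)).const_mul _
  · have hc : Continuous fun t : ℝ => inner ℝ (pMap p (a y + T x y + t • T ξ y)) (T ξ y) :=
      ((continuous_pMap hp).comp (by fun_prop)).inner continuous_const
    have := (hc.tendsto 0).mono_left (nhdsWithin_le_nhds (s := Set.Ioi 0))
    simpa using this

theorem IsPairable.two_mul_energy_midpoint_le (hp : 1 < p) (ha : IsPairable p T a) (x z : X) :
    2 * pEnergy p T a ((1 / 2 : ℝ) • (x + z)) ≤ pEnergy p T a x + pEnergy p T a z := by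
  set m := (1 / 2 : ℝ) • (x + z) with hm
  have h1 := ha.energy_add_le hp m x
  have h2 := ha.energy_add_le hp m z
  have : (x - m) + (z - m) = 0 := by rw [hm]; module
  have h3 := congrArg ((ha.add_coeFn hp m).functional hp) this
  rw [map_add, map_zero] at h3
  linarith

end Abstract

/-! ### Minimization of a uniformly convex functional. -/

section CriticalPoint

variable {X : Type*} [NormedAddCommGroup X] [NormedSpace ℝ X]

/-- A convex functional with hemicontinuous subgradients, whose minimizing sequences are bounded
and Cauchy, has a critical point. -/
theorem exists_critical_point [CompleteSpace X] {p : ℝ} (hp : 0 < p) (F : X → ℝ)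
    (DF : X → X →L[ℝ] ℝ) (hsub : ∀ x y, F x + DF x (y - x) ≤ F y)
    (hemi : ∀ x ξ, Tendsto (fun t : ℝ => DF (x + t • ξ) ξ) (𝓝[>] 0) (𝓝 (DF x ξ)))
    (R : ℝ) (hR : ∀ x, R < ‖x‖ → F 0 < F x)
    (hconv : ∀ ε > 0, ∃ C, 0 ≤ C ∧ ∀ x y, ‖x‖ ≤ R → ‖y‖ ≤ R →
      ‖x - y‖ ^ p ≤ ε + C * (F x + F y - 2 * F ((1 / 2 : ℝ) • (x + y)))) :
    ∃ x, DF x = 0 := by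
  have hR0 : ‖(0 : X)‖ ≤ R := by
    by_contra h
    exact lt_irrefl _ (hR 0 (not_le.1 h))
  let S : Set ℝ := F '' {x | ‖x‖ ≤ R}
  have hSne : S.Nonempty := ⟨F 0, 0, hR0, rfl⟩
  have hSbdd : BddBelow S := by
    refine ⟨F 0 - ‖DF 0‖ * R, ?_⟩
    rintro _ ⟨x, hx, rfl⟩
    have h1 := hsub 0 x
    have h2 := (DF 0).le_opNorm x
    rw [sub_zero] at h1
    have h3 : ‖DF 0‖ * ‖x‖ ≤ ‖DF 0‖ * R := mul_le_mul_of_nonneg_left hx (norm_nonneg _)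
    have h4 := neg_abs_le (DF 0 x)
    rw [Real.norm_eq_abs] at h2
    linarith
  set m := sInf S with hm
  -- The infimum over the ball is global, because outside it `F` exceeds `F 0`.
  have hmle : ∀ x, m ≤ F x := by
    intro x
    by_cases hx : ‖x‖ ≤ R
    · exact csInf_le hSbdd ⟨x, hx, rfl⟩
    · exact (csInf_le hSbdd ⟨0, hR0, rfl⟩).trans (hR x (not_le.1 hx)).le
  have hseq : ∀ n : ℕ, ∃ x, ‖x‖ ≤ R ∧ F x < m + 1 / ((n : ℝ) + 1) := by
    intro n
    obtain ⟨_, ⟨x, hx, rfl⟩, h⟩ := exists_lt_of_csInf_lt hSne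
      (lt_add_of_pos_right m (Nat.one_div_pos_of_nat (α := ℝ) (n := n)))
    exact ⟨x, hx, h⟩
  choose u huR hu using hseq
  have hlim : Tendsto (fun n : ℕ => 1 / ((n : ℝ) + 1)) atTop (𝓝 0) :=
    tendsto_one_div_add_atTop_nhds_zero_nat
  -- The midpoint value is at least `m`, so the convexity defect of two near-minimizers is at most
  -- twice their excess over `m`.
  have hcau : CauchySeq u := by
    rw [Metric.cauchySeq_iff]
    intro ε hε
    have hεp : 0 < ε ^ p := by positivity
    obtain ⟨C, hC, hCu⟩ := hconv (ε ^ p / 2) (by positivity)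
    have hl : Tendsto (fun n : ℕ => C * (2 * (1 / ((n : ℝ) + 1)))) atTop (𝓝 0) := by
      simpa using (hlim.const_mul 2).const_mul C
    obtain ⟨n₀, hn₀⟩ := (hl.eventually (gt_mem_nhds (half_pos hεp))).exists
    refine ⟨n₀, fun i hi j hj => ?_⟩
    have hmono : ∀ k ≥ n₀, F (u k) < m + 1 / ((n₀ : ℝ) + 1) := fun k hk =>
      (hu k).trans_le (by gcongr)
    have h1 := hCu (u i) (u j) (huR i) (huR j)
    have h2 : C * (F (u i) + F (u j) - 2 * F ((1 / 2 : ℝ) • (u i + u j))) ≤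
        C * (2 * (1 / ((n₀ : ℝ) + 1))) := by
      refine mul_le_mul_of_nonneg_left ?_ hC
      have := hmle ((1 / 2 : ℝ) • (u i + u j))
      linarith [hmono i hi, hmono j hj]
    rw [dist_eq_norm]
    refine lt_of_not_ge fun hge => ?_
    have h3 := Real.rpow_le_rpow hε.le hge hp.le
    linarith
  obtain ⟨x, hx⟩ := cauchySeq_tendsto_of_complete hcau
  -- Lower semicontinuity comes from the subgradient at the limit: `F x ≤ F (u n) - DF x (u n - x)`.
  have hFx : F x ≤ m := by
    have h1 : Tendsto (fun n : ℕ => m + 1 / ((n : ℝ) + 1) - DF x (u n - x)) atTop (𝓝 m) := by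
      have : Tendsto (fun n : ℕ => DF x (u n - x)) atTop (𝓝 (DF x (x - x))) :=
        ((DF x).continuous.tendsto _).comp (hx.sub_const x)
      simpa using (hlim.const_add m).sub this
    refine ge_of_tendsto h1 (Eventually.of_forall fun n => ?_)
    linarith [hsub x (u n), hu n]
  -- The subgradient at `x + t • ξ`, read towards the minimizer `x`, gives `0 ≤ t * DF (x + t • ξ)
  -- ξ`. Then `t` decreases to zero.
  have hnn : ∀ ξ, 0 ≤ DF x ξ := by
    intro ξ
    refine ge_of_tendsto (hemi x ξ) ?_
    filter_upwards [self_mem_nhdsWithin] with t ht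
    have h1 := hsub (x + t • ξ) x
    rw [sub_add_cancel_left, map_neg, map_smul, smul_eq_mul] at h1
    have h2 := hmle (x + t • ξ)
    have h3 : 0 ≤ t * DF (x + t • ξ) ξ := by linarith
    exact nonneg_of_mul_nonneg_right h3 ht
  refine ⟨x, ContinuousLinearMap.ext fun ξ => le_antisymm ?_ (hnn ξ)⟩
  have := hnn (-ξ)
  rw [map_neg] at this
  simpa using this

end CriticalPoint

/-! ### Existence for the sum of a coercive local term and a convex nonlocal term. -/

theorem Lp_norm_rpow_eq_integral {Y V : Type*} [MeasurableSpace Y] {μ : Measure Y} [NormedAddCommGroup V]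
    {p : ℝ} (hp : 1 < p) (b : Lp V (ENNReal.ofReal p) μ) :
    ‖b‖ ^ p = ∫ y, ‖b y‖ ^ p ∂μ := by
  have hp0 : 0 < p := by linarith
  rw [Lp.norm_def, ENNReal.toReal_rpow, ← lintegral_enorm_rpow_eq_eLpNorm hp0,
    integral_eq_lintegral_of_nonneg_ae (Eventually.of_forall fun y => by positivity)
      ((Lp.aestronglyMeasurable b).norm.aemeasurable.pow_const p).aestronglyMeasurable]
  congr 1
  refine lintegral_congr fun y => ?_
  rw [← ENNReal.ofReal_rpow_of_nonneg (norm_nonneg _) hp0.le, ofReal_norm]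

theorem Lp_integrable_norm_rpow {Y V : Type*} [MeasurableSpace Y] {μ : Measure Y} [NormedAddCommGroup V]
    {p : ℝ} (hp : 1 < p) (b : Lp V (ENNReal.ofReal p) μ) :
    Integrable (fun y => ‖b y‖ ^ p) μ := by
  have := (Lp.memLp b).integrable_norm_rpow (by simp; linarith) ENNReal.ofReal_ne_top
  rwa [ENNReal.toReal_ofReal (by linarith)] at this

theorem exists_pos_forall_lt_rpow_sub {p : ℝ} (hp : 1 < p) {c α K : ℝ} (hc : 0 < c) :
    ∃ R, 0 ≤ R ∧ ∀ r t : ℝ, R < r → r ≤ c * (t + α) → 0 ≤ t → K * r < (t ^ p - α ^ p) / p := by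
  have hp0 : 0 < p := by linarith
  -- The second threshold turns `r ≤ c (t + α)` into `r / (2c) ≤ t`. The first then gives `t ^ p / p
  -- ≥ (K + 1) r`, and the third spends one `r` on `α ^ p / p`.
  have h1 := ((tendsto_rpow_atTop (by linarith : 0 < p - 1)).eventually_ge_atTop
    ((K + 1) * p * (2 * c) ^ p)).and ((eventually_ge_atTop (2 * c * α)).and
      ((eventually_gt_atTop (α ^ p / p)).and (eventually_gt_atTop 0)))
  obtain ⟨R, hR⟩ := eventually_atTop.1 h1
  refine ⟨max R 0, le_max_right _ _, fun r t hr hrt ht => ?_⟩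
  obtain ⟨h2, h3, h4, h5⟩ := hR r ((le_max_left _ _).trans hr.le)
  have h6 : r / (2 * c) ≤ t := by
    rw [div_le_iff₀ (by positivity)]; linarith
  have h7 : (r / (2 * c)) ^ p ≤ t ^ p := Real.rpow_le_rpow (by positivity) h6 hp0.le
  have h8 : (K + 1) * p * r ≤ (r / (2 * c)) ^ p := by
    rw [Real.div_rpow h5.le (by positivity), le_div_iff₀ (by positivity)]
    have : r ^ p = r ^ (p - 1) * r := by
      rw [← Real.rpow_add_one h5.ne']; congr 1; ring
    rw [this]
    nlinarith
  rw [lt_div_iff₀ hp0]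
  rw [div_lt_iff₀ hp0] at h4
  linarith

section TwoTerms

variable {Y₁ Y₂ : Type*} [MeasurableSpace Y₁] [MeasurableSpace Y₂] {μ₁ : Measure Y₁}
  {μ₂ : Measure Y₂} {V₁ V₂ : Type*} [NormedAddCommGroup V₁] [InnerProductSpace ℝ V₁]
  [NormedAddCommGroup V₂] [InnerProductSpace ℝ V₂]
  {X : Type*} [NormedAddCommGroup X] [NormedSpace ℝ X] {p : ℝ} [Fact (1 ≤ ENNReal.ofReal p)]

theorem pEnergy_coeFn (hp : 1 < p) (T : X →L[ℝ] Lp V₁ (ENNReal.ofReal p) μ₁)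
    (b : Lp V₁ (ENNReal.ofReal p) μ₁) (x : X) :
    pEnergy p T b x = (‖b + T x‖ ^ p - ‖b‖ ^ p) / p := by
  rw [Lp_norm_rpow_eq_integral hp, Lp_norm_rpow_eq_integral hp,
    ← integral_sub (Lp_integrable_norm_rpow hp _) (Lp_integrable_norm_rpow hp _),
    ← integral_div, pEnergy]
  refine integral_congr_ae ?_
  filter_upwards [Lp.coeFn_add b (T x)] with y hy
  rw [hy, Pi.add_apply, sub_div]

/-- The pointwise uniform convexity inequality is integrated at `u = b + T x` and `v = b + T z`. The
additional factor `p` compensates for the `1 / p` in the energy. -/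
theorem exists_norm_sub_rpow_le_energy_defect [FiniteDimensional ℝ V₁] (hp : 1 < p)
    (T : X →L[ℝ] Lp V₁ (ENNReal.ofReal p) μ₁) (b : Lp V₁ (ENNReal.ofReal p) μ₁) {ε : ℝ}
    (hε : 0 < ε) : ∃ C, 0 ≤ C ∧ ∀ x z : X, ‖T x - T z‖ ^ p ≤
      ε * (‖b + T x‖ ^ p + ‖b + T z‖ ^ p) + C * (pEnergy p T b x + pEnergy p T b z -
        2 * pEnergy p T b ((1 / 2 : ℝ) • (x + z))) := by
  have hp0 : p ≠ 0 := by linarith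
  obtain ⟨C, hC, h⟩ := exists_norm_sub_rpow_le_midpoint_defect (V := V₁) hp hε
  refine ⟨C * p, by positivity, fun x z => ?_⟩
  have e : b + T ((1 / 2 : ℝ) • (x + z)) = (1 / 2 : ℝ) • ((b + T x) + (b + T z)) := by
    rw [map_smul, map_add]; module
  have hsum : pEnergy p T b x + pEnergy p T b z - 2 * pEnergy p T b ((1 / 2 : ℝ) • (x + z)) =
      (‖b + T x‖ ^ p + ‖b + T z‖ ^ p -
        2 * ‖(1 / 2 : ℝ) • ((b + T x) + (b + T z))‖ ^ p) / p := by
    rw [pEnergy_coeFn hp, pEnergy_coeFn hp, pEnergy_coeFn hp, e]; ring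
  rw [hsum, mul_assoc, mul_div_cancel₀ _ hp0]
  set u := b + T x
  set v := b + T z
  have huv : T x - T z = u - v := by simp only [u, v]; abel
  have hi := Lp_integrable_norm_rpow (μ := μ₁) (V := V₁) hp
  have I₁ : Integrable (fun y => ‖u y‖ ^ p + ‖v y‖ ^ p) μ₁ := (hi u).add (hi v)
  have I₂ : Integrable (fun y => 2 * ‖((1 / 2 : ℝ) • (u + v) : Lp V₁ (ENNReal.ofReal p) μ₁) y‖ ^ p)
    μ₁ := (hi _).const_mul 2
  have I₃ : Integrable (fun y => ‖u y‖ ^ p + ‖v y‖ ^ p -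
      2 * ‖((1 / 2 : ℝ) • (u + v) : Lp V₁ (ENNReal.ofReal p) μ₁) y‖ ^ p) μ₁ := I₁.sub I₂
  rw [huv, Lp_norm_rpow_eq_integral hp, Lp_norm_rpow_eq_integral hp, Lp_norm_rpow_eq_integral hp,
    Lp_norm_rpow_eq_integral hp, ← integral_const_mul 2, ← integral_add (hi u) (hi v),
    ← integral_sub I₁ I₂, ← integral_const_mul, ← integral_const_mul,
    ← integral_add (I₁.const_mul _) (I₃.const_mul _)]
  refine integral_mono_ae (hi _) ((I₁.const_mul _).add (I₃.const_mul _)) ?_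
  filter_upwards [Lp.coeFn_sub u v, Lp.coeFn_smul (1 / 2 : ℝ) (u + v), Lp.coeFn_add u v]
    with y h1 h2 h3
  simp only [h1, h2, h3, Pi.sub_apply, Pi.smul_apply, Pi.add_apply]
  exact h (u y) (v y)

theorem exists_functional_add_eq [FiniteDimensional ℝ V₁] [CompleteSpace X] (hp : 1 < p)
    (T₁ : X →L[ℝ] Lp V₁ (ENNReal.ofReal p) μ₁) (T₂ : X →L[ℝ] Lp V₂ (ENNReal.ofReal p) μ₂)
    (b : Lp V₁ (ENNReal.ofReal p) μ₁) {a : Y₂ → V₂} (ha : IsPairable p T₂ a) {A c : ℝ}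
    (hA : 0 ≤ A) (hc : 0 < c) (hT : ∀ x, ‖x‖ ≤ c * ‖T₁ x‖) (ℓ : X →L[ℝ] ℝ) :
    ∃ x, ∀ ξ, ∫ y, inner ℝ (pMap p (b y + T₁ x y)) (T₁ ξ y) ∂μ₁ +
      A * ∫ y, inner ℝ (pMap p (a y + T₂ x y)) (T₂ ξ y) ∂μ₂ = ℓ ξ := by
  have hp0 : 0 < p := by linarith
  have hb := isPairable_coeFn hp T₁ b
  let F : X → ℝ := fun x => pEnergy p T₁ b x + A * pEnergy p T₂ a x - ℓ x
  let DF : X → X →L[ℝ] ℝ := fun x =>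
    (hb.add_coeFn hp x).functional hp + A • (ha.add_coeFn hp x).functional hp - ℓ
  have hF0 : F 0 = 0 := by simp [F, pEnergy_zero]
  -- `K` bounds the slope at which the nonlocal energy and the load can make the functional
  -- decrease.
  obtain ⟨R, hR0, hR⟩ := exists_pos_forall_lt_rpow_sub (K := A * ‖ha.functional hp‖ + ‖ℓ‖) (α := ‖b‖) hp hc
  suffices hcrit : ∃ x, DF x = 0 by
    obtain ⟨x, hx⟩ := hcrit
    refine ⟨x, fun ξ => ?_⟩
    have := congrArg (fun g : X →L[ℝ] ℝ => g ξ) hx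
    simp only [DF, _root_.sub_apply, _root_.add_apply, _root_.smul_apply, smul_eq_mul,
      IsPairable.functional_apply, _root_.zero_apply] at this
    linarith
  refine exists_critical_point hp0 F DF ?_ ?_ R ?_ ?_
  · intro x z
    have h1 := hb.energy_add_le hp x z
    have h2 := mul_le_mul_of_nonneg_left (ha.energy_add_le hp x z) hA
    simp only [F, DF, _root_.sub_apply, _root_.add_apply,
      _root_.smul_apply, smul_eq_mul, map_sub] at h1 h2 ⊢
    linarith
  · intro x ξ
    simp only [DF, _root_.sub_apply, _root_.add_apply,
      _root_.smul_apply, smul_eq_mul]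
    exact ((hb.tendsto_functional hp x ξ).add
      ((ha.tendsto_functional hp x ξ).const_mul A)).sub_const _
  · intro x hx
    have h1 : ‖x‖ ≤ c * (‖b + T₁ x‖ + ‖b‖) := by
      refine (hT x).trans (mul_le_mul_of_nonneg_left ?_ hc.le)
      have := norm_sub_le (b + T₁ x) b
      rwa [add_sub_cancel_left] at this
    have h2 := hR ‖x‖ ‖b + T₁ x‖ hx h1 (norm_nonneg _)
    have h3 := mul_le_mul_of_nonneg_left (ha.functional_le_energy hp x) hA
    have h4 := mul_le_mul_of_nonneg_left
      ((neg_le_abs _).trans ((ha.functional hp).le_opNorm x)) hA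
    have h5 := (le_abs_self _).trans (ℓ.le_opNorm x)
    rw [hF0]
    simp only [F, pEnergy_coeFn hp]
    linarith
  · intro ε hε
    set M := ‖b‖ + ‖T₁‖ * R with hM
    have hM0 : 0 ≤ M := by positivity
    -- On the ball of radius `R` the two norms contribute at most `2 M ^ p`, and the passage from
    -- `T₁ x` to `x` costs `c ^ p`. The `+ 1` keeps the denominator positive when `M = 0`.
    obtain ⟨C, hC, h⟩ := exists_norm_sub_rpow_le_energy_defect hp T₁ b
      (ε := ε / (c ^ p * (2 * M ^ p + 1))) (by positivity)
    refine ⟨c ^ p * C, by positivity, fun x z hx hz => ?_⟩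
    have hbd : ∀ w : X, ‖w‖ ≤ R → ‖b + T₁ w‖ ^ p ≤ M ^ p := fun w hw => by
      refine Real.rpow_le_rpow (norm_nonneg _) ((norm_add_le _ _).trans ?_) hp0.le
      exact add_le_add le_rfl ((T₁.le_opNorm w).trans
        (mul_le_mul_of_nonneg_left hw (norm_nonneg _)))
    have h1 : ‖x - z‖ ^ p ≤ c ^ p * ‖T₁ x - T₁ z‖ ^ p := by
      rw [← Real.mul_rpow hc.le (norm_nonneg _), ← map_sub]
      exact Real.rpow_le_rpow (norm_nonneg _) (hT _) hp0.le
    have h2 := h x z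
    have h3 : ε / (c ^ p * (2 * M ^ p + 1)) * (‖b + T₁ x‖ ^ p + ‖b + T₁ z‖ ^ p) ≤
        ε / c ^ p := by
      rw [← div_div, div_mul_eq_mul_div, div_le_iff₀ (by positivity)]
      refine mul_le_mul_of_nonneg_left ?_ (by positivity)
      linarith [hbd x hx, hbd z hz]
    have h4 : pEnergy p T₁ b x + pEnergy p T₁ b z - 2 * pEnergy p T₁ b ((1 / 2 : ℝ) • (x + z)) ≤
        F x + F z - 2 * F ((1 / 2 : ℝ) • (x + z)) := by
      have := mul_le_mul_of_nonneg_left (ha.two_mul_energy_midpoint_le hp x z) hA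
      simp only [F, map_smul, map_add, smul_eq_mul] at this ⊢
      linarith
    have h5 := mul_le_mul_of_nonneg_left h4 hC
    have hcp : 0 < c ^ p := by positivity
    calc ‖x - z‖ ^ p ≤ c ^ p * ‖T₁ x - T₁ z‖ ^ p := h1
      _ ≤ c ^ p * (ε / c ^ p + C * (F x + F z - 2 * F ((1 / 2 : ℝ) • (x + z)))) := by
          refine mul_le_mul_of_nonneg_left ?_ hcp.le
          linarith
      _ = _ := by rw [mul_add, mul_div_cancel₀ _ hcp.ne', mul_assoc]

end TwoTerms

/-! ### Test functions and weak gradients. -/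

section WeakGradient

variable {N : ℕ}

notation:max "𝔼" n:max => EuclideanSpace ℝ (Fin n)

theorem MeasureTheory.LocallyIntegrableOn.integrable_smul_of_tsupport_subset {F : Type*} [NormedAddCommGroup F]
    [NormedSpace ℝ F] {Ω : Set (𝔼 N)} {G : 𝔼 N → F} (hG : LocallyIntegrableOn G Ω) {ψ : 𝔼 N → ℝ}
    (hψ : Continuous ψ) (hc : HasCompactSupport ψ) (hs : tsupport ψ ⊆ Ω) :
    Integrable (fun x => ψ x • G x) := by
  have h1 : IntegrableOn (fun x => ψ x • G x) (tsupport ψ) :=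
    (hG.integrableOn_compact_subset hs hc).continuousOn_smul hψ.continuousOn hc
  refine (integrableOn_iff_integrable_of_support_subset fun x hx => ?_).1 h1
  by_contra h
  exact hx (by simp [image_eq_zero_of_notMem_tsupport h])

theorem MeasureTheory.LocallyIntegrableOn.integrable_smul_right_of_tsupport_subset {F : Type*}
    [NormedAddCommGroup F] [NormedSpace ℝ F] {Ω : Set (𝔼 N)} {u : 𝔼 N → ℝ}
    (hu : LocallyIntegrableOn u Ω) {H : 𝔼 N → F} (hH : Continuous H) {K : Set (𝔼 N)}
    (hK : IsCompact K) (hKΩ : K ⊆ Ω) (hs : ∀ x ∉ K, H x = 0) :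
    Integrable (fun x => u x • H x) := by
  have h1 : IntegrableOn (fun x => u x • H x) K :=
    (hu.integrableOn_compact_subset hKΩ hK).smul_continuousOn hH.continuousOn hK
  refine (integrableOn_iff_integrable_of_support_subset fun x hx => ?_).1 h1
  by_contra h
  exact hx (by simp [hs x h])

namespace IsTestFunction

variable {Ω : Set (𝔼 N)} {ψ η : 𝔼 N → ℝ}

theorem differentiable (h : IsTestFunction Ω ψ) : Differentiable ℝ ψ :=
  h.smooth.differentiable (by simp)

theorem continuous_gradient (h : IsTestFunction Ω ψ) : Continuous (gradient ψ) :=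
  (LinearIsometryEquiv.continuous _).comp (h.smooth.continuous_fderiv (by simp))

theorem gradient_eq_zero (x : 𝔼 N) (hx : x ∉ tsupport ψ) : gradient ψ x = 0 := by
  have : fderiv ℝ ψ x = 0 := image_eq_zero_of_notMem_tsupport
    fun hx' => hx (tsupport_fderiv_subset ℝ hx')
  rw [gradient, this, map_zero]

theorem norm_gradient (x : 𝔼 N) : ‖gradient ψ x‖ = ‖fderiv ℝ ψ x‖ := by
  rw [gradient, LinearIsometryEquiv.norm_map]

theorem hasCompactSupport_gradient (h : IsTestFunction Ω ψ) : HasCompactSupport (gradient ψ) :=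
  HasCompactSupport.intro h.compact fun x hx => gradient_eq_zero x hx

theorem eq_zero_of_notMem (h : IsTestFunction Ω ψ) {x : 𝔼 N} (hx : x ∉ Ω) : ψ x = 0 :=
  image_eq_zero_of_notMem_tsupport fun hx' => hx (h.support_subset hx')

theorem gradient_eq_zero_of_notMem (h : IsTestFunction Ω ψ) {x : 𝔼 N} (hx : x ∉ Ω) :
    gradient ψ x = 0 :=
  gradient_eq_zero x fun hx' => hx (h.support_subset hx')

theorem mono {Ω' : Set (𝔼 N)} (h : IsTestFunction Ω ψ) (hΩ : Ω ⊆ Ω') : IsTestFunction Ω' ψ :=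
  ⟨h.smooth, h.compact, h.support_subset.trans hΩ⟩

theorem zero : IsTestFunction Ω (fun _ => (0 : ℝ)) :=
  ⟨contDiff_const, HasCompactSupport.zero, by
    have : tsupport (fun _ : 𝔼 N => (0 : ℝ)) = ∅ := tsupport_eq_empty_iff.2 rfl
    simp [this]⟩

theorem add (h : IsTestFunction Ω ψ) (h' : IsTestFunction Ω η) :
    IsTestFunction Ω (fun x => ψ x + η x) :=
  ⟨h.smooth.add h'.smooth, h.compact.add h'.compact, (tsupport_add ψ η).trans
    (Set.union_subset h.support_subset h'.support_subset)⟩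

theorem const_mul (h : IsTestFunction Ω ψ) (c : ℝ) : IsTestFunction Ω (fun x => c * ψ x) :=
  ⟨contDiff_const.mul h.smooth, h.compact.mul_left,
    (closure_mono (Function.support_mul_subset_right _ _)).trans h.support_subset⟩

theorem gradient_add (h : IsTestFunction Ω ψ) (h' : IsTestFunction Ω η) (x : 𝔼 N) :
    gradient (fun x => ψ x + η x) x = gradient ψ x + gradient η x := by
  rw [gradient, gradient, gradient, ← map_add, fderiv_fun_add (h.differentiable x)
    (h'.differentiable x)]

theorem gradient_const_mul (h : IsTestFunction Ω ψ) (c : ℝ) (x : 𝔼 N) :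
    gradient (fun x => c * ψ x) x = c • gradient ψ x := by
  rw [gradient, gradient, fderiv_const_mul (h.differentiable x)]
  simp

theorem comp_sub {O : Set (𝔼 N)} (h : IsTestFunction Ω ψ) (a : 𝔼 N) (hO : ∀ x ∈ Ω, x + a ∈ O) :
    IsTestFunction O (fun x => ψ (x - a)) := by
  have hs : tsupport (fun x => ψ (x - a)) = (Homeomorph.subRight a) ⁻¹' tsupport ψ :=
    tsupport_comp_eq_preimage ψ (Homeomorph.subRight a)
  refine ⟨h.smooth.comp (contDiff_id.sub contDiff_const),
    h.compact.comp_homeomorph (Homeomorph.subRight a), ?_⟩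
  rw [hs]
  intro x hx
  have := hO _ (h.support_subset hx)
  simpa using this

theorem gradient_comp_sub (a x : 𝔼 N) :
    gradient (fun x => ψ (x - a)) x = gradient ψ (x - a) := by
  rw [gradient, gradient, fderiv_comp_sub]

theorem memLp (h : IsTestFunction Ω ψ) (p : ℝ≥0∞) (μ : Measure (𝔼 N)) [IsFiniteMeasureOnCompacts μ] :
    MemLp ψ p μ :=
  h.smooth.continuous.memLp_of_hasCompactSupport h.compact

theorem memLp_gradient (h : IsTestFunction Ω ψ) (p : ℝ≥0∞) (μ : Measure (𝔼 N))
    [IsFiniteMeasureOnCompacts μ] : MemLp (gradient ψ) p μ :=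
  h.continuous_gradient.memLp_of_hasCompactSupport h.hasCompactSupport_gradient

theorem integrable_smul_gradient (h : IsTestFunction Ω ψ) {u : 𝔼 N → ℝ}
    (hu : LocallyIntegrableOn u Ω) : Integrable (fun x => u x • gradient ψ x) :=
  hu.integrable_smul_right_of_tsupport_subset h.continuous_gradient h.compact h.support_subset
    fun x hx => gradient_eq_zero x hx

theorem integrable_smul (h : IsTestFunction Ω ψ) {G : 𝔼 N → 𝔼 N} (hG : LocallyIntegrableOn G Ω) :
    Integrable (fun x => ψ x • G x) :=
  hG.integrable_smul_of_tsupport_subset h.smooth.continuous h.compact h.support_subset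

theorem setIntegral_smul_gradient (h : IsTestFunction Ω ψ) (u : 𝔼 N → ℝ) :
    ∫ x in Ω, u x • gradient ψ x = ∫ x, u x • gradient ψ x :=
  setIntegral_eq_integral_of_forall_compl_eq_zero fun x hx => by
    rw [h.gradient_eq_zero_of_notMem hx, smul_zero]

theorem setIntegral_smul (h : IsTestFunction Ω ψ) (G : 𝔼 N → 𝔼 N) :
    ∫ x in Ω, ψ x • G x = ∫ x, ψ x • G x :=
  setIntegral_eq_integral_of_forall_compl_eq_zero fun x hx => by
    rw [h.eq_zero_of_notMem hx, zero_smul]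

end IsTestFunction

namespace IsWeakGradient

variable {Ω O : Set (𝔼 N)} {u v : 𝔼 N → ℝ} {G H : 𝔼 N → 𝔼 N}

theorem integral_eq' (h : IsWeakGradient Ω u G) {ψ : 𝔼 N → ℝ} (hψ : IsTestFunction Ω ψ) :
    ∫ x, u x • gradient ψ x = - ∫ x, ψ x • G x := by
  rw [← hψ.setIntegral_smul_gradient, ← hψ.setIntegral_smul, h.integral_eq ψ hψ]

theorem mono (h : IsWeakGradient Ω u G) (hO : O ⊆ Ω) : IsWeakGradient O u G where
  locallyIntegrable := h.locallyIntegrable.mono_set hO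
  locallyIntegrable_grad := h.locallyIntegrable_grad.mono_set hO
  integral_eq ψ hψ := by
    rw [hψ.setIntegral_smul_gradient, hψ.setIntegral_smul, h.integral_eq' (hψ.mono hO)]

theorem congr_ae (h : IsWeakGradient Ω u G) (hu : u =ᵐ[volume.restrict Ω] v)
    (hG : G =ᵐ[volume.restrict Ω] H) : IsWeakGradient Ω v H where
  locallyIntegrable := h.locallyIntegrable.congr hu
  locallyIntegrable_grad := h.locallyIntegrable_grad.congr hG
  integral_eq ψ hψ := by
    rw [← integral_congr_ae (hu.smul (EventuallyEq.refl _ (gradient ψ))), h.integral_eq ψ hψ]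
    congr 1
    exact integral_congr_ae ((EventuallyEq.refl _ ψ).smul hG)

theorem add (h : IsWeakGradient Ω u G) (h' : IsWeakGradient Ω v H) :
    IsWeakGradient Ω (fun x => u x + v x) (fun x => G x + H x) where
  locallyIntegrable := h.locallyIntegrable.add h'.locallyIntegrable
  locallyIntegrable_grad := h.locallyIntegrable_grad.add h'.locallyIntegrable_grad
  integral_eq ψ hψ := by
    simp_rw [add_smul, smul_add]
    rw [integral_add (hψ.integrable_smul_gradient h.locallyIntegrable).integrableOn
      (hψ.integrable_smul_gradient h'.locallyIntegrable).integrableOn,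
      integral_add (hψ.integrable_smul h.locallyIntegrable_grad).integrableOn
      (hψ.integrable_smul h'.locallyIntegrable_grad).integrableOn, h.integral_eq ψ hψ,
      h'.integral_eq ψ hψ, neg_add]

theorem sub (h : IsWeakGradient Ω u G) (h' : IsWeakGradient Ω v H) :
    IsWeakGradient Ω (fun x => u x - v x) (fun x => G x - H x) where
  locallyIntegrable := h.locallyIntegrable.sub h'.locallyIntegrable
  locallyIntegrable_grad := h.locallyIntegrable_grad.sub h'.locallyIntegrable_grad
  integral_eq ψ hψ := by
    simp_rw [sub_smul, smul_sub]
    rw [integral_sub (hψ.integrable_smul_gradient h.locallyIntegrable).integrableOn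
      (hψ.integrable_smul_gradient h'.locallyIntegrable).integrableOn,
      integral_sub (hψ.integrable_smul h.locallyIntegrable_grad).integrableOn
      (hψ.integrable_smul h'.locallyIntegrable_grad).integrableOn, h.integral_eq ψ hψ,
      h'.integral_eq ψ hψ]
    abel

/-- The difference of two weak gradients integrates to zero against every test function, so the
fundamental lemma of the calculus of variations applies. -/
theorem ae_eq (hΩ : IsOpen Ω) (h : IsWeakGradient Ω u G) (h' : IsWeakGradient Ω u H) :
    G =ᵐ[volume.restrict Ω] H := by
  have key := hΩ.ae_eq_zero_of_integral_contDiff_smul_eq_zero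
    (h.locallyIntegrable_grad.sub h'.locallyIntegrable_grad) (fun ψ h1 h2 h3 => by
      have hψ : IsTestFunction Ω ψ := ⟨h1, h2, h3⟩
      have e1 := h.integral_eq' hψ
      rw [h'.integral_eq' hψ] at e1
      simp_rw [Pi.sub_apply, smul_sub]
      rw [integral_sub (hψ.integrable_smul h.locallyIntegrable_grad)
        (hψ.integrable_smul h'.locallyIntegrable_grad), sub_eq_zero]
      exact (neg_injective e1).symm)
  rw [EventuallyEq, ae_restrict_iff' hΩ.measurableSet]
  filter_upwards [key] with x hx hxΩ
  exact sub_eq_zero.1 (hx hxΩ)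

end IsWeakGradient

theorem IsTestFunction.isWeakGradient {Ω : Set (𝔼 N)} {ψ : 𝔼 N → ℝ} (h : IsTestFunction Ω ψ) :
    IsWeakGradient Set.univ ψ (gradient ψ) where
  locallyIntegrable := h.smooth.continuous.locallyIntegrable.locallyIntegrableOn _
  locallyIntegrable_grad := h.continuous_gradient.locallyIntegrable.locallyIntegrableOn _
  integral_eq η hη := by
    have hi : Integrable (fun x => ψ x • gradient η x) :=
      hη.integrable_smul_gradient (h.smooth.continuous.locallyIntegrable.locallyIntegrableOn _)
    have hi' : Integrable (fun x => η x • gradient ψ x) :=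
      hη.integrable_smul (h.continuous_gradient.locallyIntegrable.locallyIntegrableOn _)
    rw [Measure.restrict_univ]
    refine ext_inner_left ℝ fun v => ?_
    rw [inner_neg_right, ← integral_inner hi, ← integral_inner hi']
    simp_rw [real_inner_smul_right, real_inner_comm _ v, inner_gradient_left]
    have e := integral_mul_fderiv_eq_neg_fderiv_mul_of_integrable (μ := volume) (f := ψ) (g := η)
      (v := v) ?_ ?_ ?_ (fun x _ => h.differentiable x) (fun x _ => hη.differentiable x)
    · rw [e]; simp_rw [mul_comm]
    · have := hi'.const_inner (𝕜 := ℝ) v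
      simpa [real_inner_smul_left, real_inner_comm _ v, inner_gradient_left, mul_comm] using this
    · have := hi.const_inner (𝕜 := ℝ) v
      simpa [real_inner_smul_left, real_inner_comm _ v, inner_gradient_left, mul_comm] using this
    · exact (h.smooth.continuous.mul hη.smooth.continuous).integrable_of_hasCompactSupport
        h.compact.mul_right

end WeakGradient

/-! ### Translation estimates from weak gradients. -/

theorem enorm_inner_le_mul {V : Type*} [NormedAddCommGroup V] [InnerProductSpace ℝ V] (v w : V) :
    ‖(inner ℝ v w : ℝ)‖ₑ ≤ ‖v‖ₑ * ‖w‖ₑ := by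
  rw [enorm_eq_nnnorm, enorm_eq_nnnorm, enorm_eq_nnnorm, ← ENNReal.coe_mul]
  exact ENNReal.coe_le_coe.2 (nnnorm_inner_le_nnnorm v w)

section Translation

variable {N : ℕ} {O U : Set (𝔼 N)} {u : 𝔼 N → ℝ} {G : 𝔼 N → 𝔼 N}

theorem measurePreserving_prodMk_add_smul (ν : Measure ℝ) [SFinite ν] (h : 𝔼 N) :
    MeasurePreserving (fun z : ℝ × 𝔼 N => (z.1, z.2 + z.1 • h)) (ν.prod volume)
      (ν.prod volume) :=
  (MeasurePreserving.id ν).skew_product (g := fun (t : ℝ) (x : 𝔼 N) => x + t • h)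
    (by fun_prop) (ae_of_all _ fun t => map_add_right_eq_self _ _)

/-- A function with integrable weak gradient is absolutely continuous along translations. -/
theorem ae_sub_eq_integral_inner_weakGradient (hU : IsOpen U) (hu : Integrable u)
    (hG : Integrable G)
    (hw : ∀ ψ, IsTestFunction O ψ → ∫ x, u x • gradient ψ x = - ∫ x, ψ x • G x) (h : 𝔼 N)
    (hUO : ∀ x ∈ U, ∀ t ∈ Set.Ioc (0 : ℝ) 1, x + t • h ∈ O) :
    ∀ᵐ x, x ∈ U →
      u (x + h) - u x = ∫ t in Set.Ioc (0 : ℝ) 1, inner ℝ (G (x + t • h)) h := by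
  set ν : Measure ℝ := volume.restrict (Set.Ioc (0 : ℝ) 1) with hν
  have hGi : Integrable (fun z : ℝ × 𝔼 N => inner ℝ (G (z.2 + z.1 • h)) h) (ν.prod volume) :=
    ((measurePreserving_prodMk_add_smul ν h).integrable_comp_of_integrable
      (hG.comp_snd ν)).inner_const h
  have hJ : Integrable (fun x => ∫ t, inner ℝ (G (x + t • h)) h ∂ν) := hGi.integral_prod_right
  have huh : Integrable (fun x => u (x + h)) := hu.comp_add_right h
  -- The identity is checked against test functions in `U`. The translation is moved onto `ψ`, where
  -- the fundamental theorem of calculus is available, and Fubini together with the weak formulation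
  -- for the translates of `ψ` moves it back.
  have key := hU.ae_eq_zero_of_integral_contDiff_smul_eq_zero (μ := volume)
    (f := fun x => u (x + h) - u x - ∫ t, inner ℝ (G (x + t • h)) h ∂ν)
    (((huh.sub hu).sub hJ).locallyIntegrable.locallyIntegrableOn U) (fun ψ h1 h2 h3 => by
      have hψ : IsTestFunction U ψ := ⟨h1, h2, h3⟩
      obtain ⟨C, hC⟩ := h2.exists_bound_of_continuous h1.continuous
      obtain ⟨D, hD⟩ := hψ.hasCompactSupport_gradient.exists_bound_of_continuous
        hψ.continuous_gradient
      have hψb : ∀ {f : 𝔼 N → ℝ}, Integrable f → Integrable fun x => ψ x * f x := fun hf =>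
        hf.bdd_mul (c := C) h1.continuous.aestronglyMeasurable (Eventually.of_forall hC)
      have hψs : Integrable fun x => ψ (x - h) * u x :=
        hu.bdd_mul (c := C) (by fun_prop) (Eventually.of_forall fun x => hC _)
      have ht : ∀ t ∈ Set.Ioc (0 : ℝ) 1, ∫ x, u x * inner ℝ (gradient ψ (x - t • h)) h =
          - ∫ x, ψ x * inner ℝ (G (x + t • h)) h := by
        intro t ht
        have hψt : IsTestFunction O (fun x => ψ (x - t • h)) :=
          hψ.comp_sub _ fun x hx => hUO x hx t ht
        have e := congrArg (fun v => inner ℝ v h) (hw _ hψt)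
        have i1 := hψt.integrable_smul_gradient (hu.locallyIntegrable.locallyIntegrableOn O)
        have i2 := hψt.integrable_smul (hG.locallyIntegrable.locallyIntegrableOn O)
        simp only [inner_neg_left] at e
        rw [real_inner_comm, ← integral_inner i1, real_inner_comm, ← integral_inner i2] at e
        simp only [IsTestFunction.gradient_comp_sub, real_inner_comm _ h,
          real_inner_smul_left] at e
        rw [e, ← integral_add_right_eq_self _ (t • h)]
        simp
      have hftc : ∀ x, ψ (x - h) - ψ x = - ∫ t, inner ℝ (gradient ψ (x - t • h)) h ∂ν := by
        intro x
        have hd : ∀ t ∈ Set.uIcc (0 : ℝ) 1, HasDerivAt (fun t : ℝ => ψ (x - t • h))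
            (- inner ℝ (gradient ψ (x - t • h)) h) t := by
          intro t _
          have e1 : HasDerivAt (fun t : ℝ => x - t • h) (-h) t := by
            simpa using ((hasDerivAt_id t).smul_const h).const_sub x
          have e2 := (hψ.differentiable (x - t • h)).hasFDerivAt.comp_hasDerivAt t e1
          rw [map_neg] at e2
          rwa [inner_gradient_left]
        have hcont : Continuous fun t : ℝ => - inner ℝ (gradient ψ (x - t • h)) h :=
          ((hψ.continuous_gradient.comp (by fun_prop)).inner continuous_const).neg
        have e := intervalIntegral.integral_eq_sub_of_hasDerivAt hd (hcont.intervalIntegrable _ _)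
        rw [intervalIntegral.integral_of_le zero_le_one, integral_neg] at e
        simpa using e.symm
      have hF1 : Integrable (fun z : ℝ × 𝔼 N => u z.2 * inner ℝ (gradient ψ (z.2 - z.1 • h)) h)
          (ν.prod volume) := by
        refine (hu.comp_snd ν).mul_bdd (c := D * ‖h‖) ?_ (Eventually.of_forall fun z => ?_)
        · exact ((hψ.continuous_gradient.comp (by fun_prop)).inner
            continuous_const).aestronglyMeasurable
        · refine (norm_inner_le_norm _ _).trans ?_
          exact mul_le_mul_of_nonneg_right (hD _) (norm_nonneg _)
      have hF2 : Integrable (fun z : ℝ × 𝔼 N => ψ z.2 * inner ℝ (G (z.2 + z.1 • h)) h)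
          (ν.prod volume) :=
        hGi.bdd_mul (c := C) (h1.continuous.comp continuous_snd).aestronglyMeasurable
          (Eventually.of_forall fun z => hC _)
      have e1 : ∫ x, ψ x * u (x + h) = ∫ x, ψ (x - h) * u x := by
        rw [← integral_sub_right_eq_self _ h]
        simp
      have e2 : ∫ x, (ψ (x - h) * u x - ψ x * u x) =
          ∫ x, ψ x * ∫ t, inner ℝ (G (x + t • h)) h ∂ν := by
        calc ∫ x, (ψ (x - h) * u x - ψ x * u x)
            = ∫ x, - ∫ t, u x * inner ℝ (gradient ψ (x - t • h)) h ∂ν := by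
              congr 1; ext x
              rw [← sub_mul, hftc, integral_const_mul]; ring
          _ = - ∫ t, (∫ x, u x * inner ℝ (gradient ψ (x - t • h)) h) ∂ν := by
              rw [integral_neg, integral_integral_swap]
              exact hF1.swap
          _ = ∫ t, (∫ x, ψ x * inner ℝ (G (x + t • h)) h) ∂ν := by
              rw [← integral_neg]
              refine setIntegral_congr_fun measurableSet_Ioc fun t htm => ?_
              simp only [ht t htm, neg_neg]
          _ = ∫ x, ∫ t, ψ x * inner ℝ (G (x + t • h)) h ∂ν := integral_integral_swap hF2
          _ = _ := by simp_rw [integral_const_mul]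
      simp_rw [smul_eq_mul, mul_sub]
      have i1 : Integrable (fun x => ψ x * u (x + h) - ψ x * u x) := (hψb huh).sub (hψb hu)
      rw [integral_sub i1 (hψb hJ), integral_sub (hψb huh) (hψb hu), e1,
        ← integral_sub hψs (hψb hu), e2, sub_self])
  filter_upwards [key] with x hx hxU
  exact sub_eq_zero.1 (hx hxU)

/-- Hölder against the constant function `1`. -/
theorem lintegral_rpow_le_measure_mul {Y : Type*} [MeasurableSpace Y] (ν : Measure Y)
    {p : ℝ} (hp : 1 < p) {f : Y → ℝ≥0∞} (hf : AEMeasurable f ν) :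
    (∫⁻ t, f t ∂ν) ^ p ≤ ν Set.univ ^ (p - 1) * ∫⁻ t, f t ^ p ∂ν := by
  have hq := Real.HolderConjugate.conjExponent hp
  have h := ENNReal.lintegral_mul_le_Lp_mul_Lq ν hq hf (aemeasurable_const (b := 1))
  simp only [Pi.mul_apply, mul_one, ENNReal.one_rpow, lintegral_const, one_mul] at h
  have h2 := ENNReal.rpow_le_rpow h hq.nonneg
  rw [ENNReal.mul_rpow_of_nonneg _ _ hq.nonneg, ← ENNReal.rpow_mul, ← ENNReal.rpow_mul,
    one_div_mul_cancel hq.ne_zero, ENNReal.rpow_one, one_div_mul_eq_div, hq.div_conj_eq_sub_one,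
    mul_comm] at h2
  exact h2

/-- The increment is an average of `∇u · h` along the segment. Hölder in `t` and translation
invariance in `x` finish. The weak gradient identity is needed only on a set `O` containing the
segments, which suits a function that is Sobolev only near `Ω`. -/
theorem lintegral_enorm_sub_rpow_le {p : ℝ} (hp : 1 < p) (hU : IsOpen U) (hu : Integrable u)
    (hG : Integrable G)
    (hw : ∀ ψ, IsTestFunction O ψ → ∫ x, u x • gradient ψ x = - ∫ x, ψ x • G x) (h : 𝔼 N)
    (hUO : ∀ x ∈ U, ∀ t ∈ Set.Ioc (0 : ℝ) 1, x + t • h ∈ O) :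
    ∫⁻ x in U, ‖u (x + h) - u x‖ₑ ^ p ≤ ‖h‖ₑ ^ p * ∫⁻ x, ‖G x‖ₑ ^ p := by
  have hp0 : 0 ≤ p := by linarith
  set ν : Measure ℝ := volume.restrict (Set.Ioc (0 : ℝ) 1) with hν
  have : IsProbabilityMeasure ν := ⟨by simp [hν]⟩
  have hmp := measurePreserving_prodMk_add_smul ν h
  have hGm : AEMeasurable (fun z : ℝ × 𝔼 N => ‖G (z.2 + z.1 • h)‖ₑ) (ν.prod volume) :=
    ((hG.comp_snd ν).aestronglyMeasurable.comp_measurePreserving hmp).enorm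
  have hGs : ∀ᵐ x, AEMeasurable (fun t => ‖G (x + t • h)‖ₑ) ν := by
    have := (Measure.measurePreserving_swap (μ := (volume : Measure (𝔼 N))) (ν := ν)).quasiMeasurePreserving
    have h2 := ((hG.comp_snd ν).aestronglyMeasurable.comp_measurePreserving
      hmp).comp_quasiMeasurePreserving this
    filter_upwards [h2.prodMk_left] with x hx
    exact hx.enorm
  calc ∫⁻ x in U, ‖u (x + h) - u x‖ₑ ^ p
      ≤ ∫⁻ x in U, ‖h‖ₑ ^ p * ∫⁻ t, ‖G (x + t • h)‖ₑ ^ p ∂ν := by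
        refine lintegral_mono_ae ?_
        rw [ae_restrict_iff' hU.measurableSet]
        filter_upwards [ae_sub_eq_integral_inner_weakGradient hU hu hG hw h hUO, hGs]
          with x hx hxm hxU
        rw [hx hxU]
        have h1 : ‖∫ t in Set.Ioc (0 : ℝ) 1, inner ℝ (G (x + t • h)) h‖ₑ ≤
            ‖h‖ₑ * ∫⁻ t, ‖G (x + t • h)‖ₑ ∂ν := by
          refine (enorm_integral_le_lintegral_enorm _).trans ?_
          rw [← lintegral_const_mul' _ _ enorm_ne_top]
          refine lintegral_mono fun t => ?_
          rw [mul_comm]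
          exact enorm_inner_le_mul _ _
        refine (ENNReal.rpow_le_rpow h1 hp0).trans ?_
        rw [ENNReal.mul_rpow_of_nonneg _ _ hp0]
        gcongr
        simpa using lintegral_rpow_le_measure_mul ν hp hxm
    _ ≤ ∫⁻ x, ‖h‖ₑ ^ p * ∫⁻ t, ‖G (x + t • h)‖ₑ ^ p ∂ν := setLIntegral_le_lintegral _ _
    _ = ‖h‖ₑ ^ p * ∫⁻ t, (∫⁻ x, ‖G (x + t • h)‖ₑ ^ p) ∂ν := by
        rw [lintegral_const_mul' _ _ (ENNReal.rpow_ne_top_of_nonneg hp0 enorm_ne_top),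
          lintegral_lintegral_swap]
        exact (hGm.pow_const p).prod_swap
    _ = _ := by
        congr 1
        have : ∀ t : ℝ, ∫⁻ x, ‖G (x + t • h)‖ₑ ^ p = ∫⁻ x, ‖G x‖ₑ ^ p := fun t =>
          lintegral_add_right_eq_self (fun x => ‖G x‖ₑ ^ p) _
        simp_rw [this]
        simp

end Translation

/-! ### The space `W_0^{1,p}(Ω)` and the Poincaré inequality. -/

section SobolevZero

variable {N : ℕ} {Ω : Set (𝔼 N)} {p : ℝ} [Fact (1 ≤ ENNReal.ofReal p)]

/-- The pairs `(ψ, ∇ψ)`, for test functions `ψ` in `Ω`. -/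
noncomputable def testPairs (Ω : Set (𝔼 N)) (p : ℝ) [Fact (1 ≤ ENNReal.ofReal p)] :
    Submodule ℝ (Lp ℝ (ENNReal.ofReal p) (volume : Measure (𝔼 N)) ×
      Lp (𝔼 N) (ENNReal.ofReal p) (volume : Measure (𝔼 N))) where
  carrier := {z | ∃ ψ, IsTestFunction Ω ψ ∧ z.1 =ᵐ[volume] ψ ∧ z.2 =ᵐ[volume] gradient ψ}
  add_mem' := by
    rintro x y ⟨ψ, hψ, h1, h2⟩ ⟨η, hη, h3, h4⟩
    refine ⟨_, hψ.add hη, ?_, ?_⟩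
    · filter_upwards [h1, h3, Lp.coeFn_add x.1 y.1] with z e1 e2 e3
      rw [Prod.fst_add, e3, Pi.add_apply, e1, e2]
    · filter_upwards [h2, h4, Lp.coeFn_add x.2 y.2] with z e1 e2 e3
      rw [Prod.snd_add, e3, Pi.add_apply, e1, e2, hψ.gradient_add hη]
  zero_mem' := by
    refine ⟨_, IsTestFunction.zero, ?_, ?_⟩
    · exact Lp.coeFn_zero _ _ _
    · filter_upwards [Lp.coeFn_zero (𝔼 N) (ENNReal.ofReal p) (volume : Measure (𝔼 N))] with z e
      rw [Prod.snd_zero, e, gradient_fun_const]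
      rfl
  smul_mem' := by
    rintro c x ⟨ψ, hψ, h1, h2⟩
    refine ⟨_, hψ.const_mul c, ?_, ?_⟩
    · filter_upwards [h1, Lp.coeFn_smul c x.1] with z e1 e3
      rw [Prod.smul_fst, e3, Pi.smul_apply, e1, smul_eq_mul]
    · filter_upwards [h2, Lp.coeFn_smul c x.2] with z e1 e3
      rw [Prod.smul_snd, e3, Pi.smul_apply, e1, hψ.gradient_const_mul]

/-- The space `W_0^{1,p}(Ω)`, realized as the closed span of the pairs `(ψ, ∇ψ)`; its elements are
pairs consisting of a function, extended by zero outside `Ω`, and of its gradient. -/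
noncomputable def sobolevZero (Ω : Set (𝔼 N)) (p : ℝ) [Fact (1 ≤ ENNReal.ofReal p)] :
    Submodule ℝ (Lp ℝ (ENNReal.ofReal p) (volume : Measure (𝔼 N)) ×
      Lp (𝔼 N) (ENNReal.ofReal p) (volume : Measure (𝔼 N))) :=
  (testPairs Ω p).topologicalClosure

theorem isClosed_sobolevZero :
    IsClosed (sobolevZero Ω p : Set (Lp ℝ (ENNReal.ofReal p) (volume : Measure (𝔼 N)) ×
      Lp (𝔼 N) (ENNReal.ofReal p) (volume : Measure (𝔼 N)))) :=
  Submodule.isClosed_topologicalClosure _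

instance : CompleteSpace (sobolevZero Ω p) :=
  isClosed_sobolevZero.completeSpace_coe

theorem mem_sobolevZero_iff {x : Lp ℝ (ENNReal.ofReal p) (volume : Measure (𝔼 N)) ×
      Lp (𝔼 N) (ENNReal.ofReal p) (volume : Measure (𝔼 N))} :
    x ∈ sobolevZero Ω p ↔ ∃ ψ : ℕ → 𝔼 N → ℝ, (∀ n, IsTestFunction Ω (ψ n)) ∧
      Tendsto (fun n => eLpNorm (fun y => ψ n y - x.1 y) (ENNReal.ofReal p) volume) atTop (𝓝 0) ∧
      Tendsto (fun n => eLpNorm (fun y => gradient (ψ n) y - x.2 y) (ENNReal.ofReal p) volume)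
        atTop (𝓝 0) := by
  rw [sobolevZero, ← SetLike.mem_coe, Submodule.topologicalClosure_coe, mem_closure_iff_seq_limit]
  constructor
  · rintro ⟨z, hz, hlim⟩
    choose ψ hψ h1 h2 using hz
    refine ⟨ψ, hψ, ?_, ?_⟩
    · have := (Lp.tendsto_Lp_iff_tendsto_eLpNorm' _ _).1 ((continuous_fst.tendsto x).comp hlim)
      refine this.congr fun n => eLpNorm_congr_ae ?_
      filter_upwards [h1 n] with y e1
      simp only [Function.comp, Pi.sub_apply, e1]
    · have := (Lp.tendsto_Lp_iff_tendsto_eLpNorm' _ _).1 ((continuous_snd.tendsto x).comp hlim)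
      refine this.congr fun n => eLpNorm_congr_ae ?_
      filter_upwards [h2 n] with y e1
      simp only [Function.comp, Pi.sub_apply, e1]
  · rintro ⟨ψ, hψ, h1, h2⟩
    refine ⟨fun n => (((hψ n).memLp _ _).toLp, ((hψ n).memLp_gradient _ _).toLp),
      fun n => ⟨ψ n, hψ n, ((hψ n).memLp _ _).coeFn_toLp, ((hψ n).memLp_gradient _ _).coeFn_toLp⟩,
      ?_⟩
    rw [Prod.tendsto_iff]
    refine ⟨(Lp.tendsto_Lp_iff_tendsto_eLpNorm' _ _).2 (h1.congr fun n => eLpNorm_congr_ae ?_),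
      (Lp.tendsto_Lp_iff_tendsto_eLpNorm' _ _).2 (h2.congr fun n => eLpNorm_congr_ae ?_)⟩
    · filter_upwards [((hψ n).memLp (ENNReal.ofReal p) volume).coeFn_toLp] with y e1
      simp only [Pi.sub_apply, e1]
    · filter_upwards [((hψ n).memLp_gradient (ENNReal.ofReal p) volume).coeFn_toLp] with y e1
      simp only [Pi.sub_apply, e1]

theorem ae_eq_zero_of_tendsto_eLpNorm_sub {F : Type*} [NormedAddCommGroup F] {S : Set (𝔼 N)}
    (hS : MeasurableSet S) {f : ℕ → 𝔼 N → F} {w : 𝔼 N → F} (hw : AEStronglyMeasurable w)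
    {q : ℝ≥0∞} (hq : q ≠ 0)
    (h : Tendsto (fun n => eLpNorm (fun y => f n y - w y) q volume) atTop (𝓝 0))
    (hf : ∀ n, ∀ x ∈ S, f n x = 0) : ∀ᵐ x, x ∈ S → w x = 0 := by
  have h1 : eLpNorm w q (volume.restrict S) = 0 := by
    refine le_antisymm (ge_of_tendsto h (Eventually.of_forall fun n => ?_)) zero_le
    calc eLpNorm w q (volume.restrict S)
        = eLpNorm (fun y => f n y - w y) q (volume.restrict S) := by
          rw [← eLpNorm_neg]
          refine eLpNorm_congr_ae ?_
          filter_upwards [ae_restrict_mem hS] with x hx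
          simp [hf n x hx]
      _ ≤ _ := eLpNorm_mono_measure _ Measure.restrict_le_self
  rw [eLpNorm_eq_zero_iff hw.restrict hq, EventuallyEq, ae_restrict_iff' hS] at h1
  exact h1

theorem sobolevZero_ae_eq_zero (hp : 0 < p) (hΩ : MeasurableSet Ω)
    {x : Lp ℝ (ENNReal.ofReal p) (volume : Measure (𝔼 N)) ×
      Lp (𝔼 N) (ENNReal.ofReal p) (volume : Measure (𝔼 N))} (hx : x ∈ sobolevZero Ω p) :
    (∀ᵐ y, y ∉ Ω → x.1 y = 0) ∧ ∀ᵐ y, y ∉ Ω → x.2 y = 0 := by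
  obtain ⟨ψ, hψ, h1, h2⟩ := mem_sobolevZero_iff.1 hx
  have hp' : ENNReal.ofReal p ≠ 0 := by simpa using hp
  exact ⟨ae_eq_zero_of_tendsto_eLpNorm_sub hΩ.compl (Lp.aestronglyMeasurable _) hp' h1
      fun n y hy => (hψ n).eq_zero_of_notMem hy,
    ae_eq_zero_of_tendsto_eLpNorm_sub hΩ.compl (Lp.aestronglyMeasurable _) hp' h2
      fun n y hy => (hψ n).gradient_eq_zero_of_notMem hy⟩

theorem Lp_locallyIntegrable {F : Type*} [NormedAddCommGroup F]
    (w : Lp F (ENNReal.ofReal p) (volume : Measure (𝔼 N))) :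
    LocallyIntegrable w :=
  (Lp.memLp w).locallyIntegrable Fact.out

theorem tendsto_integral_bilin {V W Z : Type*} [NormedAddCommGroup V] [NormedSpace ℝ V]
    [NormedAddCommGroup W] [NormedSpace ℝ W] [NormedAddCommGroup Z] [NormedSpace ℝ Z]
    [CompleteSpace Z] (hp : 1 < p) (B : V →L[ℝ] W →L[ℝ] Z) {f : ℕ → 𝔼 N → V} {w : 𝔼 N → V}
    (hf : ∀ n, MemLp (f n) (ENNReal.ofReal p) volume) (hw : MemLp w (ENNReal.ofReal p) volume)
    (h : Tendsto (fun n => eLpNorm (fun y => f n y - w y) (ENNReal.ofReal p) volume) atTop (𝓝 0))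
    {k : 𝔼 N → W} (hk : ∀ q : ℝ≥0∞, MemLp k q volume) :
    Tendsto (fun n => ∫ y, B (f n y) (k y)) atTop (𝓝 (∫ y, B (w y) (k y))) := by
  have := (Real.HolderConjugate.conjExponent hp).ennrealOfReal
  have : Fact (1 ≤ ENNReal.ofReal p.conjExponent) := ⟨by
    rw [← ENNReal.ofReal_one]
    exact ENNReal.ofReal_le_ofReal (Real.HolderConjugate.conjExponent hp).symm.lt.le⟩
  have h1 := (Lp.tendsto_Lp_iff_tendsto_eLpNorm'' f hf w hw).2 h
  have h2 := (((B.lpPairing volume (ENNReal.ofReal p) (ENNReal.ofReal p.conjExponent)).flip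
    (hk _).toLp).continuous.tendsto _).comp h1
  have e : ∀ v : 𝔼 N → V, ∀ hv : MemLp v (ENNReal.ofReal p) volume,
      (B.lpPairing volume (ENNReal.ofReal p) (ENNReal.ofReal p.conjExponent)).flip
        (hk _).toLp hv.toLp = ∫ y, B (v y) (k y) := fun v hv => by
    rw [ContinuousLinearMap.flip_apply, ContinuousLinearMap.lpPairing_eq_integral]
    refine integral_congr_ae ?_
    filter_upwards [hv.coeFn_toLp, (hk (ENNReal.ofReal p.conjExponent)).coeFn_toLp] with y e1 e2
    rw [e1, e2]
  rw [e w hw] at h2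
  exact h2.congr fun n => e _ (hf n)

/-- Integration by parts passes to the `L^p` limit because a test function and its gradient lie in
`L^{p'}`. The identity holds on the whole space, so extension by zero creates no jump across the
boundary of `Ω`. -/
theorem sobolevZero_isWeakGradient (hp : 1 < p)
    {x : Lp ℝ (ENNReal.ofReal p) (volume : Measure (𝔼 N)) ×
      Lp (𝔼 N) (ENNReal.ofReal p) (volume : Measure (𝔼 N))} (hx : x ∈ sobolevZero Ω p) :
    IsWeakGradient Set.univ x.1 x.2 := by
  obtain ⟨ψ, hψ, h1, h2⟩ := mem_sobolevZero_iff.1 hx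
  refine ⟨(Lp_locallyIntegrable _).locallyIntegrableOn _,
    (Lp_locallyIntegrable _).locallyIntegrableOn _, fun η hη => ?_⟩
  rw [Measure.restrict_univ]
  have t1 := tendsto_integral_bilin hp (ContinuousLinearMap.lsmul ℝ ℝ)
    (fun n => (hψ n).memLp _ _) (Lp.memLp x.1) h1 (k := gradient η)
    (fun q => hη.memLp_gradient q _)
  have t2 := tendsto_integral_bilin hp (ContinuousLinearMap.lsmul ℝ ℝ).flip
    (fun n => (hψ n).memLp_gradient _ _) (Lp.memLp x.2) h2 (k := η) (fun q => hη.memLp q _)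
  refine tendsto_nhds_unique t1 (t2.neg.congr fun n => ?_)
  have := (hψ n).isWeakGradient.integral_eq' hη
  simpa using this.symm

theorem sobolevZero_memW1pZero (hp : 1 < p)
    {x : Lp ℝ (ENNReal.ofReal p) (volume : Measure (𝔼 N)) ×
      Lp (𝔼 N) (ENNReal.ofReal p) (volume : Measure (𝔼 N))} (hx : x ∈ sobolevZero Ω p) :
    MemW1pZero Ω p x.1 := by
  obtain ⟨ψ, hψ, h1, h2⟩ := mem_sobolevZero_iff.1 hx
  refine ⟨(Lp.memLp x.1).restrict _, x.2,
    (sobolevZero_isWeakGradient hp hx).mono (Set.subset_univ _), (Lp.memLp x.2).restrict _, ψ, hψ,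
    ?_, ?_⟩
  · exact tendsto_of_tendsto_of_tendsto_of_le_of_le tendsto_const_nhds h1 (fun _ => zero_le)
      fun _ => eLpNorm_mono_measure _ Measure.restrict_le_self
  · exact tendsto_of_tendsto_of_tendsto_of_le_of_le tendsto_const_nhds h2 (fun _ => zero_le)
      fun _ => eLpNorm_mono_measure _ Measure.restrict_le_self

/-- The approximating test functions vanish outside `Ω`, so convergence in `Ω` is convergence of the
zero extensions in the whole space. Uniqueness of weak gradients allows any representative `Dφ`. -/
theorem MemW1pZero.exists_mem_sobolevZero (hΩ : IsOpen Ω) {φ : 𝔼 N → ℝ} {Dφ : 𝔼 N → 𝔼 N}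
    (h : MemW1pZero Ω p φ) (hD : IsWeakGradient Ω φ Dφ) :
    ∃ x ∈ sobolevZero Ω p, x.1 =ᵐ[volume] Ω.indicator φ ∧ x.2 =ᵐ[volume] Ω.indicator Dφ := by
  obtain ⟨hφ, G, hG, hGp, ψ, hψ, h1, h2⟩ := h
  have hGD := hG.ae_eq hΩ hD
  have hφ' : MemLp (Ω.indicator φ) (ENNReal.ofReal p) volume :=
    (memLp_indicator_iff_restrict hΩ.measurableSet).2 hφ
  have hD' : MemLp (Ω.indicator Dφ) (ENNReal.ofReal p) volume :=
    (memLp_indicator_iff_restrict hΩ.measurableSet).2 ((memLp_congr_ae hGD).1 hGp)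
  refine ⟨(hφ'.toLp, hD'.toLp), mem_sobolevZero_iff.2 ⟨ψ, hψ, ?_, ?_⟩, hφ'.coeFn_toLp,
    hD'.coeFn_toLp⟩
  · refine h1.congr fun n => ?_
    rw [← eLpNorm_indicator_eq_eLpNorm_restrict hΩ.measurableSet]
    refine eLpNorm_congr_ae ?_
    filter_upwards [hφ'.coeFn_toLp] with y hy
    rw [hy]
    by_cases hyΩ : y ∈ Ω
    · simp [hyΩ]
    · simp [hyΩ, (hψ n).eq_zero_of_notMem hyΩ]
  · refine h2.congr fun n => ?_
    rw [← eLpNorm_indicator_eq_eLpNorm_restrict hΩ.measurableSet]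
    refine eLpNorm_congr_ae ?_
    rw [EventuallyEq, ae_restrict_iff' hΩ.measurableSet] at hGD
    filter_upwards [hD'.coeFn_toLp, hGD] with y hy hy2
    rw [hy]
    by_cases hyΩ : y ∈ Ω
    · simp [hyΩ, hy2 hyΩ]
    · simp [hyΩ, (hψ n).gradient_eq_zero_of_notMem hyΩ]

theorem Lp_integrable_of_ae_eq_zero {F : Type*} [NormedAddCommGroup F] (hΩ : MeasurableSet Ω)
    (hb : Bornology.IsBounded Ω) (w : Lp F (ENNReal.ofReal p) (volume : Measure (𝔼 N)))
    (hw : ∀ᵐ y, y ∉ Ω → w y = 0) : Integrable w := by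
  have hfin : volume Ω ≠ ⊤ := hb.measure_lt_top.ne
  have : IsFiniteMeasure (volume.restrict Ω) := ⟨by simpa using hfin.lt_top⟩
  have h1 : IntegrableOn w Ω := ((Lp.memLp w).restrict Ω).integrable Fact.out
  rw [← integrable_indicator_iff hΩ] at h1
  refine h1.congr ?_
  filter_upwards [hw] with y hy
  by_cases hyΩ : y ∈ Ω
  · simp [hyΩ]
  · simp [hyΩ, hy hyΩ]

theorem sobolevZero_lintegral_enorm_sub_le (hp : 1 < p) (hΩ : MeasurableSet Ω)
    (hb : Bornology.IsBounded Ω) {x : Lp ℝ (ENNReal.ofReal p) (volume : Measure (𝔼 N)) ×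
      Lp (𝔼 N) (ENNReal.ofReal p) (volume : Measure (𝔼 N))} (hx : x ∈ sobolevZero Ω p)
    (h : 𝔼 N) :
    ∫⁻ y, ‖x.1 (y + h) - x.1 y‖ₑ ^ p ≤ ‖h‖ₑ ^ p * ‖x.2‖ₑ ^ p := by
  have hz := sobolevZero_ae_eq_zero (by linarith) hΩ hx
  have := lintegral_enorm_sub_rpow_le (O := Set.univ) hp isOpen_univ
    (Lp_integrable_of_ae_eq_zero hΩ hb _ hz.1) (Lp_integrable_of_ae_eq_zero hΩ hb _ hz.2)
    (fun ψ hψ => (sobolevZero_isWeakGradient hp hx).integral_eq' hψ) h (fun _ _ _ _ => trivial)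
  rwa [Measure.restrict_univ, lintegral_enorm_rpow_eq_eLpNorm (by linarith) x.2,
    ← Lp.enorm_def] at this

/-- The Poincaré inequality. -/
theorem sobolevZero_exists_norm_le (hN : 1 ≤ N) (hp : 1 < p) (hΩ : MeasurableSet Ω)
    (hb : Bornology.IsBounded Ω) : ∃ C : ℝ, 0 < C ∧ ∀ x ∈ sobolevZero Ω p, ‖x‖ ≤ C * ‖x.2‖ := by
  obtain ⟨R, hR0, hR⟩ := hb.subset_ball_lt 0 0
  have : NeZero N := ⟨by omega⟩
  -- A translation by `2 * R` pushes the ball of radius `R` off itself, so for `y ∈ Ω` the increment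
  -- is `-x.1 y`.
  let h : 𝔼 N := EuclideanSpace.single 0 (2 * R)
  have hnorm : ‖h‖ = 2 * R := by
    simp only [h, PiLp.norm_single]
    exact Real.norm_of_nonneg (by linarith)
  have hp0 : 0 < p := by linarith
  -- The norm of a pair is the maximum of both norms; the `1` accounts for the gradient component.
  refine ⟨max 1 ‖h‖, by positivity, fun x hx => ?_⟩
  have hz := (sobolevZero_ae_eq_zero hp0 hΩ hx).1
  have hzh : ∀ᵐ y, y + h ∉ Ω → x.1 (y + h) = 0 :=
    (measurePreserving_add_right volume h).quasiMeasurePreserving.ae hz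
  have h1 : ‖x.1‖ₑ ^ p ≤ ‖h‖ₑ ^ p * ‖x.2‖ₑ ^ p := by
    refine le_trans ?_ (sobolevZero_lintegral_enorm_sub_le hp hΩ hb hx h)
    rw [Lp.enorm_def, ← lintegral_enorm_rpow_eq_eLpNorm hp0]
    refine lintegral_mono_ae ?_
    filter_upwards [hz, hzh] with y h1 h2
    by_cases hy : y ∈ Ω
    · have hyh : y + h ∉ Ω := fun hyh => by
        have e1 := mem_ball_zero_iff.1 (hR hy)
        have e2 := mem_ball_zero_iff.1 (hR hyh)
        have e3 := norm_sub_le (y + h) y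
        rw [add_sub_cancel_left, hnorm] at e3
        linarith
      rw [h2 hyh, zero_sub, enorm_neg]
    · rw [h1 hy, enorm_zero, ENNReal.zero_rpow_of_pos hp0]
      exact zero_le
  rw [← ENNReal.mul_rpow_of_nonneg _ _ hp0.le, ENNReal.rpow_le_rpow_iff hp0] at h1
  have h2 : ‖x.1‖ ≤ ‖h‖ * ‖x.2‖ := by
    rw [enorm_eq_nnnorm, enorm_eq_nnnorm, enorm_eq_nnnorm, ← ENNReal.coe_mul,
      ENNReal.coe_le_coe] at h1
    exact_mod_cast h1
  rw [Prod.norm_def, max_le_iff]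
  refine ⟨h2.trans (mul_le_mul_of_nonneg_right (le_max_right _ _) (norm_nonneg _)), ?_⟩
  exact le_mul_of_one_le_left (norm_nonneg _) (le_max_left _ _)

end SobolevZero

/-! ### The fractional kernel and its integrability. -/

section Kernel

variable {N : ℕ} {α : ℝ}

/-- The kernel `|h|^{-N-α}`. -/
noncomputable def fracKernel (N : ℕ) (α : ℝ) (h : 𝔼 N) : ℝ≥0∞ :=
  ENNReal.ofReal ((‖h‖ ^ ((N : ℝ) + α))⁻¹)

theorem measurable_fracKernel : Measurable (fracKernel N α) :=
  (measurable_norm.pow_const _).inv.ennreal_ofReal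

theorem measurable_fracKernel_sub :
    Measurable (fun z : 𝔼 N × 𝔼 N => fracKernel N α (z.1 - z.2)) :=
  measurable_fracKernel.comp (measurable_fst.sub measurable_snd)

/-- The measure `|x - y|^{-N-α} dx dy`. -/
noncomputable def fracMeasure (N : ℕ) (α : ℝ) : Measure (𝔼 N × 𝔼 N) :=
  (volume.prod volume).withDensity fun z => fracKernel N α (z.1 - z.2)

theorem fracMeasure_ac : fracMeasure N α ≪ (volume : Measure (𝔼 N)).prod volume :=
  withDensity_absolutelyContinuous _ _

theorem lintegral_fracMeasure' {F : 𝔼 N × 𝔼 N → ℝ≥0∞} (hF : AEMeasurable F (volume.prod volume)) :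
    ∫⁻ z, F z ∂fracMeasure N α =
      ∫⁻ z, fracKernel N α (z.1 - z.2) * F z ∂(volume.prod volume) := by
  rw [fracMeasure, lintegral_withDensity_eq_lintegral_mul₀
    measurable_fracKernel_sub.aemeasurable hF]
  rfl

theorem measurePreserving_prodMk_add :
    MeasurePreserving (fun z : 𝔼 N × 𝔼 N => (z.2 + z.1, z.2)) (volume.prod volume)
      (volume.prod volume) :=
  Measure.measurePreserving_swap.comp (measurePreserving_prod_add_swap volume volume)

/-- The change of variables `x = y + h` isolates the kernel, so estimates for the measure reduce to
estimates for translations. -/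
theorem lintegral_fracMeasure {F : 𝔼 N × 𝔼 N → ℝ≥0∞} (hF : AEMeasurable F (volume.prod volume)) :
    ∫⁻ z, F z ∂fracMeasure N α = ∫⁻ h, fracKernel N α h * ∫⁻ y, F (y + h, y) := by
  have hKF : AEMeasurable (fun z : 𝔼 N × 𝔼 N => fracKernel N α (z.1 - z.2) * F z)
    (volume.prod volume) := measurable_fracKernel_sub.aemeasurable.mul hF
  have hmp := measurePreserving_prodMk_add (N := N)
  rw [lintegral_fracMeasure' hF]
  conv_lhs => rw [← hmp.map_eq]
  rw [lintegral_map' (by rwa [hmp.map_eq]) hmp.measurable.aemeasurable, lintegral_prod]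
  · refine lintegral_congr fun h => ?_
    simp only [add_sub_cancel_left]
    exact lintegral_const_mul' _ _ ENNReal.ofReal_ne_top
  · exact hKF.comp_quasiMeasurePreserving hmp.quasiMeasurePreserving

theorem lintegral_fracKernel_far (hα : 0 < α) {r : ℝ} (hr : 0 < r) :
    ∫⁻ h in {h : 𝔼 N | r ≤ ‖h‖}, fracKernel N α h < ⊤ := by
  have hM : 0 < (N : ℝ) + α := by positivity
  have h1 := finite_integral_one_add_norm (E := 𝔼 N) (μ := volume) (r := (N : ℝ) + α)
    (by simpa using hα)
  set c : ℝ := (1 / r + 1) ^ ((N : ℝ) + α) with hc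
  have hS : MeasurableSet {h : 𝔼 N | r ≤ ‖h‖} := measurableSet_le measurable_const measurable_norm
  calc ∫⁻ h in {h : 𝔼 N | r ≤ ‖h‖}, fracKernel N α h
      ≤ ∫⁻ h in {h : 𝔼 N | r ≤ ‖h‖}, ENNReal.ofReal c *
          ENNReal.ofReal ((1 + ‖h‖) ^ (-((N : ℝ) + α))) := by
        refine setLIntegral_mono' hS fun h hh => ?_
        have hh' : r ≤ ‖h‖ := hh
        have hpos : 0 < ‖h‖ := hr.trans_le hh'
        rw [← ENNReal.ofReal_mul (by positivity)]
        refine ENNReal.ofReal_le_ofReal ?_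
        rw [Real.rpow_neg (by positivity), ← div_eq_mul_inv, le_div_iff₀ (by positivity),
          inv_mul_le_iff₀ (by positivity), hc, ← Real.mul_rpow (by positivity) (by positivity)]
        refine Real.rpow_le_rpow (by positivity) ?_ hM.le
        have : 1 ≤ ‖h‖ * (1 / r) := by rw [mul_one_div, le_div_iff₀ hr]; linarith
        linarith
    _ ≤ ∫⁻ h : 𝔼 N, ENNReal.ofReal c * ENNReal.ofReal ((1 + ‖h‖) ^ (-((N : ℝ) + α))) :=
        setLIntegral_le_lintegral _ _
    _ < ⊤ := by
        rw [lintegral_const_mul' _ _ ENNReal.ofReal_ne_top]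
        exact ENNReal.mul_lt_top ENNReal.ofReal_lt_top h1

theorem lintegral_fracKernel_near (hN : 1 ≤ N) {p : ℝ} (hαp : α < p) (r : ℝ) :
    ∫⁻ h in Metric.ball (0 : 𝔼 N) r, fracKernel N α h * ‖h‖ₑ ^ p < ⊤ := by
  have hpos : -1 < p - α - 1 := by linarith
  have : NeZero N := ⟨by omega⟩
  have h1 : IntegrableOn (fun x : 𝔼 N => ‖x‖ ^ (p - N - α)) (Metric.ball 0 r) := by
    -- In polar coordinates the power becomes `(N - 1) + (p - N - α) = p - α - 1 > -1`.
    rw [integrableOn_fun_norm_addHaar volume (f := fun t : ℝ => t ^ (p - N - α))]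
    have h2 : IntegrableOn (fun y : ℝ => y ^ (p - α - 1)) (Set.Ioo 0 r) := by
      rcases le_or_gt r 0 with hr | hr
      · simp [Set.Ioo_eq_empty (not_lt.2 hr)]
      · exact (intervalIntegral.integrableOn_Ioo_rpow_iff hr).2 hpos
    refine h2.congr_fun (fun y hy => ?_) measurableSet_Ioo
    simp only [finrank_euclideanSpace, Fintype.card_fin, smul_eq_mul]
    rw [← Real.rpow_natCast, ← Real.rpow_add hy.1]
    congr 1
    push_cast [hN]
    ring
  have h3 := h1.2
  rw [hasFiniteIntegral_iff_enorm] at h3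
  refine lt_of_le_of_lt (lintegral_mono_ae ?_) h3
  have h0 : ∀ᵐ x : 𝔼 N, x ≠ 0 := by
    simp [ae_iff]
  filter_upwards [ae_restrict_of_ae h0] with h hh
  have hh' : 0 < ‖h‖ := norm_pos_iff.2 hh
  rw [fracKernel, Real.enorm_of_nonneg (by positivity), ← ofReal_norm, ENNReal.ofReal_rpow_of_pos hh',
    ← ENNReal.ofReal_mul (by positivity), ← Real.rpow_neg hh'.le, ← Real.rpow_add hh']
  refine le_of_eq ?_
  congr 2; ring

end Kernel

/-- The integral is split at `‖h‖ = 1`: the factor `‖h‖ ^ p` tames the singularity at the origin,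
and the uniform bound suffices at infinity, where the kernel is integrable. -/
theorem exists_lintegral_fracKernel_mul_le {N : ℕ} {p α : ℝ} (hN : 1 ≤ N) (hα : 0 < α) (hαp : α < p) :
    ∃ C : NNReal, ∀ (M : ℝ≥0∞) (I : 𝔼 N → ℝ≥0∞), (∀ h, I h ≤ ‖h‖ₑ ^ p * M) → (∀ h, I h ≤ M) →
      ∫⁻ h, fracKernel N α h * I h ≤ C * M := by
  have h1 := lintegral_fracKernel_near (N := N) hN hαp 1
  have h2 := lintegral_fracKernel_far (N := N) hα one_pos
  set C₁ := ∫⁻ h in Metric.ball (0 : 𝔼 N) 1, fracKernel N α h * ‖h‖ₑ ^ p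
  set C₂ := ∫⁻ h in {h : 𝔼 N | 1 ≤ ‖h‖}, fracKernel N α h
  refine ⟨(C₁ + C₂).toNNReal, fun M I hI1 hI2 => ?_⟩
  rw [ENNReal.coe_toNNReal (ENNReal.add_lt_top.2 ⟨h1, h2⟩).ne, add_mul]
  have hc : (Metric.ball (0 : 𝔼 N) 1)ᶜ = {h : 𝔼 N | 1 ≤ ‖h‖} := by ext; simp
  rw [← lintegral_add_compl _ (measurableSet_ball (x := (0 : 𝔼 N)) (ε := 1)), hc]
  refine add_le_add ?_ ?_
  · have hm : Measurable fun h : 𝔼 N => fracKernel N α h * ‖h‖ₑ ^ p :=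
      measurable_fracKernel.mul (measurable_enorm.pow_const _)
    rw [← lintegral_mul_const _ hm]
    refine lintegral_mono fun h => ?_
    rw [mul_assoc]
    gcongr
    exact hI1 h
  · rw [← lintegral_mul_const _ measurable_fracKernel]
    refine lintegral_mono fun h => ?_
    gcongr
    exact hI2 h

/-! ### Embedding of `W_0^{1,p}(Ω)` into the fractional Sobolev space. -/

section Seminorm

variable {N : ℕ} {Ω : Set (𝔼 N)} {p α : ℝ} [Fact (1 ≤ ENNReal.ofReal p)]

theorem AEStronglyMeasurable_sub_prod {w : 𝔼 N → ℝ} (hw : AEStronglyMeasurable w) :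
    AEStronglyMeasurable (fun z : 𝔼 N × 𝔼 N => w z.1 - w z.2) (volume.prod volume) :=
  hw.comp_fst.sub hw.comp_snd

theorem sobolevZero_exists_seminorm_le (hN : 1 ≤ N) (hp : 1 < p) (hα : 0 < α) (hαp : α < p)
    (hΩ : MeasurableSet Ω) (hb : Bornology.IsBounded Ω) :
    ∃ C : NNReal, ∀ x ∈ sobolevZero Ω p,
      ∫⁻ z, ‖x.1 z.1 - x.1 z.2‖ₑ ^ p ∂fracMeasure N α ≤ C * ‖x‖ₑ ^ p := by
  have hp0 : 0 < p := by linarith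
  obtain ⟨C, hC⟩ := exists_lintegral_fracKernel_mul_le (N := N) hN hα hαp
  refine ⟨C * (2 ^ p * 2), fun x hx => ?_⟩
  have hm := Lp.aestronglyMeasurable x.1
  rw [lintegral_fracMeasure ((AEStronglyMeasurable_sub_prod hm).enorm.pow_const p)]
  -- This one constant serves both the gradient bound for the increment and the triangle bound `2 ^
  -- p * 2 * ‖x.1‖ ^ p`.
  refine (hC (2 ^ p * 2 * ‖x‖ₑ ^ p) _ (fun h => ?_) (fun h => ?_)).trans (le_of_eq ?_)
  · refine (sobolevZero_lintegral_enorm_sub_le hp hΩ hb hx h).trans ?_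
    gcongr
    have h1 : ‖x.2‖ₑ ^ p ≤ ‖x‖ₑ ^ p := by
      refine ENNReal.rpow_le_rpow ?_ hp0.le
      exact enorm_le_iff_norm_le.2 (norm_snd_le x)
    refine h1.trans (le_mul_of_one_le_left zero_le ?_)
    refine one_le_mul (ENNReal.one_le_rpow one_le_two hp0) one_le_two
  · calc ∫⁻ y, ‖x.1 (y + h) - x.1 y‖ₑ ^ p
        ≤ ∫⁻ y, 2 ^ p * (‖x.1 (y + h)‖ₑ ^ p + ‖x.1 y‖ₑ ^ p) := by
          refine lintegral_mono fun y => ?_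
          have := enorm_add_rpow_le hp0.le (x.1 (y + h)) (-x.1 y)
          rwa [← sub_eq_add_neg, enorm_neg] at this
      _ = 2 ^ p * ((∫⁻ y, ‖x.1 y‖ₑ ^ p) + ∫⁻ y, ‖x.1 y‖ₑ ^ p) := by
          rw [lintegral_const_mul' _ _ (ENNReal.rpow_ne_top_of_nonneg hp0.le (by simp)),
            lintegral_add_right' _ (hm.enorm.pow_const p),
            lintegral_add_right_eq_self (fun y => ‖x.1 y‖ₑ ^ p) h]
      _ = 2 ^ p * 2 * ‖x.1‖ₑ ^ p := by
          rw [lintegral_enorm_rpow_eq_eLpNorm hp0, ← Lp.enorm_def]; ring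
      _ ≤ _ := by
          gcongr
          exact enorm_le_iff_norm_le.2 (norm_fst_le x)
  · push_cast
    rw [ENNReal.coe_rpow_of_nonneg _ hp0.le]
    push_cast
    ring

theorem sobolevZero_memLp_sub (hN : 1 ≤ N) (hp : 1 < p) (hα : 0 < α) (hαp : α < p)
    (hΩ : MeasurableSet Ω) (hb : Bornology.IsBounded Ω) {x : Lp ℝ (ENNReal.ofReal p)
      (volume : Measure (𝔼 N)) × Lp (𝔼 N) (ENNReal.ofReal p) (volume : Measure (𝔼 N))}
    (hx : x ∈ sobolevZero Ω p) :
    MemLp (fun z : 𝔼 N × 𝔼 N => x.1 z.1 - x.1 z.2) (ENNReal.ofReal p) (fracMeasure N α) := by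
  obtain ⟨C, hC⟩ := sobolevZero_exists_seminorm_le hN hp hα hαp hΩ hb
  refine ⟨(AEStronglyMeasurable_sub_prod (Lp.aestronglyMeasurable _)).mono_ac fracMeasure_ac, ?_⟩
  rw [eLpNorm_ofReal_eq_lintegral (by linarith)]
  refine ENNReal.rpow_lt_top_of_nonneg (by positivity) ((hC x hx).trans_lt ?_).ne
  exact ENNReal.mul_lt_top ENNReal.coe_lt_top
    (ENNReal.rpow_lt_top_of_nonneg (by linarith) enorm_ne_top)

theorem exists_differenceLinearMap (hN : 1 ≤ N) (hp : 1 < p) (hα : 0 < α) (hαp : α < p)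
    (hΩ : MeasurableSet Ω) (hb : Bornology.IsBounded Ω) :
    ∃ T : sobolevZero Ω p →ₗ[ℝ] Lp ℝ (ENNReal.ofReal p) (fracMeasure N α), ∀ x,
      T x =ᵐ[fracMeasure N α] fun z => x.1.1 z.1 - x.1.1 z.2 := by
  have hm := fun x : sobolevZero Ω p => sobolevZero_memLp_sub hN hp hα hαp hΩ hb x.2
  have hq1 : Measure.QuasiMeasurePreserving Prod.fst (fracMeasure N α) (volume : Measure (𝔼 N)) :=
    Measure.quasiMeasurePreserving_fst.mono_left fracMeasure_ac
  have hq2 : Measure.QuasiMeasurePreserving Prod.snd (fracMeasure N α) (volume : Measure (𝔼 N)) :=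
    Measure.quasiMeasurePreserving_snd.mono_left fracMeasure_ac
  obtain ⟨D, hD⟩ : ∃ D : sobolevZero Ω p → Lp ℝ (ENNReal.ofReal p) (fracMeasure N α), ∀ x,
      D x =ᵐ[fracMeasure N α] fun z => x.1.1 z.1 - x.1.1 z.2 :=
    ⟨fun x => (hm x).toLp, fun x => (hm x).coeFn_toLp⟩
  have hadd : ∀ x y, D (x + y) = D x + D y := fun x y => by
    refine Lp.ext ?_
    have h := Lp.coeFn_add x.1.1 y.1.1
    filter_upwards [hq1.ae h, hq2.ae h, hD (x + y), hD x, hD y, Lp.coeFn_add (D x) (D y)]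
      with z h1 h2 h3 h4 h5 h6
    rw [h3, h6, Pi.add_apply, h4, h5]
    refine (congrArg₂ (· - ·) h1 h2).trans ?_
    simp only [Pi.add_apply]
    ring
  have hsmul : ∀ (c : ℝ) x, D (c • x) = c • D x := fun c x => by
    refine Lp.ext ?_
    have h := Lp.coeFn_smul c x.1.1
    filter_upwards [hq1.ae h, hq2.ae h, hD (c • x), hD x, Lp.coeFn_smul c (D x)]
      with z h1 h2 h3 h4 h6
    rw [h3, h6, Pi.smul_apply, h4]
    refine (congrArg₂ (· - ·) h1 h2).trans ?_
    simp only [Pi.smul_apply, smul_eq_mul]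
    ring
  exact ⟨⟨⟨D, hadd⟩, hsmul⟩, hD⟩

/-- The map `w ↦ w(x) - w(y)` from `W_0^{1,p}(Ω)` to `L^p(|x - y|^{-N-α} dx dy)`. -/
theorem exists_differenceMap (hN : 1 ≤ N) (hp : 1 < p) (hα : 0 < α) (hαp : α < p)
    (hΩ : MeasurableSet Ω) (hb : Bornology.IsBounded Ω) :
    ∃ T : sobolevZero Ω p →L[ℝ] Lp ℝ (ENNReal.ofReal p) (fracMeasure N α), ∀ x,
      T x =ᵐ[fracMeasure N α] fun z => x.1.1 z.1 - x.1.1 z.2 := by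
  have hp0 : 0 < p := by linarith
  obtain ⟨C, hC⟩ := sobolevZero_exists_seminorm_le hN hp hα hαp hΩ hb
  obtain ⟨T, hT⟩ := exists_differenceLinearMap hN hp hα hαp hΩ hb
  have h1 : ∀ x, ‖T x‖ ≤ (C ^ (1 / p) : NNReal) * ‖x‖ := fun x => by
    have h1 : ‖T x‖ₑ ≤ (C : ℝ≥0∞) ^ (1 / p) * ‖x.1‖ₑ := by
      rw [Lp.enorm_def, eLpNorm_congr_ae (hT x), eLpNorm_ofReal_eq_lintegral hp0]
      refine (ENNReal.rpow_le_rpow (hC x.1 x.2) (by positivity)).trans (le_of_eq ?_)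
      rw [ENNReal.mul_rpow_of_nonneg _ _ (by positivity), ← ENNReal.rpow_mul,
        mul_one_div_cancel hp0.ne', ENNReal.rpow_one]
    rw [enorm_eq_nnnorm, enorm_eq_nnnorm, ← ENNReal.coe_rpow_of_nonneg _ (by positivity),
      ← ENNReal.coe_mul, ENNReal.coe_le_coe] at h1
    exact h1
  exact ⟨T.mkContinuous _ h1, hT⟩

end Seminorm

/-! ### The nonlocal pairing with the boundary datum. -/

section Tail

variable {N : ℕ} {Ω Ω' U : Set (𝔼 N)} {p α : ℝ}

theorem MemTailSpace.aestronglyMeasurable {q : ℝ} {g : 𝔼 N → ℝ} (h : MemTailSpace q α g) :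
    AEStronglyMeasurable g := by
  rw [← Measure.restrict_univ (μ := (volume : Measure (𝔼 N))),
    ← Metric.iUnion_closedBall_nat (0 : 𝔼 N), aestronglyMeasurable_iUnion_iff]
  exact fun n => (h.1 _ (isCompact_closedBall _ _)).1

theorem lintegral_fracMeasure_swap {F : 𝔼 N × 𝔼 N → ℝ≥0∞}
    (hF : AEMeasurable F (volume.prod volume)) :
    ∫⁻ z, F z.swap ∂fracMeasure N α = ∫⁻ z, F z ∂fracMeasure N α := by
  rw [lintegral_fracMeasure' hF, lintegral_fracMeasure' hF.prod_swap, ← lintegral_prod_swap]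
  refine lintegral_congr fun z => ?_
  simp only [Prod.fst_swap, Prod.snd_swap, Prod.swap_swap, fracKernel, norm_sub_rev]

theorem MemLp.integrable_indicator_of_isBounded {F : Type*} [NormedAddCommGroup F] (hp : 1 ≤ p)
    (hΩ : MeasurableSet Ω) (hb : Bornology.IsBounded Ω) {w : 𝔼 N → F}
    (hw : MemLp w (ENNReal.ofReal p) (volume.restrict Ω)) : Integrable (Ω.indicator w) := by
  have hfin : volume Ω < ⊤ := hb.measure_lt_top
  have : IsFiniteMeasure (volume.restrict Ω) := ⟨by simpa using hfin⟩
  rw [integrable_indicator_iff hΩ]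
  exact hw.integrable (by rw [← ENNReal.ofReal_one]; exact ENNReal.ofReal_le_ofReal hp)

theorem IsWeakGradient.integral_indicator (hΩ : MeasurableSet Ω) {u : 𝔼 N → ℝ} {G : 𝔼 N → 𝔼 N}
    (h : IsWeakGradient Ω u G) (ψ : 𝔼 N → ℝ) (hψ : IsTestFunction Ω ψ) :
    ∫ x, Ω.indicator u x • gradient ψ x = - ∫ x, ψ x • Ω.indicator G x :=
  (h.congr_ae (indicator_ae_eq_restrict hΩ).symm
    (indicator_ae_eq_restrict hΩ).symm).integral_eq' hψ

/-- Increments of length below `r` starting in `U` stay in `Ω'`, where `g` has an `L^p` gradient.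
The translation estimate is applied to the extensions of `g` and of its gradient by zero. -/
theorem setLIntegral_near_lt_top (hN : 1 ≤ N) (hp : 1 < p) (hαp : α < p) (hΩ' : IsOpen Ω')
    (hb : Bornology.IsBounded Ω') (hU : IsOpen U) {r : ℝ}
    (hUr : ∀ y ∈ U, ∀ h, ‖h‖ < r → y + h ∈ Ω') {g : 𝔼 N → ℝ} (hg : MemW1p Ω' p g)
    (hgm : AEStronglyMeasurable g) :
    ∫⁻ z in {z : 𝔼 N × 𝔼 N | z.2 ∈ U ∧ ‖z.1 - z.2‖ < r}, ‖g z.1 - g z.2‖ₑ ^ p ∂fracMeasure N α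
      < ⊤ := by
  have hp0 : 0 < p := by linarith
  obtain ⟨hgp, G, hG, hGp⟩ := hg
  set S : Set (𝔼 N × 𝔼 N) := {z | z.2 ∈ U ∧ ‖z.1 - z.2‖ < r} with hS
  have hSm : MeasurableSet S :=
    (measurable_snd hU.measurableSet).inter
      (measurableSet_lt (measurable_fst.sub measurable_snd).norm measurable_const)
  set M := ∫⁻ x, ‖Ω'.indicator G x‖ₑ ^ p with hM
  have hMfin : M < ⊤ := by
    rw [hM, lintegral_enorm_rpow_eq_eLpNorm hp0, eLpNorm_indicator_eq_eLpNorm_restrict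
      hΩ'.measurableSet]
    exact ENNReal.rpow_lt_top_of_nonneg hp0.le hGp.eLpNorm_ne_top
  have hF : AEMeasurable (S.indicator fun z : 𝔼 N × 𝔼 N => ‖g z.1 - g z.2‖ₑ ^ p)
      (volume.prod volume) :=
    ((AEStronglyMeasurable_sub_prod hgm).enorm.pow_const p).indicator hSm
  have hball : MeasurableSet (Metric.ball (0 : 𝔼 N) r) := measurableSet_ball
  rw [← lintegral_indicator hSm, lintegral_fracMeasure hF]
  calc ∫⁻ h, fracKernel N α h * ∫⁻ y, S.indicator (fun z => ‖g z.1 - g z.2‖ₑ ^ p) (y + h, y)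
      ≤ ∫⁻ h, (Metric.ball (0 : 𝔼 N) r).indicator
          (fun h => fracKernel N α h * ‖h‖ₑ ^ p * M) h := by
        refine lintegral_mono fun h => ?_
        by_cases hh : h ∈ Metric.ball (0 : 𝔼 N) r
        · have hhr : ‖h‖ < r := by simpa using hh
          rw [Set.indicator_of_mem hh, mul_assoc]
          gcongr
          have key := lintegral_enorm_sub_rpow_le hp hU
            (MemLp.integrable_indicator_of_isBounded hp.le hΩ'.measurableSet hb hgp)
            (MemLp.integrable_indicator_of_isBounded hp.le hΩ'.measurableSet hb hGp)
            (hG.integral_indicator hΩ'.measurableSet) h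
            (fun y hy t ht => hUr y hy _ (by
              rw [norm_smul, Real.norm_of_nonneg ht.1.le]
              exact (mul_le_of_le_one_left (norm_nonneg _) ht.2).trans_lt hhr))
          refine le_trans (le_of_eq ?_) key
          rw [← lintegral_indicator hU.measurableSet]
          refine lintegral_congr fun y => ?_
          by_cases hy : y ∈ U
          · have h1 : y ∈ Ω' := by simpa using hUr y hy 0 (by simpa using (norm_nonneg h).trans_lt hhr)
            have h2 : y + h ∈ Ω' := hUr y hy h hhr
            have h3 : (y + h, y) ∈ S := ⟨hy, by simpa using hhr⟩
            simp [hy, h1, h2, h3]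
          · have h3 : (y + h, y) ∉ S := fun h => hy h.1
            simp [hy, h3]
        · have : ∀ y, S.indicator (fun z => ‖g z.1 - g z.2‖ₑ ^ p) (y + h, y) = 0 := fun y =>
            Set.indicator_of_notMem (fun hy => hh (by simpa using hy.2)) _
          simp [this]
    _ = (∫⁻ h in Metric.ball (0 : 𝔼 N) r, fracKernel N α h * ‖h‖ₑ ^ p) * M := by
        rw [lintegral_indicator hball, lintegral_mul_const' _ _ hMfin.ne]
    _ < ⊤ := ENNReal.mul_lt_top (lintegral_fracKernel_near hN hαp r) hMfin

theorem exists_fracKernel_le_tail (hα : 0 < α) (hb : Bornology.IsBounded Ω) {r : ℝ} (hr : 0 < r) :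
    ∃ C : NNReal, ∀ x, ∀ y ∈ Ω, r ≤ ‖x - y‖ →
      fracKernel N α (x - y) ≤ C * ENNReal.ofReal ((1 + ‖x‖ ^ ((N : ℝ) + α))⁻¹) := by
  obtain ⟨R, hR0, hR⟩ := hb.subset_ball_lt 0 0
  have hM : 0 < (N : ℝ) + α := by positivity
  set M := (N : ℝ) + α
  -- From `1 ≤ ‖x - y‖ / r` and `‖y‖ < R` follows `‖x‖ ≤ ‖x - y‖ (1 + R / r)`. The two summands
  -- bound `1` and `‖x‖ ^ M`.
  refine ⟨((1 / r) ^ M + (1 + R / r) ^ M).toNNReal, fun x y hy hxy => ?_⟩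
  have hyR : ‖y‖ < R := mem_ball_zero_iff.1 (hR hy)
  have hpos : 0 < ‖x - y‖ := hr.trans_le hxy
  change ENNReal.ofReal ((‖x - y‖ ^ M)⁻¹) ≤ ENNReal.ofReal _ * _
  rw [← ENNReal.ofReal_mul (by positivity)]
  refine ENNReal.ofReal_le_ofReal ?_
  rw [← div_eq_mul_inv, le_div_iff₀ (by positivity), inv_mul_le_iff₀ (by positivity),
    mul_add, ← Real.mul_rpow (by positivity) (by positivity),
    ← Real.mul_rpow (by positivity) (by positivity)]
  have h1 : 1 ≤ ‖x - y‖ * (1 / r) := by rw [mul_one_div, le_div_iff₀ hr]; linarith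
  refine add_le_add (Real.one_le_rpow h1 hM.le) (Real.rpow_le_rpow (norm_nonneg _) ?_ hM.le)
  have h2 := norm_add_le (x - y) y
  rw [sub_add_cancel] at h2
  have h3 : R ≤ ‖x - y‖ * (R / r) := by
    have := mul_le_mul_of_nonneg_left h1 hR0.le
    calc R = R * 1 := (mul_one R).symm
      _ ≤ _ := this
      _ = _ := by ring
  linarith

theorem lintegral_mul_enorm_eq_setLIntegral (hΩ : MeasurableSet Ω) {w : 𝔼 N → ℝ}
    (hw : ∀ᵐ y, y ∉ Ω → w y = 0) (H : 𝔼 N → ℝ≥0∞) :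
    ∫⁻ y, H y * ‖w y‖ₑ = ∫⁻ y in Ω, H y * ‖w y‖ₑ := by
  rw [← lintegral_indicator hΩ]
  refine lintegral_congr_ae ?_
  filter_upwards [hw] with y hy
  by_cases hyΩ : y ∈ Ω
  · simp [hyΩ]
  · simp [hyΩ, hy hyΩ]

theorem lintegral_rpow_sub_one_mul_le_of_ae_eq_zero (hp : 1 < p) (hΩ : MeasurableSet Ω)
    {g w : 𝔼 N → ℝ} (hg : AEStronglyMeasurable g) (hwm : AEStronglyMeasurable w)
    (hw : ∀ᵐ y, y ∉ Ω → w y = 0) :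
    ∫⁻ y, ‖g y‖ₑ ^ (p - 1) * ‖w y‖ₑ ≤
      eLpNorm g (ENNReal.ofReal p) (volume.restrict Ω) ^ (p - 1) *
        eLpNorm w (ENNReal.ofReal p) volume := by
  rw [lintegral_mul_enorm_eq_setLIntegral hΩ hw]
  refine (lintegral_rpow_sub_one_mul_le hp hg.restrict hwm.restrict).trans ?_
  gcongr
  exact Measure.restrict_le_self

theorem MemTailSpace.lintegral_lt_top (hp : 1 < p) {g : 𝔼 N → ℝ}
    (hg : MemTailSpace (p - 1) α g) :
    ∫⁻ x, ‖g x‖ₑ ^ (p - 1) * ENNReal.ofReal ((1 + ‖x‖ ^ ((N : ℝ) + α))⁻¹) < ⊤ := by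
  have h := hg.2.2
  rw [hasFiniteIntegral_iff_enorm] at h
  refine lt_of_le_of_lt (lintegral_mono fun x => le_of_eq ?_) h
  rw [div_eq_mul_inv, enorm_mul, Real.enorm_rpow_of_nonneg (abs_nonneg _) (by linarith),
    Real.enorm_abs, Real.enorm_of_nonneg (r := (1 + ‖x‖ ^ ((N : ℝ) + α))⁻¹) (by positivity)]

/-- The power of `g(x) - g(y)` is split between the points. The part with `g(x)` meets the tail
weight, since `y ∈ Ω` is bounded. The part with `g(y)` is treated by Hölder on `Ω`, with the kernel
integrated over `‖h‖ ≥ r`. -/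
theorem exists_setLIntegral_far_le (hp : 1 < p) (hα : 0 < α) (hΩ : MeasurableSet Ω)
    (hb : Bornology.IsBounded Ω) {g : 𝔼 N → ℝ}
    (hg : MemLp g (ENNReal.ofReal p) (volume.restrict Ω)) (hgt : MemTailSpace (p - 1) α g) {r : ℝ}
    (hr : 0 < r) : ∃ C : NNReal, ∀ w : 𝔼 N → ℝ, AEStronglyMeasurable w →
      (∀ᵐ y, y ∉ Ω → w y = 0) →
      ∫⁻ z in {z : 𝔼 N × 𝔼 N | r ≤ ‖z.1 - z.2‖}, ‖g z.1 - g z.2‖ₑ ^ (p - 1) * ‖w z.2‖ₑ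
        ∂fracMeasure N α ≤ C * eLpNorm w (ENNReal.ofReal p) volume := by
  have hp1 : 0 ≤ p - 1 := by linarith
  have hgm := hgt.aestronglyMeasurable
  obtain ⟨C₀, hC₀⟩ := exists_fracKernel_le_tail (N := N) hα hb hr
  have hT := hgt.lintegral_lt_top hp
  set T := ∫⁻ x, ‖g x‖ₑ ^ (p - 1) * ENNReal.ofReal ((1 + ‖x‖ ^ ((N : ℝ) + α))⁻¹)
  have hK := lintegral_fracKernel_far (N := N) hα hr
  set K := ∫⁻ h in {h : 𝔼 N | r ≤ ‖h‖}, fracKernel N α h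
  set B := eLpNorm (fun _ : 𝔼 N => (1 : ℝ)) (ENNReal.ofReal p) (volume.restrict Ω) ^ (p - 1)
  set D := eLpNorm g (ENNReal.ofReal p) (volume.restrict Ω) ^ (p - 1)
  have hB : B ≠ ⊤ := by
    refine ENNReal.rpow_ne_top_of_nonneg hp1 ?_
    have : IsFiniteMeasure (volume.restrict Ω) := ⟨by simpa using hb.measure_lt_top⟩
    exact (memLp_const (1 : ℝ)).eLpNorm_ne_top
  have hD : D ≠ ⊤ := ENNReal.rpow_ne_top_of_nonneg hp1 hg.eLpNorm_ne_top
  have h2 : (2 : ℝ≥0∞) ^ (p - 1) ≠ ⊤ := ENNReal.rpow_ne_top_of_nonneg hp1 (by simp)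
  refine ⟨(2 ^ (p - 1) * (C₀ * T * B + K * D)).toNNReal, fun w hwm hw => ?_⟩
  rw [ENNReal.coe_toNNReal (by finiteness)]
  set W := eLpNorm w (ENNReal.ofReal p) (volume : Measure (𝔼 N))
  set F : Set (𝔼 N × 𝔼 N) := {z | r ≤ ‖z.1 - z.2‖} with hF
  have hFm : MeasurableSet F :=
    measurableSet_le measurable_const (measurable_fst.sub measurable_snd).norm
  have hm1 : AEMeasurable (fun z : 𝔼 N × 𝔼 N => ‖g z.1‖ₑ ^ (p - 1) * ‖w z.2‖ₑ)
    (volume.prod volume) := (hgm.comp_fst.enorm.pow_const _).mul hwm.comp_snd.enorm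
  have hm2 : AEMeasurable (fun z : 𝔼 N × 𝔼 N => ‖g z.2‖ₑ ^ (p - 1) * ‖w z.2‖ₑ)
    (volume.prod volume) := (hgm.comp_snd.enorm.pow_const _).mul hwm.comp_snd.enorm
  have e1 : ∫⁻ z in F, ‖g z.1‖ₑ ^ (p - 1) * ‖w z.2‖ₑ ∂fracMeasure N α ≤ C₀ * T * (B * W) := by
    rw [← lintegral_indicator hFm, lintegral_fracMeasure' (hm1.indicator hFm)]
    calc ∫⁻ z, fracKernel N α (z.1 - z.2) * F.indicator
          (fun z => ‖g z.1‖ₑ ^ (p - 1) * ‖w z.2‖ₑ) z ∂(volume.prod volume)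
        ≤ ∫⁻ z : 𝔼 N × 𝔼 N, C₀ * ((‖g z.1‖ₑ ^ (p - 1) *
            ENNReal.ofReal ((1 + ‖z.1‖ ^ ((N : ℝ) + α))⁻¹)) * ‖w z.2‖ₑ) ∂(volume.prod volume) := by
          refine lintegral_mono_ae ?_
          filter_upwards [Measure.quasiMeasurePreserving_snd.ae hw] with z hz
          by_cases hzF : z ∈ F
          · rw [Set.indicator_of_mem hzF]
            by_cases hzΩ : z.2 ∈ Ω
            · calc fracKernel N α (z.1 - z.2) * (‖g z.1‖ₑ ^ (p - 1) * ‖w z.2‖ₑ)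
                  ≤ C₀ * ENNReal.ofReal ((1 + ‖z.1‖ ^ ((N : ℝ) + α))⁻¹) *
                    (‖g z.1‖ₑ ^ (p - 1) * ‖w z.2‖ₑ) := by
                    gcongr
                    exact hC₀ _ _ hzΩ hzF
                _ = _ := by ring
            · simp [hz hzΩ]
          · simp [hzF]
      _ = C₀ * (T * ∫⁻ y, ‖w y‖ₑ) := by
          have hT' : AEMeasurable (fun x => ‖g x‖ₑ ^ (p - 1) *
              ENNReal.ofReal ((1 + ‖x‖ ^ ((N : ℝ) + α))⁻¹)) volume :=
            (hgm.enorm.pow_const _).mul (Measurable.aemeasurable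
              (measurable_const.add (measurable_norm.pow_const _)).inv.ennreal_ofReal)
          rw [lintegral_const_mul' _ _ ENNReal.coe_ne_top]
          exact congrArg _ (lintegral_prod_mul hT' hwm.enorm)
      _ ≤ C₀ * (T * (B * W)) := by
          gcongr
          have := lintegral_rpow_sub_one_mul_le_of_ae_eq_zero hp hΩ
            (aestronglyMeasurable_const (b := (1 : ℝ))) hwm hw
          simpa using this
      _ = _ := by ring
  have e2 : ∫⁻ z in F, ‖g z.2‖ₑ ^ (p - 1) * ‖w z.2‖ₑ ∂fracMeasure N α ≤ K * (D * W) := by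
    rw [← lintegral_indicator hFm, lintegral_fracMeasure (hm2.indicator hFm)]
    have hS : MeasurableSet {h : 𝔼 N | r ≤ ‖h‖} := measurableSet_le measurable_const measurable_norm
    calc ∫⁻ h, fracKernel N α h * ∫⁻ y, F.indicator
          (fun z => ‖g z.2‖ₑ ^ (p - 1) * ‖w z.2‖ₑ) (y + h, y)
        ≤ ∫⁻ h, {h : 𝔼 N | r ≤ ‖h‖}.indicator (fun h => fracKernel N α h * (D * W)) h := by
          refine lintegral_mono fun h => ?_
          by_cases hh : r ≤ ‖h‖
          · rw [Set.indicator_of_mem (show h ∈ {h : 𝔼 N | r ≤ ‖h‖} from hh)]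
            gcongr
            refine le_trans (lintegral_mono fun y => ?_)
              (lintegral_rpow_sub_one_mul_le_of_ae_eq_zero hp hΩ hgm hwm hw)
            exact Set.indicator_le_self _ _ _
          · have : ∀ y, F.indicator (fun z => ‖g z.2‖ₑ ^ (p - 1) * ‖w z.2‖ₑ) (y + h, y) = 0 :=
              fun y => Set.indicator_of_notMem (fun hy => hh (by simpa [hF] using hy)) _
            simp [this]
      _ = K * (D * W) := by
          rw [lintegral_indicator hS, lintegral_mul_const _ measurable_fracKernel]
  calc ∫⁻ z in F, ‖g z.1 - g z.2‖ₑ ^ (p - 1) * ‖w z.2‖ₑ ∂fracMeasure N α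
      ≤ ∫⁻ z in F, 2 ^ (p - 1) * (‖g z.1‖ₑ ^ (p - 1) * ‖w z.2‖ₑ +
          ‖g z.2‖ₑ ^ (p - 1) * ‖w z.2‖ₑ) ∂fracMeasure N α := by
        refine lintegral_mono fun z => ?_
        rw [← add_mul, ← mul_assoc]
        gcongr
        have := enorm_add_rpow_le hp1 (g z.1) (-g z.2)
        rwa [← sub_eq_add_neg, enorm_neg] at this
    _ = 2 ^ (p - 1) * ((∫⁻ z in F, ‖g z.1‖ₑ ^ (p - 1) * ‖w z.2‖ₑ ∂fracMeasure N α) +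
          ∫⁻ z in F, ‖g z.2‖ₑ ^ (p - 1) * ‖w z.2‖ₑ ∂fracMeasure N α) := by
        rw [lintegral_const_mul' _ _ h2, lintegral_add_left']
        exact (hm1.mono_ac fracMeasure_ac).restrict
    _ ≤ 2 ^ (p - 1) * (C₀ * T * (B * W) + K * (D * W)) := by gcongr
    _ = _ := by ring

variable [Fact (1 ≤ ENNReal.ofReal p)]

theorem exists_lintegral_sub_rpow_mul_le (hN : 1 ≤ N) (hp : 1 < p) (hα : 0 < α) (hαp : α < p)
    (hΩ : IsOpen Ω) (hΩ' : IsOpen Ω') (hb : Bornology.IsBounded Ω) (hb' : Bornology.IsBounded Ω')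
    (hΩΩ' : closure Ω ⊆ Ω') {g : 𝔼 N → ℝ} (hg : MemW1p Ω' p g)
    (hgt : MemTailSpace (p - 1) α g) :
    ∃ C : NNReal, ∀ x ∈ sobolevZero Ω p,
      ∫⁻ z, ‖g z.1 - g z.2‖ₑ ^ (p - 1) * ‖x.1 z.1 - x.1 z.2‖ₑ ∂fracMeasure N α ≤ C * ‖x‖ₑ := by
  have hp0 : 0 < p := by linarith
  have hp1 : 0 ≤ p - 1 := by linarith
  have hgm := hgt.aestronglyMeasurable
  have hgΩ : MemLp g (ENNReal.ofReal p) (volume.restrict Ω) :=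
    hg.1.mono_measure (Measure.restrict_mono (subset_closure.trans hΩΩ') le_rfl)
  obtain ⟨δ, hδ, hδΩ⟩ := hb.isCompact_closure.exists_thickening_subset_open hΩ' hΩΩ'
  -- Half of `δ` widens `Ω` to `U`; the other half leaves room in `Ω'` for an increment from `U`.
  set r := δ / 2 with hr
  have hr0 : 0 < r := by positivity
  set U := Metric.thickening r Ω
  have hUr : ∀ y ∈ U, ∀ h, ‖h‖ < r → y + h ∈ Ω' := by
    intro y hy h hh
    refine hδΩ ?_
    rw [Metric.thickening_closure]
    obtain ⟨z, hz, hyz⟩ := Metric.mem_thickening_iff.1 hy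
    refine Metric.mem_thickening_iff.2 ⟨z, hz, ?_⟩
    have : dist (y + h) y = ‖h‖ := by simp [dist_eq_norm]
    linarith [dist_triangle (y + h) y z]
  set S : Set (𝔼 N × 𝔼 N) := {z | z.2 ∈ U ∧ ‖z.1 - z.2‖ < r} with hS
  have hSm : MeasurableSet S :=
    (measurable_snd Metric.isOpen_thickening.measurableSet).inter
      (measurableSet_lt (measurable_fst.sub measurable_snd).norm measurable_const)
  set F : Set (𝔼 N × 𝔼 N) := {z | r ≤ ‖z.1 - z.2‖} with hF
  have hFm : MeasurableSet F :=
    measurableSet_le measurable_const (measurable_fst.sub measurable_snd).norm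
  have hnear := setLIntegral_near_lt_top hN hp hαp hΩ' hb' Metric.isOpen_thickening hUr hg hgm
  obtain ⟨C₁, hC₁⟩ := sobolevZero_exists_seminorm_le (α := α) hN hp hα hαp hΩ.measurableSet hb
  obtain ⟨C₂, hC₂⟩ := exists_setLIntegral_far_le hp hα hΩ.measurableSet hb hgΩ hgt hr0
  have hgd : AEStronglyMeasurable (fun z : 𝔼 N × 𝔼 N => g z.1 - g z.2) (fracMeasure N α) :=
    (AEStronglyMeasurable_sub_prod hgm).mono_ac fracMeasure_ac
  set Q := eLpNorm (fun z : 𝔼 N × 𝔼 N => g z.1 - g z.2) (ENNReal.ofReal p)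
    ((fracMeasure N α).restrict S) ^ (p - 1)
  have hQ : Q ≠ ⊤ := by
    refine ENNReal.rpow_ne_top_of_nonneg hp1 ?_
    rw [eLpNorm_ofReal_eq_lintegral hp0]
    exact ENNReal.rpow_ne_top_of_nonneg (by positivity) hnear.ne
  refine ⟨Q.toNNReal * C₁ ^ (1 / p) + (C₂ + C₂), fun x hx => ?_⟩
  have hwm := Lp.aestronglyMeasurable x.1
  have hw := (sobolevZero_ae_eq_zero hp0 hΩ.measurableSet hx).1
  have hw1 : ∀ᵐ z : 𝔼 N × 𝔼 N ∂fracMeasure N α, z.1 ∉ Ω → x.1 z.1 = 0 :=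
    fracMeasure_ac (Measure.quasiMeasurePreserving_fst.ae hw)
  have hw2 : ∀ᵐ z : 𝔼 N × 𝔼 N ∂fracMeasure N α, z.2 ∉ Ω → x.1 z.2 = 0 :=
    fracMeasure_ac (Measure.quasiMeasurePreserving_snd.ae hw)
  have hwd : AEStronglyMeasurable (fun z : 𝔼 N × 𝔼 N => x.1 z.1 - x.1 z.2) (fracMeasure N α) :=
    (AEStronglyMeasurable_sub_prod hwm).mono_ac fracMeasure_ac
  have hx1 : eLpNorm x.1 (ENNReal.ofReal p) volume ≤ ‖x‖ₑ := by
    rw [← Lp.enorm_def]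
    exact enorm_le_iff_norm_le.2 (norm_fst_le x)
  have eN : ∫⁻ z in Fᶜ, ‖g z.1 - g z.2‖ₑ ^ (p - 1) * ‖x.1 z.1 - x.1 z.2‖ₑ ∂fracMeasure N α ≤
      Q * (C₁ ^ (1 / p) * ‖x‖ₑ) := by
    calc _ ≤ ∫⁻ z in S, ‖g z.1 - g z.2‖ₑ ^ (p - 1) * ‖x.1 z.1 - x.1 z.2‖ₑ ∂fracMeasure N α := by
          rw [← lintegral_indicator hFm.compl, ← lintegral_indicator hSm]
          refine lintegral_mono_ae ?_
          filter_upwards [hw1, hw2] with z h1 h2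
          by_cases hzF : z ∈ F
          · simp [hzF]
          · have hzr : ‖z.1 - z.2‖ < r := not_le.1 hzF
            by_cases hzU : z.2 ∈ U
            · have hzS : z ∈ S := ⟨hzU, hzr⟩
              simp [hzF, hzS]
            -- If `z.2` lies outside the `r`-neighbourhood of `Ω` and `z.1` is within `r` of it,
            -- both points are outside `Ω` and the increment of `x.1` vanishes.
            · have h3 : z.2 ∉ Ω := fun h => hzU (Metric.self_subset_thickening hr0 _ h)
              have h4 : z.1 ∉ Ω := fun h => hzU (Metric.mem_thickening_iff.2
                ⟨z.1, h, by rwa [dist_comm, dist_eq_norm]⟩)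
              rw [Set.indicator_of_mem (show z ∈ Fᶜ from hzF), h1 h4, h2 h3]
              simp
      _ ≤ Q * eLpNorm (fun z : 𝔼 N × 𝔼 N => x.1 z.1 - x.1 z.2) (ENNReal.ofReal p)
            ((fracMeasure N α).restrict S) :=
          lintegral_rpow_sub_one_mul_le hp hgd.restrict hwd.restrict
      _ ≤ Q * eLpNorm (fun z : 𝔼 N × 𝔼 N => x.1 z.1 - x.1 z.2) (ENNReal.ofReal p)
            (fracMeasure N α) := by
          gcongr
          exact Measure.restrict_le_self
      _ ≤ _ := by
          gcongr
          rw [eLpNorm_ofReal_eq_lintegral hp0]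
          refine (ENNReal.rpow_le_rpow (hC₁ x hx) (by positivity)).trans (le_of_eq ?_)
          rw [ENNReal.mul_rpow_of_nonneg _ _ (by positivity), ← ENNReal.rpow_mul,
            mul_one_div_cancel hp0.ne', ENNReal.rpow_one]
  have hmz : ∀ f : 𝔼 N × 𝔼 N → 𝔼 N, Measure.QuasiMeasurePreserving f (volume.prod volume)
      (volume : Measure (𝔼 N)) → AEMeasurable (fun z : 𝔼 N × 𝔼 N =>
        ‖g z.1 - g z.2‖ₑ ^ (p - 1) * ‖x.1 (f z)‖ₑ) (volume.prod volume) := fun f hf =>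
    ((AEStronglyMeasurable_sub_prod hgm).enorm.pow_const _).mul
      (hwm.comp_quasiMeasurePreserving hf).enorm
  have hm1 := hmz Prod.fst Measure.quasiMeasurePreserving_fst
  have hm2 := hmz Prod.snd Measure.quasiMeasurePreserving_snd
  -- The measure, `F` and `‖g z.1 - g z.2‖ₑ` are all symmetric, so only the value of `x.1` at the
  -- second point needs an estimate.
  have eS : ∫⁻ z in F, ‖g z.1 - g z.2‖ₑ ^ (p - 1) * ‖x.1 z.1‖ₑ ∂fracMeasure N α =
      ∫⁻ z in F, ‖g z.1 - g z.2‖ₑ ^ (p - 1) * ‖x.1 z.2‖ₑ ∂fracMeasure N α := by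
    rw [← lintegral_indicator hFm, ← lintegral_indicator hFm,
      ← lintegral_fracMeasure_swap (hm2.indicator hFm)]
    refine lintegral_congr fun z => ?_
    have hiff : z.swap ∈ F ↔ z ∈ F := by
      simp only [hF, Set.mem_ofPred_eq, Prod.fst_swap, Prod.snd_swap, norm_sub_rev]
    by_cases hz : z ∈ F
    · rw [Set.indicator_of_mem hz, Set.indicator_of_mem (hiff.2 hz), Prod.fst_swap, Prod.snd_swap,
        ← enorm_neg (g z.1 - g z.2), neg_sub]
    · rw [Set.indicator_of_notMem hz, Set.indicator_of_notMem (fun h => hz (hiff.1 h))]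
  have eF : ∫⁻ z in F, ‖g z.1 - g z.2‖ₑ ^ (p - 1) * ‖x.1 z.1 - x.1 z.2‖ₑ ∂fracMeasure N α ≤
      (C₂ + C₂) * ‖x‖ₑ := by
    calc _ ≤ ∫⁻ z in F, (‖g z.1 - g z.2‖ₑ ^ (p - 1) * ‖x.1 z.1‖ₑ +
            ‖g z.1 - g z.2‖ₑ ^ (p - 1) * ‖x.1 z.2‖ₑ) ∂fracMeasure N α := by
          refine lintegral_mono fun z => ?_
          rw [← mul_add]
          gcongr
          exact enorm_sub_le
      _ = (∫⁻ z in F, ‖g z.1 - g z.2‖ₑ ^ (p - 1) * ‖x.1 z.2‖ₑ ∂fracMeasure N α) +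
            ∫⁻ z in F, ‖g z.1 - g z.2‖ₑ ^ (p - 1) * ‖x.1 z.2‖ₑ ∂fracMeasure N α := by
          rw [lintegral_add_left' (hm1.mono_ac fracMeasure_ac).restrict, eS]
      _ ≤ C₂ * ‖x‖ₑ + C₂ * ‖x‖ₑ := by
          have := (hC₂ x.1 hwm hw).trans (mul_le_mul_right hx1 _)
          exact add_le_add this this
      _ = _ := by ring
  rw [← lintegral_add_compl _ hFm, add_comm]
  refine (add_le_add eN eF).trans (le_of_eq ?_)
  push_cast
  rw [ENNReal.coe_toNNReal hQ, ENNReal.coe_rpow_of_nonneg _ (by positivity)]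
  ring

end Tail

/-! ### Sobolev embeddings and continuity of the load. -/

section Embedding

variable {N : ℕ} {Ω : Set (𝔼 N)} {p : ℝ}

theorem lintegral_comp_add_smul {F : 𝔼 N → ℝ≥0∞} (hF : Measurable F) (x : 𝔼 N) {r : ℝ}
    (hr : 0 < r) :
    ∫⁻ y, F (x + r • y) = ENNReal.ofReal ((r ^ N)⁻¹) * ∫⁻ y, F y := by
  have h1 := Measure.map_addHaar_smul (volume : Measure (𝔼 N)) hr.ne'
  rw [← lintegral_map (f := fun y => F (x + y)) (hF.comp (measurable_const.add measurable_id))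
    (measurable_const_smul r), h1, lintegral_smul_measure, lintegral_add_left_eq_self]
  simp [abs_of_pos hr]

theorem IsTestFunction.enorm_le_lintegral_ray {ψ : 𝔼 N → ℝ} (hψ : IsTestFunction Ω ψ) {x y : 𝔼 N}
    {R : ℝ} (hR : 0 ≤ R) (hx : x + R • y ∉ Ω) :
    ‖ψ x‖ₑ ≤ ∫⁻ r in Set.Ioc 0 R, ‖gradient ψ (x + r • y)‖ₑ * ‖y‖ₑ := by
  have hd : ∀ t ∈ Set.uIcc (0 : ℝ) R, HasDerivAt (fun t : ℝ => ψ (x + t • y))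
      (inner ℝ (gradient ψ (x + t • y)) y) t := by
    intro t _
    have e1 : HasDerivAt (fun t : ℝ => x + t • y) y t := by
      simpa using ((hasDerivAt_id t).smul_const y).const_add x
    have e2 := (hψ.differentiable (x + t • y)).hasFDerivAt.comp_hasDerivAt t e1
    rwa [inner_gradient_left]
  have hcont : Continuous fun t : ℝ => inner ℝ (gradient ψ (x + t • y)) y :=
    (hψ.continuous_gradient.comp (by fun_prop)).inner continuous_const
  have e := intervalIntegral.integral_eq_sub_of_hasDerivAt hd (hcont.intervalIntegrable _ _)
  rw [hψ.eq_zero_of_notMem hx, intervalIntegral.integral_of_le hR] at e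
  have e' : ‖ψ x‖ₑ = ‖∫ t in Set.Ioc 0 R, inner ℝ (gradient ψ (x + t • y)) y‖ₑ := by
    rw [e]; simp
  rw [e']
  exact (enorm_integral_le_lintegral_enorm _).trans
    (lintegral_mono fun t => enorm_inner_le_mul _ _)

/-- The value `ψ x` is recovered by integrating the gradient along rays `x + r • y` until they leave
`Ω`, then averaging over `y` in a ball. Hölder in `y` and the substitution `z = x + r • y` give the
weight `r ^ (-(N / p))`, integrable at zero exactly because `p > N`. -/
theorem exists_enorm_le_eLpNorm_gradient (hN : 1 ≤ N) (hp : 1 < p) (hNp : N < p)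
    (hb : Bornology.IsBounded Ω) :
    ∃ C : NNReal, ∀ ψ : 𝔼 N → ℝ, IsTestFunction Ω ψ →
      ∀ x, ‖ψ x‖ₑ ≤ C * eLpNorm (gradient ψ) (ENNReal.ofReal p) volume := by
  have hp0 : 0 < p := by linarith
  obtain ⟨ρ, hρ, hΩρ⟩ := hb.subset_closedBall_lt 0 0
  -- Directions in `B` have length at least one, so at time `R` every ray from a point of `Ω` has
  -- left the ball of radius `ρ`.
  set R : ℝ := 2 * ρ + 1 with hR
  have hR0 : 0 < R := by positivity
  set y₀ : 𝔼 N := EuclideanSpace.single ⟨0, hN⟩ 2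
  have hy₀ : ‖y₀‖ = 2 := by simp [y₀]
  set B := Metric.ball y₀ 1
  have hB : ∀ y ∈ B, 1 ≤ ‖y‖ ∧ ‖y‖ ≤ 3 := by
    intro y hy
    have hy' : ‖y - y₀‖ < 1 := by simpa [B, dist_eq_norm] using hy
    have h1 := norm_sub_norm_le y y₀
    have h2 := norm_sub_norm_le y₀ y
    rw [norm_sub_rev] at h2
    constructor <;> linarith
  set b := volume B
  have hb0 : b ≠ 0 := (Metric.measure_ball_pos volume y₀ one_pos).ne'
  have hb1 : b ≠ ⊤ := measure_ball_lt_top.ne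
  set J : ℝ≥0∞ := ∫⁻ r in Set.Ioc 0 R, ENNReal.ofReal (r ^ (-(N / p)))
  have hJ : J ≠ ⊤ := by
    have h1 : IntegrableOn (fun r : ℝ => r ^ (-(N / p))) (Set.Ioc 0 R) := by
      rw [integrableOn_Ioc_iff_integrableOn_Ioo,
        intervalIntegral.integrableOn_Ioo_rpow_iff hR0, neg_lt_neg_iff, div_lt_one hp0]
      exact hNp
    have h2 := h1.2
    rw [hasFiniteIntegral_iff_ofReal] at h2
    · exact h2.ne
    · filter_upwards [ae_restrict_mem measurableSet_Ioc] with r hr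
      exact Real.rpow_nonneg hr.1.le _
  set C : ℝ≥0∞ := b⁻¹ * (3 * (J * (b ^ (p - 1)) ^ (1 / p))) with hC
  have hCt : C ≠ ⊤ := by
    have : b ^ (p - 1) ≠ ⊤ := ENNReal.rpow_ne_top_of_nonneg (by linarith) hb1
    have : (b ^ (p - 1)) ^ (1 / p) ≠ ⊤ := ENNReal.rpow_ne_top_of_nonneg (by positivity) this
    have : b⁻¹ ≠ ⊤ := ENNReal.inv_ne_top.2 hb0
    finiteness
  refine ⟨C.toNNReal, fun ψ hψ x => ?_⟩
  rw [ENNReal.coe_toNNReal hCt]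
  by_cases hx : x ∈ Ω
  swap
  · simp [hψ.eq_zero_of_notMem hx]
  set E := eLpNorm (gradient ψ) (ENNReal.ofReal p) volume with hE
  have hgm : Continuous fun z : 𝔼 N => ‖gradient ψ z‖ₑ := hψ.continuous_gradient.enorm
  have key : b * ‖ψ x‖ₑ ≤ 3 * (J * (b ^ (p - 1)) ^ (1 / p)) * E := by
    calc b * ‖ψ x‖ₑ = ∫⁻ _ in B, ‖ψ x‖ₑ := by rw [setLIntegral_const, mul_comm]
      _ ≤ ∫⁻ y in B, 3 * ∫⁻ r in Set.Ioc 0 R, ‖gradient ψ (x + r • y)‖ₑ := by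
        refine setLIntegral_mono' measurableSet_ball fun y hy => ?_
        have hout : x + R • y ∉ Ω := by
          intro h
          have h1 : ‖x + R • y‖ ≤ ρ := by simpa using hΩρ h
          have h2 : ‖x‖ ≤ ρ := by simpa using hΩρ hx
          have h3 : ‖R • y‖ ≤ ‖x + R • y‖ + ‖x‖ := by
            simpa using norm_sub_le (x + R • y) x
          rw [norm_smul, Real.norm_of_nonneg hR0.le] at h3
          nlinarith [(hB y hy).1]
        refine (hψ.enorm_le_lintegral_ray hR0.le hout).trans ?_
        rw [lintegral_mul_const' _ _ enorm_ne_top, mul_comm]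
        gcongr
        rw [← ofReal_norm]
        exact (ENNReal.ofReal_le_ofReal (hB y hy).2).trans (by simp)
      _ = 3 * ∫⁻ r in Set.Ioc 0 R, ∫⁻ y in B, ‖gradient ψ (x + r • y)‖ₑ := by
        rw [lintegral_const_mul' _ _ (by simp), lintegral_lintegral_swap]
        exact (hgm.comp (by fun_prop)).measurable.aemeasurable
      _ ≤ 3 * ∫⁻ r in Set.Ioc 0 R, ENNReal.ofReal (r ^ (-(N / p))) *
            ((b ^ (p - 1)) ^ (1 / p) * E) := by
        gcongr 3 * ?_
        refine setLIntegral_mono' measurableSet_Ioc fun r hr => ?_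
        have h1 := lintegral_rpow_le_measure_mul (volume.restrict B) hp
          (f := fun y => ‖gradient ψ (x + r • y)‖ₑ)
          (hgm.comp (by fun_prop)).measurable.aemeasurable
        rw [Measure.restrict_apply_univ] at h1
        have h2 : ∫⁻ y in B, ‖gradient ψ (x + r • y)‖ₑ ^ p ≤
            ENNReal.ofReal ((r ^ N)⁻¹) * ∫⁻ y, ‖gradient ψ y‖ₑ ^ p :=
          (setLIntegral_le_lintegral _ _).trans
            (lintegral_comp_add_smul (hgm.measurable.pow_const p) x hr.1).le
        have h3 := ENNReal.rpow_le_rpow (h1.trans (mul_le_mul_right h2 _))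
          (show 0 ≤ 1 / p by positivity)
        rw [← ENNReal.rpow_mul, mul_one_div_cancel hp0.ne', ENNReal.rpow_one,
          ENNReal.mul_rpow_of_nonneg _ _ (by positivity),
          ENNReal.mul_rpow_of_nonneg _ _ (by positivity),
          ← eLpNorm_ofReal_eq_lintegral hp0, ENNReal.ofReal_rpow_of_nonneg
          (by have := hr.1; positivity) (by positivity)] at h3
        refine h3.trans (le_of_eq ?_)
        have e : ((r ^ N)⁻¹) ^ (1 / p) = r ^ (-(N / p)) := by
          rw [← Real.rpow_natCast, ← Real.rpow_neg hr.1.le, ← Real.rpow_mul hr.1.le]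
          congr 1; ring
        rw [e]
        ring
      _ = _ := by
        have hE' : E ≠ ⊤ := (hψ.memLp_gradient _ _).2.ne
        have : b ^ (p - 1) ≠ ⊤ := ENNReal.rpow_ne_top_of_nonneg (by linarith) hb1
        have : (b ^ (p - 1)) ^ (1 / p) ≠ ⊤ := ENNReal.rpow_ne_top_of_nonneg (by positivity) this
        rw [lintegral_mul_const' _ _ (by finiteness)]
        ring
  calc ‖ψ x‖ₑ = b⁻¹ * (b * ‖ψ x‖ₑ) := by
        rw [← mul_assoc, ENNReal.inv_mul_cancel hb0 hb1, one_mul]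
    _ ≤ b⁻¹ * (3 * (J * (b ^ (p - 1)) ^ (1 / p)) * E) := by gcongr
    _ = C * E := by rw [hC]; ring

/-- Gagliardo–Nirenberg–Sobolev at an exponent `t < N`, then Hölder on the bounded set `Ω` to pass
from `t` to `p`. -/
theorem exists_eLpNorm_le_eLpNorm_gradient (hp : 1 < p) (hpN : p ≤ N)
    (hb : Bornology.IsBounded Ω) {r : NNReal} (hr : 0 < r) (hpr : p⁻¹ - (N : ℝ)⁻¹ ≤ (r : ℝ)⁻¹) :
    ∃ C : NNReal, ∀ ψ : 𝔼 N → ℝ, IsTestFunction Ω ψ →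
      eLpNorm ψ r volume ≤ C * eLpNorm (gradient ψ) (ENNReal.ofReal p) volume := by
  have hN : (1 : ℝ) < N := hp.trans_le hpN
  obtain ⟨t, ht1, htp, htN, htr⟩ : ∃ t : ℝ, 1 ≤ t ∧ t ≤ p ∧ t < N ∧
      t⁻¹ - (N : ℝ)⁻¹ ≤ (r : ℝ)⁻¹ := by
    rcases hpN.lt_or_eq with h | h
    · exact ⟨p, hp.le, le_rfl, h, hpr⟩
    · have hr' : (0 : ℝ) < (r : ℝ)⁻¹ := by positivity
      -- For `p = N` the exponent `t = m⁻¹` is strictly below `N`, at least `1` by the minimum, and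
      -- large enough for its Sobolev exponent to reach `r`.
      set m : ℝ := min 1 ((N : ℝ)⁻¹ + (r : ℝ)⁻¹) with hm
      have hNi : (N : ℝ)⁻¹ < m := lt_min (inv_lt_one_of_one_lt₀ hN) (by linarith)
      have hm0 : 0 < m := lt_trans (by positivity) hNi
      have hmN : m⁻¹ < N := inv_lt_of_inv_lt₀ (by linarith) hNi
      refine ⟨m⁻¹, (one_le_inv₀ hm0).2 (min_le_left _ _), h ▸ hmN.le, hmN, ?_⟩
      rw [inv_inv]
      linarith [min_le_right 1 ((N : ℝ)⁻¹ + (r : ℝ)⁻¹)]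
  have ht0 : 0 ≤ t := by linarith
  lift t to NNReal using ht0
  set c : ℝ≥0∞ := volume Ω ^ (1 / (t : ℝ) - 1 / p) with hc
  have hct : c ≠ ⊤ := by
    refine ENNReal.rpow_ne_top_of_nonneg ?_ hb.measure_lt_top.ne
    rw [sub_nonneg]
    exact one_div_le_one_div_of_le (by linarith) htp
  refine ⟨eLpNormLESNormFDerivOfLeConst ℝ (volume : Measure (𝔼 N)) Ω t r * c.toNNReal,
    fun ψ hψ => ?_⟩
  have h1 := eLpNorm_le_eLpNorm_fderiv_of_le (volume : Measure (𝔼 N)) (s := Ω)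
    (hψ.smooth.of_le (by simp)) ((subset_tsupport ψ).trans hψ.support_subset)
    (p := t) (q := r) (by exact_mod_cast ht1) (by rw [finrank_euclideanSpace_fin]; exact_mod_cast htN) (by simpa using htr) hb
  refine h1.trans ?_
  rw [ENNReal.coe_mul, mul_assoc, ENNReal.coe_toNNReal hct]
  gcongr
  have e1 : eLpNorm (fderiv ℝ ψ) t volume = eLpNorm (gradient ψ) t volume :=
    eLpNorm_congr_norm_ae (Eventually.of_forall fun x => (IsTestFunction.norm_gradient x).symm)
  have hsub : Function.support (gradient ψ) ⊆ Ω := fun x hx => by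
    by_contra h
    exact hx (hψ.gradient_eq_zero_of_notMem h)
  rw [e1, ← eLpNorm_restrict_eq_of_support_subset hsub,
    ← eLpNorm_restrict_eq_of_support_subset hsub (p := ENNReal.ofReal p)]
  have h2 := eLpNorm_le_eLpNorm_mul_rpow_measure_univ (μ := volume.restrict Ω)
    (f := gradient ψ) (p := t) (q := ENNReal.ofReal p)
    (by rw [← ENNReal.ofReal_coe_nnreal]; exact ENNReal.ofReal_le_ofReal htp)
    hψ.continuous_gradient.aestronglyMeasurable
  rw [Measure.restrict_apply_univ, ENNReal.toReal_ofReal (by linarith), mul_comm] at h2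
  simpa [hc, ← one_div] using h2

/-- Fatou along an almost everywhere convergent subsequence of the approximating test functions. -/
theorem sobolevZero_eLpNorm_le [Fact (1 ≤ ENNReal.ofReal p)] {r : ℝ≥0∞} {C : NNReal}
    (h : ∀ ψ : 𝔼 N → ℝ, IsTestFunction Ω ψ →
      eLpNorm ψ r volume ≤ C * eLpNorm (gradient ψ) (ENNReal.ofReal p) volume)
    {x : Lp ℝ (ENNReal.ofReal p) (volume : Measure (𝔼 N)) ×
      Lp (𝔼 N) (ENNReal.ofReal p) (volume : Measure (𝔼 N))} (hx : x ∈ sobolevZero Ω p) :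
    eLpNorm x.1 r volume ≤ C * eLpNorm x.2 (ENNReal.ofReal p) volume := by
  obtain ⟨ψ, hψ, h1, h2⟩ := mem_sobolevZero_iff.1 hx
  have hp1 : 1 ≤ ENNReal.ofReal p := Fact.out
  have hm : ∀ n, AEStronglyMeasurable (ψ n) volume := fun n =>
    (hψ n).smooth.continuous.aestronglyMeasurable
  obtain ⟨ns, hns, hlim⟩ := (tendstoInMeasure_of_tendsto_eLpNorm (zero_lt_one.trans_le hp1).ne' hm
    (Lp.aestronglyMeasurable x.1) h1).exists_seq_tendsto_ae
  refine (Lp.eLpNorm_lim_le_liminf_eLpNorm (fun n => hm (ns n)) _ hlim).trans ?_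
  have hbd : ∀ n, eLpNorm (ψ (ns n)) r volume ≤
      C * (eLpNorm (fun y => gradient (ψ (ns n)) y - x.2 y) (ENNReal.ofReal p) volume +
        eLpNorm x.2 (ENNReal.ofReal p) volume) := fun n => by
    refine (h _ (hψ _)).trans ?_
    gcongr
    have e : (fun y => gradient (ψ (ns n)) y - x.2 y) + x.2 = gradient (ψ (ns n)) :=
      sub_add_cancel _ _
    have := eLpNorm_add_le (μ := volume)
      (f := fun y => gradient (ψ (ns n)) y - x.2 y) (g := x.2)
      ((hψ _).continuous_gradient.aestronglyMeasurable.sub (Lp.aestronglyMeasurable x.2))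
      (Lp.aestronglyMeasurable x.2) hp1
    rwa [e] at this
  have ht : Tendsto (fun n => C * (eLpNorm (fun y => gradient (ψ (ns n)) y - x.2 y)
      (ENNReal.ofReal p) volume + eLpNorm x.2 (ENNReal.ofReal p) volume)) atTop
      (𝓝 (C * (0 + eLpNorm x.2 (ENNReal.ofReal p) volume))) :=
    ENNReal.Tendsto.const_mul ((h2.comp hns.tendsto_atTop).add tendsto_const_nhds)
      (Or.inr ENNReal.coe_ne_top)
  rw [zero_add] at ht
  rw [← ht.liminf_eq]
  exact liminf_le_liminf (Eventually.of_forall hbd)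

/-- For `p < N` the witness is `(p^*)'`, with equality in the last condition. For `p = N` any finite
`t` with `1 < t < q` works, the left side being zero. -/
theorem exists_conj_sobolev_exponent (hp : 1 < p) {q : ℝ≥0∞}
    (hq : p ≠ N → sobolevDualExponent N p ≤ q) (hqN : p = N → 1 < q) (hpN : p ≤ N) :
    ∃ t : ℝ, 1 < t ∧ ENNReal.ofReal t ≤ q ∧ p⁻¹ - (N : ℝ)⁻¹ ≤ 1 - t⁻¹ := by
  rcases hpN.lt_or_eq with h | h
  · have hN : (1 : ℝ) < N := hp.trans h
    have hd : 0 < N * p - N + p := by nlinarith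
    refine ⟨N * p / (N * p - N + p), (one_lt_div hd).2 (by linarith), ?_, ?_⟩
    · simpa [sobolevDualExponent, h] using hq h.ne
    · refine le_of_eq ?_
      have : (N : ℝ) ≠ 0 := by positivity
      have : p ≠ 0 := by positivity
      field_simp
      ring
  · obtain ⟨t, ht1, htq⟩ := ENNReal.lt_iff_exists_nnreal_btwn.1 (hqN h)
    have ht : (1 : ℝ) < t := by exact_mod_cast ht1
    refine ⟨t, ht, by simpa using htq.le, ?_⟩
    rw [h, sub_self, sub_nonneg]
    exact inv_le_one_of_one_le₀ ht.le

theorem exists_setLIntegral_mul_le [Fact (1 ≤ ENNReal.ofReal p)] (hN : 1 ≤ N) (hp : 1 < p)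
    (hb : Bornology.IsBounded Ω) {q : ℝ≥0∞}
    (hq : p ≠ N → sobolevDualExponent N p ≤ q) (hqN : p = N → 1 < q) {f : 𝔼 N → ℝ}
    (hf : MemLp f q (volume.restrict Ω)) :
    ∃ C : NNReal, ∀ x ∈ sobolevZero Ω p, ∫⁻ y in Ω, ‖f y‖ₑ * ‖x.1 y‖ₑ ≤ C * ‖x.2‖ₑ := by
  have : IsFiniteMeasure (volume.restrict Ω) := ⟨by simpa using hb.measure_lt_top⟩
  obtain ⟨t, r, C, htq, htr, hC⟩ : ∃ (t r : ℝ≥0∞) (C : NNReal), t ≤ q ∧ ENNReal.HolderConjugate t r ∧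
      ∀ ψ : 𝔼 N → ℝ, IsTestFunction Ω ψ →
        eLpNorm ψ r volume ≤ C * eLpNorm (gradient ψ) (ENNReal.ofReal p) volume := by
    rcases le_or_gt p N with hpN | hpN
    · obtain ⟨t, ht1, htq, ht⟩ := exists_conj_sobolev_exponent hp hq hqN hpN
      have hc := Real.HolderConjugate.conjExponent ht1
      obtain ⟨C, hC⟩ := exists_eLpNorm_le_eLpNorm_gradient hp hpN hb
        (r := t.conjExponent.toNNReal) (by simpa using hc.symm.pos)
        (by rwa [Real.coe_toNNReal _ hc.symm.nonneg, ← hc.one_sub_inv])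
      exact ⟨_, _, C, htq, hc.ennrealOfReal, hC⟩
    · obtain ⟨C, hC⟩ := exists_enorm_le_eLpNorm_gradient hN hp hpN hb
      refine ⟨1, ⊤, C, ?_, inferInstance, fun ψ hψ => ?_⟩
      · simpa [sobolevDualExponent, hpN.not_gt] using hq hpN.ne'
      · exact eLpNorm_exponent_top (μ := volume) (f := ψ) ▸
          eLpNormEssSup_le_of_ae_enorm_bound (Eventually.of_forall (hC ψ hψ))
  have hft : MemLp f t (volume.restrict Ω) := hf.mono_exponent htq
  refine ⟨(eLpNorm f t (volume.restrict Ω)).toNNReal * C, fun x hx => ?_⟩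
  have h1 := eLpNorm_smul_le_mul_eLpNorm (μ := volume.restrict Ω) (p := t) (q := r) (r := 1)
    (Lp.aestronglyMeasurable x.1).restrict hft.1
  rw [ENNReal.coe_mul, ENNReal.coe_toNNReal hft.2.ne, mul_assoc, Lp.enorm_def]
  calc ∫⁻ y in Ω, ‖f y‖ₑ * ‖x.1 y‖ₑ = eLpNorm (f • ⇑x.1) 1 (volume.restrict Ω) := by
        rw [eLpNorm_one_eq_lintegral_enorm]
        simp [enorm_mul]
    _ ≤ _ := h1
    _ ≤ _ := by
        gcongr
        exact (eLpNorm_mono_measure _ Measure.restrict_le_self).trans (sobolevZero_eLpNorm_le hC hx)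

end Embedding

/-! ### Existence and uniqueness for the Dirichlet problem. -/

section Boundary

variable {N : ℕ} {Ω Ω' : Set (𝔼 N)} {p α : ℝ}

theorem nonlocalIntegrand_eq (p s : ℝ) (u φ : 𝔼 N → ℝ) (z : 𝔼 N × 𝔼 N) :
    nonlocalIntegrand p s u φ z = (fracKernel N (s * p) (z.1 - z.2)).toReal •
      inner ℝ (pMap p (u z.1 - u z.2)) (φ z.1 - φ z.2) := by
  rw [nonlocalIntegrand, fracKernel, ENNReal.toReal_ofReal (by positivity), pPower_eq_pMap,
    smul_eq_mul, div_eq_inv_mul]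
  simp [mul_comm]

theorem integrable_nonlocalIntegrand_iff (p s : ℝ) (u φ : 𝔼 N → ℝ) :
    Integrable (nonlocalIntegrand p s u φ) ↔
      Integrable (fun z => inner ℝ (pMap p (u z.1 - u z.2)) (φ z.1 - φ z.2))
        (fracMeasure N (s * p)) := by
  rw [fracMeasure, integrable_withDensity_iff_integrable_smul' measurable_fracKernel_sub
    (Eventually.of_forall fun _ => ENNReal.ofReal_lt_top)]
  exact iff_of_eq (congrArg (Integrable · _) (funext (nonlocalIntegrand_eq p s u φ)))

theorem integral_nonlocalIntegrand (p s : ℝ) (u φ : 𝔼 N → ℝ) :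
    ∫ z, nonlocalIntegrand p s u φ z =
      ∫ z, inner ℝ (pMap p (u z.1 - u z.2)) (φ z.1 - φ z.2) ∂fracMeasure N (s * p) := by
  rw [fracMeasure, integral_withDensity_eq_integral_toReal_smul measurable_fracKernel_sub
    (Eventually.of_forall fun _ => ENNReal.ofReal_lt_top)]
  exact integral_congr_ae (Eventually.of_forall (nonlocalIntegrand_eq p s u φ))

theorem ae_fracMeasure_sub_eq {v w : 𝔼 N → ℝ} (h : v =ᵐ[volume] w) :
    ∀ᵐ z ∂fracMeasure N α, v z.1 - v z.2 = w z.1 - w z.2 := by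
  filter_upwards [fracMeasure_ac (Measure.quasiMeasurePreserving_fst.ae h),
    fracMeasure_ac (Measure.quasiMeasurePreserving_snd.ae h)] with z h1 h2
  rw [h1, h2]

theorem MemTailSpace.add_of_memLp (hp : 1 < p) (hα : 0 < α)
    (hb : Bornology.IsBounded Ω) {g w : 𝔼 N → ℝ} (hg : MemTailSpace (p - 1) α g)
    (hw : MemLp w (ENNReal.ofReal p) volume) (hw0 : ∀ᵐ y, y ∉ Ω → w y = 0) :
    MemTailSpace (p - 1) α (fun x => g x + w x) := by
  have hp1 : 0 < p - 1 := by linarith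
  have hM : 0 < (N : ℝ) + α := by positivity
  have hle : ENNReal.ofReal (p - 1) ≤ ENNReal.ofReal p := ENNReal.ofReal_le_ofReal (by linarith)
  refine ⟨fun K hK => ?_, ?_⟩
  · have : IsFiniteMeasure (volume.restrict K) := ⟨by simpa using hK.measure_lt_top⟩
    exact (hg.1 K hK).add ((hw.restrict K).mono_exponent hle)
  · have : IsFiniteMeasure (volume.restrict Ω) := ⟨by simpa using hb.measure_lt_top⟩
    have h1 : IntegrableOn (fun x => |w x| ^ (p - 1)) Ω := by
      have := ((hw.restrict Ω).mono_exponent hle).integrable_norm_rpow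
        (by simpa using hp1) ENNReal.ofReal_ne_top
      simpa [IntegrableOn, ENNReal.toReal_ofReal hp1.le] using this
    have h2 : Integrable (fun x => |w x| ^ (p - 1)) :=
      h1.integrable_of_ae_notMem_eq_zero (by
        filter_upwards [hw0] with y hy hyΩ
        rw [hy hyΩ, abs_zero, Real.zero_rpow hp1.ne'])
    refine ((hg.2.add h2).const_mul (2 ^ (p - 1))).mono' ?_ (Eventually.of_forall fun x => ?_)
    · have hm := (hg.aestronglyMeasurable.add hw.1).norm.aemeasurable.pow_const (p - 1)
      exact (hm.div (measurable_const.add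
        (measurable_norm.pow_const ((N : ℝ) + α))).aemeasurable).aestronglyMeasurable
    · rw [Real.norm_of_nonneg (by positivity)]
      have h3 := norm_add_rpow_le hp1.le (g x) (w x)
      simp only [Real.norm_eq_abs, Pi.add_apply] at h3 ⊢
      have hx : 1 ≤ 1 + ‖x‖ ^ ((N : ℝ) + α) := by
        have : 0 ≤ ‖x‖ ^ ((N : ℝ) + α) := by positivity
        linarith
      have h4 : |w x| ^ (p - 1) / (1 + ‖x‖ ^ ((N : ℝ) + α)) ≤ |w x| ^ (p - 1) :=
        div_le_self (by positivity) hx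
      calc |g x + w x| ^ (p - 1) / (1 + ‖x‖ ^ ((N : ℝ) + α))
          ≤ 2 ^ (p - 1) * (|g x| ^ (p - 1) + |w x| ^ (p - 1)) / (1 + ‖x‖ ^ ((N : ℝ) + α)) := by
            gcongr
        _ = 2 ^ (p - 1) * (|g x| ^ (p - 1) / (1 + ‖x‖ ^ ((N : ℝ) + α)) +
              |w x| ^ (p - 1) / (1 + ‖x‖ ^ ((N : ℝ) + α))) := by ring
        _ ≤ _ := by gcongr

variable [Fact (1 ≤ ENNReal.ofReal p)]

theorem memW1pBdry_add {s : ℝ} (hp : 1 < p) (hs : 0 < s) (hΩ : IsOpen Ω)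
    (hb : Bornology.IsBounded Ω) {g : 𝔼 N → ℝ} (hg : MemW1p Ω p g)
    (hgt : MemTailSpace (p - 1) (s * p) g)
    {x : Lp ℝ (ENNReal.ofReal p) (volume : Measure (𝔼 N)) ×
      Lp (𝔼 N) (ENNReal.ofReal p) (volume : Measure (𝔼 N))} (hx : x ∈ sobolevZero Ω p) :
    MemW1pBdry Ω p s g (fun y => g y + x.1 y) := by
  have hz := (sobolevZero_ae_eq_zero (by linarith) hΩ.measurableSet hx).1
  have hx0 := sobolevZero_memW1pZero hp hx
  refine ⟨⟨hg.1.add hx0.1, ?_⟩, hgt.add_of_memLp hp (mul_pos hs (by linarith)) hb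
    (Lp.memLp x.1) hz, ?_, ?_⟩
  · obtain ⟨Dg, hDg, hDgp⟩ := hg.2
    obtain ⟨Dx, hDx, hDxp, -⟩ := hx0.2
    exact ⟨_, hDg.add hDx, hDgp.add hDxp⟩
  · simpa only [add_sub_cancel_left] using hx0
  · rw [EventuallyEq, ae_restrict_iff' hΩ.measurableSet.compl]
    filter_upwards [hz] with y hy hyΩ
    rw [hy hyΩ, add_zero]

/-- All the integrals depend only on almost everywhere classes, `fracMeasure` being absolutely
continuous, so each test pair can be replaced by its zero extension in `sobolevZero`. -/
theorem isWeakSolution_of_sobolevZero {s A : ℝ} (hΩ : IsOpen Ω) {f g u : 𝔼 N → ℝ}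
    {Du : 𝔼 N → 𝔼 N} (hu : MemW1pBdry Ω p s g u) (hDu : IsWeakGradient Ω u Du)
    (h : ∀ ξ ∈ sobolevZero Ω p,
      IntegrableOn (fun y => inner ℝ (pMap p (Du y)) (ξ.2 y)) Ω ∧
      Integrable (fun z => inner ℝ (pMap p (u z.1 - u z.2)) (ξ.1 z.1 - ξ.1 z.2))
        (fracMeasure N (s * p)) ∧
      IntegrableOn (fun y => f y * ξ.1 y) Ω ∧
      (∫ y in Ω, inner ℝ (pMap p (Du y)) (ξ.2 y)) +
        A * (∫ z, inner ℝ (pMap p (u z.1 - u z.2)) (ξ.1 z.1 - ξ.1 z.2) ∂fracMeasure N (s * p)) =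
        ∫ y in Ω, f y * ξ.1 y) :
    IsWeakSolution Ω p s A f g u := by
  refine ⟨hu, Du, hDu, fun φ Dφ hφ hDφ => ?_⟩
  obtain ⟨ξ, hξ, h1, h2⟩ := hφ.exists_mem_sobolevZero hΩ hDφ
  obtain ⟨i1, i2, i3, heq⟩ := h ξ hξ
  have h1' : ξ.1 =ᵐ[volume.restrict Ω] φ :=
    EventuallyEq.trans (ae_restrict_of_ae h1) (indicator_ae_eq_restrict hΩ.measurableSet)
  have h2' : ξ.2 =ᵐ[volume.restrict Ω] Dφ :=
    EventuallyEq.trans (ae_restrict_of_ae h2) (indicator_ae_eq_restrict hΩ.measurableSet)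
  have e1 : (fun y => inner ℝ (pMap p (Du y)) (ξ.2 y)) =ᵐ[volume.restrict Ω]
      localIntegrand p Du Dφ := by
    filter_upwards [h2'] with y hy
    rw [hy, inner_pMap_left, localIntegrand]
  have e2 : (fun z : 𝔼 N × 𝔼 N => inner ℝ (pMap p (u z.1 - u z.2)) (ξ.1 z.1 - ξ.1 z.2))
      =ᵐ[fracMeasure N (s * p)] fun z =>
        inner ℝ (pMap p (u z.1 - u z.2)) (Ω.indicator φ z.1 - Ω.indicator φ z.2) := by
    filter_upwards [ae_fracMeasure_sub_eq h1] with z hz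
    rw [hz]
  have e3 : (fun y => f y * ξ.1 y) =ᵐ[volume.restrict Ω] fun y => f y * φ y := by
    filter_upwards [h1'] with y hy
    rw [hy]
  rw [integrable_nonlocalIntegrand_iff, integral_nonlocalIntegrand, ← integral_congr_ae e1,
    ← integral_congr_ae e2, ← integral_congr_ae e3]
  exact ⟨i1.congr e1, i2.congr e2, i3.congr e3, heq⟩

theorem exists_linearMap_integral_mul {f : 𝔼 N → ℝ}
    (hi : ∀ ξ ∈ sobolevZero Ω p, IntegrableOn (fun y => f y * ξ.1 y) Ω) :
    ∃ L : sobolevZero Ω p →ₗ[ℝ] ℝ, ∀ ξ, L ξ = ∫ y in Ω, f y * ξ.1.1 y := by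
  obtain ⟨D, hD⟩ : ∃ D : sobolevZero Ω p → ℝ, ∀ ξ, D ξ = ∫ y in Ω, f y * ξ.1.1 y :=
    ⟨_, fun _ => rfl⟩
  have hadd : ∀ ξ η, D (ξ + η) = D ξ + D η := fun ξ η => by
    rw [hD, hD, hD, ← integral_add (hi _ ξ.2) (hi _ η.2)]
    refine integral_congr_ae ?_
    filter_upwards [ae_restrict_of_ae (Lp.coeFn_add ξ.1.1 η.1.1)] with y hy
    rw [← mul_add]
    exact congrArg _ hy
  have hsmul : ∀ (c : ℝ) ξ, D (c • ξ) = c • D ξ := fun c ξ => by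
    rw [hD, hD, smul_eq_mul, ← integral_const_mul]
    refine integral_congr_ae ?_
    filter_upwards [ae_restrict_of_ae (Lp.coeFn_smul c ξ.1.1)] with y hy
    rw [mul_left_comm]
    exact congrArg _ hy
  exact ⟨⟨⟨D, hadd⟩, hsmul⟩, hD⟩

theorem exists_loadFunctional (hN : 1 ≤ N) (hp : 1 < p) (hb : Bornology.IsBounded Ω) {q : ℝ≥0∞}
    (hq : p ≠ N → sobolevDualExponent N p ≤ q) (hqN : p = N → 1 < q) {f : 𝔼 N → ℝ}
    (hf : MemLp f q (volume.restrict Ω)) :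
    (∀ ξ ∈ sobolevZero Ω p, IntegrableOn (fun y => f y * ξ.1 y) Ω) ∧
    ∃ ℓ : sobolevZero Ω p →L[ℝ] ℝ, ∀ ξ, ℓ ξ = ∫ y in Ω, f y * ξ.1.1 y := by
  obtain ⟨C, hC⟩ := exists_setLIntegral_mul_le hN hp hb hq hqN hf
  have hC' : ∀ ξ ∈ sobolevZero Ω p, ∫⁻ y in Ω, ‖f y * ξ.1 y‖ₑ ≤ C * ‖ξ‖ₑ := fun ξ hξ => by
    simp_rw [enorm_mul]
    refine (hC ξ hξ).trans ?_
    gcongr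
    exact enorm_le_iff_norm_le.2 (norm_snd_le ξ)
  have hi : ∀ ξ ∈ sobolevZero Ω p, IntegrableOn (fun y => f y * ξ.1 y) Ω := fun ξ hξ =>
    ⟨hf.1.mul (Lp.aestronglyMeasurable ξ.1).restrict,
      (hC' ξ hξ).trans_lt (ENNReal.mul_lt_top ENNReal.coe_lt_top enorm_lt_top)⟩
  obtain ⟨L, hL⟩ := exists_linearMap_integral_mul hi
  have h1 : ∀ ξ, ‖L ξ‖ ≤ C * ‖ξ‖ := fun ξ => by
    have h1 : ‖L ξ‖ₑ ≤ (C : ℝ≥0∞) * ‖ξ.1‖ₑ := by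
      rw [hL]
      exact (enorm_integral_le_lintegral_enorm _).trans (hC' ξ.1 ξ.2)
    rw [enorm_eq_nnnorm, enorm_eq_nnnorm, ← ENNReal.coe_mul, ENNReal.coe_le_coe] at h1
    exact_mod_cast h1
  exact ⟨hi, L.mkContinuous C h1, hL⟩

theorem exists_gradientMap : ∃ T : sobolevZero Ω p →L[ℝ]
    Lp (𝔼 N) (ENNReal.ofReal p) (volume : Measure (𝔼 N)), ∀ x, T x = x.1.2 :=
  ⟨(ContinuousLinearMap.snd ℝ _ _).comp (sobolevZero Ω p).subtypeL, fun _ => rfl⟩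

set_option maxHeartbeats 1000000 in
theorem exists_isWeakSolution {s A : ℝ} (hN : 1 ≤ N) (hp : 1 < p) (hs0 : 0 < s) (hs1 : s < 1)
    (hA : 0 ≤ A) (hΩ : IsOpen Ω) (hΩ' : IsOpen Ω') (hb : Bornology.IsBounded Ω)
    (hb' : Bornology.IsBounded Ω') (hΩΩ' : closure Ω ⊆ Ω') {q : ℝ≥0∞}
    (hq : p ≠ N → sobolevDualExponent N p ≤ q) (hqN : p = N → 1 < q) {f : 𝔼 N → ℝ}
    (hf : MemLp f q (volume.restrict Ω)) {g : 𝔼 N → ℝ} (hg : MemW1p Ω' p g)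
    (hgt : MemTailSpace (p - 1) (s * p) g) :
    ∃ u, IsWeakSolution Ω p s A f g u := by
  have hp0 : 0 < p := by linarith
  have hα : 0 < s * p := mul_pos hs0 hp0
  have hαp : s * p < p := by nlinarith
  have hΩm := hΩ.measurableSet
  have hsub : Ω ⊆ Ω' := subset_closure.trans hΩΩ'
  obtain ⟨hgp, Dg, hDg', hDgp'⟩ := hg
  have hDg := hDg'.mono hsub
  have hDgp : MemLp Dg (ENNReal.ofReal p) (volume.restrict Ω) :=
    hDgp'.mono_measure (Measure.restrict_mono hsub le_rfl)
  have hgΩ : MemW1p Ω p g :=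
    ⟨hgp.mono_measure (Measure.restrict_mono hsub le_rfl), Dg, hDg, hDgp⟩
  obtain ⟨T₂, hT₂⟩ := exists_differenceMap (N := N) (Ω := Ω) hN hp hα hαp hΩm hb
  obtain ⟨C, hC⟩ := exists_lintegral_sub_rpow_mul_le hN hp hα hαp hΩ hΩ' hb hb' hΩΩ'
    ⟨hgp, Dg, hDg', hDgp'⟩ hgt
  obtain ⟨c, hc, hPoincare⟩ := sobolevZero_exists_norm_le (Ω := Ω) (p := p) hN hp hΩm hb
  obtain ⟨hfi, ℓ, hℓ⟩ := exists_loadFunctional hN hp hb hq hqN hf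
  obtain ⟨T₁, hT₁⟩ := exists_gradientMap (Ω := Ω) (p := p)
  have hb1 : MemLp (Ω.indicator Dg) (ENNReal.ofReal p) volume :=
    (memLp_indicator_iff_restrict hΩm).2 hDgp
  obtain ⟨b, hbD⟩ : ∃ b : Lp (𝔼 N) (ENNReal.ofReal p) (volume : Measure (𝔼 N)),
      b =ᵐ[volume] Ω.indicator Dg := ⟨hb1.toLp, hb1.coeFn_toLp⟩
  have ha : IsPairable p T₂ (fun z => g z.1 - g z.2) := by
    refine ⟨(AEStronglyMeasurable_sub_prod hgt.aestronglyMeasurable).mono_ac fracMeasure_ac, C,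
      fun ξ => ?_⟩
    refine le_trans (le_of_eq (lintegral_congr_ae ?_)) (hC ξ.1 ξ.2)
    filter_upwards [hT₂ ξ] with z hz
    rw [hz]
  -- Here `T₁` is the gradient, `T₂` the difference map, `b` the gradient of `g` cut off to `Ω`, and
  -- `a` the increment of `g`. Poincaré supplies the coercivity constant.
  obtain ⟨x, hx⟩ := exists_functional_add_eq hp T₁ T₂ b ha hA hc
    (fun ξ => (hPoincare ξ.1 ξ.2).trans_eq (by rw [hT₁])) ℓ
  refine ⟨fun y => g y + x.1.1 y, isWeakSolution_of_sobolevZero hΩ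
    (memW1pBdry_add hp hs0 hΩ hb hgΩ hgt x.2)
    (hDg.add ((sobolevZero_isWeakGradient hp x.2).mono (Set.subset_univ Ω))) fun ξ hξ => ?_⟩
  have e1 : (fun y => inner ℝ (pMap p (b y + T₁ x y)) (T₁ ⟨ξ, hξ⟩ y))
      =ᵐ[volume.restrict Ω] fun y => inner ℝ (pMap p (Dg y + x.1.2 y)) (ξ.2 y) := by
    filter_upwards [ae_restrict_of_ae hbD, ae_restrict_mem hΩm] with y hy hyΩ
    rw [hy, Set.indicator_of_mem hyΩ, hT₁, hT₁]
  have e1' : ∫ y in Ω, inner ℝ (pMap p (b y + T₁ x y)) (T₁ ⟨ξ, hξ⟩ y) =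
      ∫ y, inner ℝ (pMap p (b y + T₁ x y)) (T₁ ⟨ξ, hξ⟩ y) := by
    refine setIntegral_eq_integral_of_ae_compl_eq_zero ?_
    filter_upwards [(sobolevZero_ae_eq_zero hp0 hΩm hξ).2] with y hy hyΩ
    rw [hT₁ ⟨ξ, hξ⟩, hy hyΩ, inner_zero_right]
  have e2 : (fun z => inner ℝ (pMap p (g z.1 - g z.2 + T₂ x z)) (T₂ ⟨ξ, hξ⟩ z))
      =ᵐ[fracMeasure N (s * p)] fun z => inner ℝ (pMap p (g z.1 + x.1.1 z.1 - (g z.2 + x.1.1 z.2)))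
        (ξ.1 z.1 - ξ.1 z.2) := by
    filter_upwards [hT₂ x, hT₂ ⟨ξ, hξ⟩] with z h1 h2
    rw [h1, h2]
    congr 2
    ring
  have i1 := (((isPairable_coeFn hp T₁ b).add_coeFn hp x).integrable_inner hp
    ⟨ξ, hξ⟩).integrableOn (s := Ω)
  have i2 := (ha.add_coeFn hp x).integrable_inner hp ⟨ξ, hξ⟩
  refine ⟨i1.congr e1, i2.congr e2, hfi ξ hξ, ?_⟩
  rw [← integral_congr_ae e1, ← integral_congr_ae e2, e1', hx, hℓ]

theorem IsWeakSolution.ae_eq {s A : ℝ} (hN : 1 ≤ N) (hp : 1 < p) (hA : 0 ≤ A) (hΩ : IsOpen Ω)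
    (hb : Bornology.IsBounded Ω) {f g u v : 𝔼 N → ℝ} (hv : IsWeakSolution Ω p s A f g v)
    (hu : IsWeakSolution Ω p s A f g u) : v =ᵐ[volume] u := by
  have hΩm := hΩ.measurableSet
  obtain ⟨hvb, Dv, hDv, hv⟩ := hv
  obtain ⟨hub, Du, hDu, hu⟩ := hu
  obtain ⟨-, Gv, hGv, -⟩ := hvb.sub_mem
  obtain ⟨-, Gu, hGu, -⟩ := hub.sub_mem
  obtain ⟨ξv, hξv, hv1, -⟩ := hvb.sub_mem.exists_mem_sobolevZero hΩ hGv
  obtain ⟨ξu, hξu, hu1, -⟩ := hub.sub_mem.exists_mem_sobolevZero hΩ hGu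
  set ξ := ξv - ξu with hξdef
  have hξ : ξ ∈ sobolevZero Ω p := Submodule.sub_mem _ hξv hξu
  have hout : ∀ᵐ y, y ∉ Ω → v y = u y := by
    have h1 := hvb.eq_outside.trans hub.eq_outside.symm
    rwa [EventuallyEq, ae_restrict_iff' hΩm.compl] at h1
  have hξ1 : ξ.1 =ᵐ[volume] fun y => v y - u y := by
    filter_upwards [Lp.coeFn_sub ξv.1 ξu.1, hv1, hu1, hout] with y h1 h2 h3 h4
    rw [hξdef, Prod.fst_sub, h1, Pi.sub_apply, h2, h3]
    by_cases hy : y ∈ Ω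
    · simp [hy]
    · simp [hy, h4 hy]
  have hz := sobolevZero_ae_eq_zero (by linarith) hΩm hξ
  have hind : Ω.indicator ξ.1 =ᵐ[volume] fun y => v y - u y := by
    filter_upwards [hξ1, hz.1] with y h1 h2
    rw [← h1]
    by_cases hy : y ∈ Ω
    · simp [hy]
    · simp [hy, h2 hy]
  have hDξ := (sobolevZero_isWeakGradient hp hξ).mono (Set.subset_univ Ω)
  have hξ1' : ξ.1 =ᵐ[volume.restrict Ω] fun y => v y - u y := ae_restrict_of_ae hξ1
  have hξ2 : ξ.2 =ᵐ[volume.restrict Ω] fun y => Dv y - Du y :=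
    hDξ.ae_eq hΩ ((hDv.sub hDu).congr_ae hξ1'.symm EventuallyEq.rfl)
  -- Testing with `v - u` is legitimate, and the absolute convergence built into the definition
  -- allows the equations to be subtracted term by term.
  obtain ⟨iv1, iv2, -, ev⟩ := hv ξ.1 ξ.2 (sobolevZero_memW1pZero hp hξ) hDξ
  obtain ⟨iu1, iu2, -, eu⟩ := hu ξ.1 ξ.2 (sobolevZero_memW1pZero hp hξ) hDξ
  rw [integrable_nonlocalIntegrand_iff] at iv2 iu2
  rw [integral_nonlocalIntegrand] at ev eu
  have hloc : (fun y => localIntegrand p Dv ξ.2 y - localIntegrand p Du ξ.2 y)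
      =ᵐ[volume.restrict Ω] fun y => inner ℝ (pMap p (Dv y) - pMap p (Du y)) (Dv y - Du y) := by
    filter_upwards [hξ2] with y hy
    rw [localIntegrand, localIntegrand, ← inner_pMap_left, ← inner_pMap_left, hy, ← inner_sub_left]
  have hnl : 0 ≤ ∫ z, (inner ℝ (pMap p (v z.1 - v z.2)) (Ω.indicator ξ.1 z.1 - Ω.indicator ξ.1 z.2)
      - inner ℝ (pMap p (u z.1 - u z.2)) (Ω.indicator ξ.1 z.1 - Ω.indicator ξ.1 z.2))
      ∂fracMeasure N (s * p) := by
    refine integral_nonneg_of_ae ?_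
    filter_upwards [ae_fracMeasure_sub_eq hind] with z hz
    rw [hz, ← inner_sub_left, sub_sub_sub_comm]
    exact inner_pMap_sub_nonneg hp _ _
  rw [integral_sub iv2 iu2] at hnl
  -- The local and nonlocal differences are nonnegative and, with weight `A ≥ 0`, sum to zero.
  have hloc0 : ∫ y in Ω, inner ℝ (pMap p (Dv y) - pMap p (Du y)) (Dv y - Du y) = 0 := by
    refine le_antisymm ?_ (integral_nonneg fun y => inner_pMap_sub_nonneg hp _ _)
    rw [← integral_congr_ae hloc, integral_sub iv1 iu1]
    nlinarith
  have hD : ∀ᵐ y ∂volume.restrict Ω, Dv y = Du y := by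
    rw [integral_eq_zero_iff_of_nonneg (fun y => inner_pMap_sub_nonneg hp _ _)
      ((iv1.sub iu1).congr hloc)] at hloc0
    filter_upwards [hloc0] with y hy
    exact eq_of_inner_pMap_sub_eq_zero hp hy
  have hξ20 : ξ.2 = 0 := by
    rw [Lp.eq_zero_iff_ae_eq_zero]
    have h1 : ∀ᵐ y, y ∈ Ω → ξ.2 y = 0 := by
      rw [← ae_restrict_iff' hΩm]
      filter_upwards [hξ2, hD] with y h1 h2
      rw [h1, h2, sub_self]
    filter_upwards [h1, hz.2] with y h1 h2
    by_cases hy : y ∈ Ω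
    · exact h1 hy
    · exact h2 hy
  obtain ⟨c, hc, hP⟩ := sobolevZero_exists_norm_le (Ω := Ω) (p := p) hN hp hΩm hb
  have hξ0 : ξ = 0 := by
    have := hP ξ hξ
    rw [hξ20, norm_zero, mul_zero] at this
    exact norm_le_zero_iff.1 this
  filter_upwards [hξ1, Lp.coeFn_zero ℝ (ENNReal.ofReal p) (volume : Measure (𝔼 N))] with y h1 h2
  rw [hξ0, Prod.fst_zero, h2] at h1
  exact sub_eq_zero.1 h1.symm

end Boundary

theorem theorem1p1 (N : ℕ) (hN : 1 ≤ N) (p s A : ℝ) (hp : 1 < p) (hs0 : 0 < s) (hs1 : s < 1)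
    (hA : 0 < A) (Ω Ω' : Set (EuclideanSpace ℝ (Fin N)))
    (hΩ : IsOpen Ω) (hΩ' : IsOpen Ω') (hΩb : Bornology.IsBounded Ω)
    (hΩb' : Bornology.IsBounded Ω') (hΩΩ' : closure Ω ⊆ Ω')
    (q : ℝ≥0∞) (hq : p ≠ N → sobolevDualExponent N p ≤ q) (hqN : p = N → 1 < q)
    (f : EuclideanSpace ℝ (Fin N) → ℝ) (hf : MemLp f q (volume.restrict Ω))
    (g : EuclideanSpace ℝ (Fin N) → ℝ) (hg : MemW1p Ω' p g)
    (hgt : MemTailSpace (p - 1) (s * p) g) :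
    ∃ u : EuclideanSpace ℝ (Fin N) → ℝ, IsWeakSolution Ω p s A f g u ∧
      ∀ v : EuclideanSpace ℝ (Fin N) → ℝ, IsWeakSolution Ω p s A f g v → v =ᵐ[volume] u := by
  have : Fact (1 ≤ ENNReal.ofReal p) := ⟨ENNReal.one_le_ofReal.2 hp.le⟩
  obtain ⟨u, hu⟩ := exists_isWeakSolution hN hp hs0 hs1 hA.le hΩ hΩ' hΩb hΩb' hΩΩ' hq hqN hf hg hgt
  exact ⟨u, hu, fun v hv => hv.ae_eq hN hp hA.le hΩ hΩb hu⟩
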